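/- Notation. Let $V$ be a unitary operator (resp. let $\{U_t\}_{t\in\mathbb R}$ be a unitary flow, i.e. a strongly continuous one-parameter group of unitary operators) on a separable complex Hilbert space. It is unitarily equivalent to multiplication by $z$ (resp. by the functions $x\mapsto e^{itx}$, $t\in\mathbb R$) on $\bigoplus_{k\ge 0}L^2(\{x: m(x)>k\},\mu)$, where $\mu$ is a finite Borel measure on the unit circle (resp. on $\mathbb R$), the measure of maximal spectral type, and $m\ge 1$ is a measurable function with values in $\mathbb N\cup\{\infty\}$, the multiplicity function. The set of spectral multiplicities $\mathcal M(V)$ (resp. $\mathcal M(\{U_t\})$) is the set of essential values of $m$, i.e. of all $n\in\mathbb N\cup\{\infty\}$ with $\mu(\{m=n\})>0$. The spectrum is simple if there is a cyclic vector; the spectrum of a flow is singular if for every vector $h$ the spectral measure $\sigma_h$ on $\mathbb R$, given by $\langle U_th,h\rangle=\int e^{itx}\,d\sigma_h(x)$, is singular with respect to Lebesgue measure. A measure-preserving flow $\{G_t\}_{t\in\mathbb R}$ on a standard probability space $(\Omega,P)$ (group law modulo null sets, continuous in the weak topology on automorphisms) is Gaussian if there is a closed $\{G_t\}$-invariant subspace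 of the real space $L^2(\Omega,P)$ which consists of centered Gaussian variables and generates the $\sigma$-algebra modulo null sets; $\mathcal M(G_t)$ is the set of spectral multiplicities of the operator $f\mapsto f\circ G_t$ on the orthogonal complement $L^2_0(\Omega,P)$ of the constants in the complex space $L^2(\Omega,P)$. Assertion. Let $\{U_t\}$ be a unitary flow on a separable complex Hilbert space. 1. If $\{U_t\}$ has simple singular spectrum, then for almost every $t\in\mathbb R$ the operator $U_t$ has simple spectrum. 2. If $\{U_t\}$ has singular spectrum, then $\mathcal M(U_t)=\mathcal M(\{U_t\})$ for almost every $t\in\mathbb R$. 3. For every Gaussian flow $\{G_t\}$ the set $\mathcal M(G_t)$ is constant almost everywhere: there is a set $S\subset\mathbb N\cup\{\infty\}$ such that $\mathcal M(G_t)=S$ for almost every $t\in\mathbb R$. -/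

import Mathlib

open MeasureTheory ProbabilityTheory Filter Topology
open scoped ENNReal

noncomputable section

/-! ### Spectral multiplicities -/

instance : MeasurableSpace Circle := borel Circle

instance : BorelSpace Circle := ⟨rfl⟩

section Spectral

variable {H : Type*} [NormedAddCommGroup H] [InnerProductSpace ℂ H]

/-- The Hilbert space `⨁_{k ∈ ℕ} L²({x | k < m x}, μ)`, i.e. the direct integral over `(X, μ)` of
Hilbert spaces of dimension `m x ∈ {0, 1, 2, …, ∞}`. -/
abbrev MultiplicitySpace {X : Type*} [MeasurableSpace X] (μ : Measure X) (m : X → ℕ∞) : Type _ :=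
  lp (fun k : ℕ => Lp ℂ 2 (μ.restrict {x | (k : ℕ∞) < m x})) 2

/-- The pair `(μ, m)` represents the family of unitary operators `V i`: there is a unitary
equivalence of `H` with `⨁_k L²({k < m}, μ)` which takes each `V i` to the operator of
multiplication by the function `χ i`.  As `m ≥ 1`, `μ` is a measure of maximal spectral type and
`m` is the spectral multiplicity function. -/
structure IsSpectralModel {ι X : Type*} [MeasurableSpace X] (χ : ι → X → ℂ)
    (V : ι → H ≃ₗᵢ[ℂ] H) (μ : Measure X) (m : X → ℕ∞) : Prop where
  finite : IsFiniteMeasure μ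
  measurable : Measurable m
  one_le : ∀ x, 1 ≤ m x
  exists_equiv : ∃ W : H ≃ₗᵢ[ℂ] MultiplicitySpace μ m, ∀ (i : ι) (h : H) (k : ℕ),
    ((W (V i h) k : Lp ℂ 2 (μ.restrict {x | (k : ℕ∞) < m x})) : X → ℂ)
      =ᵐ[μ.restrict {x | (k : ℕ∞) < m x}]
    fun x => χ i x * (W h k : Lp ℂ 2 (μ.restrict {x | (k : ℕ∞) < m x})) x

/-- The set of essential values of the spectral multiplicity function of the family `V`. -/
def essentialMultiplicities {ι X : Type*} [MeasurableSpace X] (χ : ι → X → ℂ)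
    (V : ι → H ≃ₗᵢ[ℂ] H) : Set ℕ∞ :=
  {n | ∃ (μ : Measure X) (m : X → ℕ∞), IsSpectralModel χ V μ m ∧ μ {x | m x = n} ≠ 0}

/-- The set `M(V)` of spectral multiplicities of a unitary operator `V`, which is represented as
multiplication by `z` over the unit circle. -/
def multiplicitySet (V : H ≃ₗᵢ[ℂ] H) : Set ℕ∞ :=
  essentialMultiplicities (fun (_ : Unit) (z : Circle) => (z : ℂ)) (fun _ => V)

/-- A unitary operator has simple spectrum if it has a cyclic vector. -/
def HasSimpleSpectrum (V : H ≃ₗᵢ[ℂ] H) : Prop :=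
  ∃ h : H, (Submodule.span ℂ (Set.range fun n : ℤ => (V ^ n) h)).topologicalClosure = ⊤

variable (H) in
/-- A unitary flow: a strongly continuous one-parameter group of unitary operators. -/
structure UnitaryFlow where
  toFun : ℝ → H ≃ₗᵢ[ℂ] H
  map_zero : ∀ h, toFun 0 h = h
  map_add : ∀ s t h, toFun (s + t) h = toFun s (toFun t h)
  continuous : ∀ h, Continuous fun t => toFun t h

namespace UnitaryFlow

/-- The set `M({U_t})` of spectral multiplicities of a unitary flow, where `U_t` is represented as
multiplication by `x ↦ exp (i t x)` over the real line. -/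
def multiplicitySet (U : UnitaryFlow H) : Set ℕ∞ :=
  essentialMultiplicities (fun (t : ℝ) (x : ℝ) => Complex.exp (t * x * Complex.I)) U.toFun

/-- A unitary flow has simple spectrum if it has a cyclic vector. -/
def HasSimpleSpectrum (U : UnitaryFlow H) : Prop :=
  ∃ h : H, (Submodule.span ℂ (Set.range fun t : ℝ => U.toFun t h)).topologicalClosure = ⊤

/-- `σ` is the spectral measure of the vector `h`: `⟨U_t h, h⟩ = ∫ exp (i t x) dσ(x)`.
(Mathlib's inner product is conjugate-linear in its first argument.) -/
def IsSpectralMeasure (U : UnitaryFlow H) (h : H) (σ : Measure ℝ) : Prop :=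
  IsFiniteMeasure σ ∧
    ∀ t : ℝ, inner ℂ h (U.toFun t h) = ∫ x : ℝ, Complex.exp (t * x * Complex.I) ∂σ

/-- The flow has singular spectrum: all its spectral measures (equivalently, a spectral measure of
maximal type) are singular with respect to Lebesgue measure. -/
def HasSingularSpectrum (U : UnitaryFlow H) : Prop :=
  ∀ h : H, ∃ σ : Measure ℝ, U.IsSpectralMeasure h σ ∧ σ ⟂ₘ (volume : Measure ℝ)

end UnitaryFlow

end Spectral

/-! ### Gaussian flows -/

section Gaussian

variable {Ω : Type*} [MeasurableSpace Ω]

/-- A flow of automorphisms of `(Ω, P)` (as usual the group law holds modulo null sets), which is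
continuous in the weak topology of the group of automorphisms. -/
structure MeasurePreservingFlow (P : Measure Ω) where
  toFun : ℝ → Ω → Ω
  measurePreserving : ∀ t, MeasurePreserving (toFun t) P P
  map_zero : toFun 0 =ᵐ[P] id
  map_add : ∀ s t, toFun (s + t) =ᵐ[P] toFun s ∘ toFun t
  continuous : ∀ A, MeasurableSet A →
    Tendsto (fun t => P (symmDiff (toFun t ⁻¹' A) A)) (𝓝 0) (𝓝 0)

/-- `L²₀(Ω, P)`, the orthogonal complement of the constants in the complex space `L²(Ω, P)`. -/
abbrev L2Zero (P : Measure Ω) [IsFiniteMeasure P] : Submodule ℂ (Lp ℂ 2 P) :=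
  (Submodule.span ℂ {Lp.const 2 P (1 : ℂ)})ᗮ

namespace MeasurePreservingFlow

variable {P : Measure Ω} (G : MeasurePreservingFlow P)

/-- The Koopman operator `f ↦ f ∘ G_t` on the complex space `L²(Ω, P)`. -/
def koopman (t : ℝ) : Lp ℂ 2 P →ₗᵢ[ℂ] Lp ℂ 2 P :=
  Lp.compMeasurePreservingₗᵢ ℂ (G.toFun t) (G.measurePreserving t)

theorem koopman_ae (t : ℝ) (f : Lp ℂ 2 P) : G.koopman t f =ᵐ[P] f ∘ G.toFun t :=
  Lp.coeFn_compMeasurePreserving f (G.measurePreserving t)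

theorem koopman_add (s t : ℝ) (f : Lp ℂ 2 P) :
    G.koopman t (G.koopman s f) = G.koopman (s + t) f := by
  apply Lp.ext
  have h1 := (G.measurePreserving t).quasiMeasurePreserving.ae_eq_comp (G.koopman_ae s f)
  filter_upwards [G.koopman_ae t (G.koopman s f), h1, G.koopman_ae (s + t) f, G.map_add s t]
    with x a b c d
  rw [a, b, c]
  simp only [Function.comp_apply] at d ⊢
  rw [d]

theorem koopman_zero (f : Lp ℂ 2 P) : G.koopman 0 f = f := by
  apply Lp.ext
  filter_upwards [G.koopman_ae 0 f, G.map_zero] with x a b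
  rw [a, Function.comp_apply, b, id]

theorem koopman_const [IsFiniteMeasure P] (t : ℝ) :
    G.koopman t (Lp.const 2 P (1 : ℂ)) = Lp.const 2 P (1 : ℂ) := rfl

theorem koopman_mem [IsFiniteMeasure P] (t : ℝ) {f : Lp ℂ 2 P} (hf : f ∈ L2Zero P) :
    G.koopman t f ∈ L2Zero P := by
  rw [Submodule.mem_orthogonal_singleton_iff_inner_right] at hf ⊢
  rw [← G.koopman_const t, LinearIsometry.inner_map_map, hf]

/-- The unitary Koopman operator `f ↦ f ∘ G_t` on `L²₀(Ω, P)`. -/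
def koopmanZero [IsFiniteMeasure P] (t : ℝ) : L2Zero P ≃ₗᵢ[ℂ] L2Zero P where
  toFun f := ⟨G.koopman t f, G.koopman_mem t f.2⟩
  invFun f := ⟨G.koopman (-t) f, G.koopman_mem (-t) f.2⟩
  map_add' f g := by ext1; simp
  map_smul' c f := by ext1; simp
  left_inv f := by ext1; simp [koopman_add, koopman_zero]
  right_inv f := by ext1; simp [koopman_add, koopman_zero]
  norm_map' f := (G.koopman t).norm_map f

/-- A flow is Gaussian if some invariant closed subspace `V` of the real space `L²(Ω, P)` consists
of centered Gaussian random variables and generates the σ-algebra modulo null sets. -/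
def IsGaussian : Prop :=
  ∃ V : Submodule ℝ (Lp ℝ 2 P),
    IsClosed (V : Set (Lp ℝ 2 P)) ∧
    (∀ f ∈ V, ∃ v : NNReal, P.map (f : Ω → ℝ) = gaussianReal 0 v) ∧
    (∀ t, ∀ f ∈ V, Lp.compMeasurePreserving (G.toFun t) (G.measurePreserving t) f ∈ V) ∧
    ∀ A, MeasurableSet A → ∃ B,
      MeasurableSet[⨆ f ∈ V, MeasurableSpace.comap (f : Ω → ℝ) inferInstance] B ∧ A =ᵐ[P] B

/-- The set `M(G_t)` of spectral multiplicities of the automorphism `G_t`, i.e. of its Koopman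
operator on `L²₀(Ω, P)`. -/
def multiplicitySet [IsFiniteMeasure P] (t : ℝ) : Set ℕ∞ :=
  _root_.multiplicitySet (G.koopmanZero t)

end MeasurePreservingFlow

end Gaussian

end

/-! In the spectral picture of a flow, `U_t` is multiplication by `exp (i t x)`. So the spectral
picture of the single operator `U_t` is obtained by folding the line onto the circle along `x ↦ exp
(i t x)`. Folding changes multiplicities only where several points `x + 2πk/t` of the spectrum are
superposed.

Let `N` be a Lebesgue null set. For fixed `x` and `k ≠ 0`, the parameters `t` with `x - 2πk/t ∈ N`
lie in a smooth image of `N \ {x}`, apart from `t = 0`, and hence form a null set. By Fubini, for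
almost every `t`, almost no point `x` of the spectrum has a further translate `x - 2πk/t` in `N`
(`ae_forall_sub_notMem`). If the spectrum is singular, it is carried by such an `N`. The folding is
then injective on a set of full measure, so a cyclic vector stays cyclic and the multiplicity
function is merely transported. More generally, `ae_multiplicitySet_eq` allows spectrum outside `N`,
provided that its multiplicity is infinite: superposition cannot change infinity, and almost no
point outside `N` is folded onto the isolated points of `N`.

For a Gaussian flow this condition always holds, with `N` a null set carrying the singular part of
the maximal spectral type. The vectors `exp(‖f‖²/2) exp(i f) - 1`, for `f` in the Gaussian space,
are total in `L²₀` and have spectral measures `∑ σ^{*l} / l!` (`l ≥ 1`), where `σ` is the spectral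
measure of `f`. If all convolution powers of all these `σ` are singular, there is no spectrum
outside `N`. Otherwise some power of a symmetric `σ` is not singular. By a Steinhaus argument its
square dominates Lebesgue measure near `0`, and further powers dominate it on ever larger intervals.
Almost every point of the absolutely continuous part is then seen by infinitely many powers. A
Vandermonde argument applied to the multiples `f, 2f, …, nf` shows that the multiplicity there is at
least `n` for each `n` (`IsSpectralModel.ae_eq_top_of_wick`).

The supporting theory is developed for an arbitrary group of characters, so that the same results
serve the line and the circle: existence of a spectral model, its uniqueness, and Bochner's theorem
for flows. -/

/-! ### Character systems -/

/-- A group of measurable unimodular functions on `X`, indexed by the additive group `ι`, which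
separates the finite measures on `X`. -/
structure IsCharacterSystem {ι X : Type*} [AddCommGroup ι] [MeasurableSpace X]
    (χ : ι → X → ℂ) : Prop where
  measurable : ∀ i, Measurable (χ i)
  norm_eq : ∀ i x, ‖χ i x‖ = 1
  map_zero : ∀ x, χ 0 x = 1
  map_add : ∀ i j x, χ (i + j) x = χ i x * χ j x
  ext : ∀ (μ ν : Measure X), IsFiniteMeasure μ → IsFiniteMeasure ν →
    (∀ i, ∫ x, χ i x ∂μ = ∫ x, χ i x ∂ν) → μ = ν

namespace IsCharacterSystem

variable {ι X : Type*} [AddCommGroup ι] [MeasurableSpace X] {χ : ι → X → ℂ}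

theorem map_neg (hχ : IsCharacterSystem χ) (i : ι) (x : X) :
    χ (-i) x = starRingEnd ℂ (χ i x) := by
  have h1 : χ i x * χ (-i) x = 1 := by rw [← hχ.map_add, add_neg_cancel, hχ.map_zero]
  have h2 : χ i x * starRingEnd ℂ (χ i x) = 1 := by
    rw [Complex.mul_conj, Complex.normSq_eq_norm_sq, hχ.norm_eq]; simp
  have h3 : χ i x ≠ 0 := by rw [← norm_ne_zero_iff, hχ.norm_eq]; exact one_ne_zero
  exact mul_left_cancel₀ h3 (h1.trans h2.symm)

theorem integrable_mul (hχ : IsCharacterSystem χ) {μ : Measure X} {g : X → ℂ}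
    (hg : Integrable g μ) (i : ι) : Integrable (fun x => χ i x * g x) μ :=
  hg.bdd_mul (c := 1) (hχ.measurable i).aestronglyMeasurable
    (Eventually.of_forall fun x => (hχ.norm_eq i x).le)

theorem integrable (hχ : IsCharacterSystem χ) (μ : Measure X) [IsFiniteMeasure μ] (i : ι) :
    Integrable (χ i) μ := by
  simpa using hχ.integrable_mul (integrable_const (1 : ℂ)) i

theorem ae_eq_zero_real (hχ : IsCharacterSystem χ) {μ : Measure X} {a : X → ℝ}
    (ha : Integrable a μ) (h : ∀ i, ∫ x, χ i x * (a x : ℂ) ∂μ = 0) : a =ᵐ[μ] 0 := by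
  have key : ∀ b : X → ℝ, Integrable b μ → ∀ i,
      ∫ x, χ i x ∂(μ.withDensity fun x => ENNReal.ofReal (b x))
        = ∫ x, χ i x * ((max (b x) 0 : ℝ) : ℂ) ∂μ := by
    intro b hb i
    rw [integral_withDensity_eq_integral_toReal_smul₀ hb.aemeasurable.ennreal_ofReal
      (Eventually.of_forall fun x => ENNReal.ofReal_lt_top)]
    congr 1 with x
    rw [ENNReal.toReal_ofReal', Complex.real_smul, mul_comm]
  have hfin : ∀ b : X → ℝ, Integrable b μ →
      IsFiniteMeasure (μ.withDensity fun x => ENNReal.ofReal (b x)) := fun b hb =>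
    isFiniteMeasure_withDensity (hb.lintegral_lt_top).ne
  have heq := hχ.ext _ _ (hfin a ha) (hfin (-a) ha.neg) (fun i => by
    rw [key a ha, key (-a) ha.neg, ← sub_eq_zero, ← integral_sub, ← h i]
    · congr 1 with x
      rw [← mul_sub, ← Complex.ofReal_sub]
      congr 2
      rcases le_total (a x) 0 with h | h <;> simp [h]
    · exact hχ.integrable_mul (ha.pos_part.ofReal) i
    · exact hχ.integrable_mul (ha.neg.pos_part.ofReal) i)
  rw [withDensity_eq_iff ha.aemeasurable.ennreal_ofReal ha.neg.aemeasurable.ennreal_ofReal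
    ha.lintegral_lt_top.ne] at heq
  filter_upwards [heq] with x hx
  rcases le_total (a x) 0 with h0 | h0
  · rw [ENNReal.ofReal_of_nonpos h0, eq_comm, ENNReal.ofReal_eq_zero] at hx
    simp only [Pi.neg_apply, Pi.zero_apply] at hx ⊢
    linarith
  · have h1 : (-a) x ≤ 0 := by simpa using h0
    rw [ENNReal.ofReal_of_nonpos h1, ENNReal.ofReal_eq_zero] at hx
    exact le_antisymm hx h0

/-- An integrable function is determined by its integrals against the characters. -/
theorem ae_eq_zero (hχ : IsCharacterSystem χ) {μ : Measure X} {g : X → ℂ}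
    (hg : Integrable g μ) (h : ∀ i, ∫ x, χ i x * g x ∂μ = 0) : g =ᵐ[μ] 0 := by
  have hconj : ∀ i, ∫ x, χ i x * starRingEnd ℂ (g x) ∂μ = 0 := by
    intro i
    have h1 := congrArg (starRingEnd ℂ) (h (-i))
    rw [← integral_conj, _root_.map_zero] at h1
    simpa [hχ.map_neg] using h1
  have hgc : Integrable (fun x => starRingEnd ℂ (g x)) μ :=
    (LinearIsometryEquiv.integrable_comp_iff Complex.conjLIE).2 hg
  have hre := hχ.ae_eq_zero_real hg.re (fun i => by
    have : ∀ x, χ i x * ((RCLike.re (g x) : ℝ) : ℂ)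
        = (χ i x * g x + χ i x * starRingEnd ℂ (g x)) * (1 / 2) := by
      intro x
      rw [← mul_add, Complex.add_conj]
      simp; ring
    simp_rw [this]
    rw [integral_mul_const, integral_add (hχ.integrable_mul hg i) (hχ.integrable_mul hgc i),
      h, hconj]
    simp)
  have him := hχ.ae_eq_zero_real hg.im (fun i => by
    have : ∀ x, χ i x * ((RCLike.im (g x) : ℝ) : ℂ)
        = (χ i x * g x - χ i x * starRingEnd ℂ (g x)) * (1 / (2 * Complex.I)) := by
      intro x
      rw [← mul_sub, Complex.sub_conj]
      have := Complex.I_ne_zero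
      simp only [RCLike.im_to_complex]
      field_simp
      push_cast
      ring
    simp_rw [this]
    rw [integral_mul_const, integral_sub (hχ.integrable_mul hg i) (hχ.integrable_mul hgc i),
      h, hconj]
    simp)
  filter_upwards [hre, him] with x h1 h2
  exact Complex.ext h1 h2

theorem ae_eq (hχ : IsCharacterSystem χ) {μ : Measure X} {f g : X → ℂ}
    (hf : Integrable f μ) (hg : Integrable g μ)
    (h : ∀ i, ∫ x, χ i x * f x ∂μ = ∫ x, χ i x * g x ∂μ) : f =ᵐ[μ] g := by
  have := hχ.ae_eq_zero (hf.sub hg) (fun i => by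
    simp only [Pi.sub_apply, mul_sub]
    rw [integral_sub (hχ.integrable_mul hf i) (hχ.integrable_mul hg i), h, sub_self])
  filter_upwards [this] with x hx
  exact sub_eq_zero.1 hx

/-- If a finite measure `σ` has the same integrals against the characters as `G μ`, then `σ` is
absolutely continuous and `G` is its density. -/
theorem absolutelyContinuous_and_ae_eq (hχ : IsCharacterSystem χ) {μ σ : Measure X}
    [IsFiniteMeasure μ] [IsFiniteMeasure σ] {G : X → ℂ} (hG : Integrable G μ)
    (h : ∀ i, ∫ x, χ i x ∂σ = ∫ x, χ i x * G x ∂μ) :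
    σ ≪ μ ∧ G =ᵐ[μ] fun x => ((σ.rnDeriv μ x).toReal : ℂ) := by
  classical
  obtain ⟨N, hN, hN1, hN2⟩ := Measure.mutuallySingular_singularPart σ μ
  -- `σ.singularPart μ` lives on `Nᶜ`, `μ` on `N`
  set s := σ.singularPart μ
  have hs1 : ∀ᵐ x ∂s, x ∉ N := by rw [ae_iff]; simpa using hN1
  have hm1 : ∀ᵐ x ∂μ, x ∈ N := by rw [ae_iff]; exact hN2
  have hρ : Integrable (fun x => ((σ.rnDeriv μ x).toReal : ℂ)) μ :=
    (Measure.integrable_toReal_rnDeriv (μ := σ) (ν := μ)).ofReal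
  -- One function tests both parts: on `N` it is the difference of the two densities, off `N` the
  -- constant 1, which detects the singular part. Its integrals against the characters over `μ + s`
  -- vanish, so it is zero for both measures.
  set g : X → ℂ := fun x => if x ∈ N then ((σ.rnDeriv μ x).toReal : ℂ) - G x else 1
  have hgμ : g =ᵐ[μ] fun x => ((σ.rnDeriv μ x).toReal : ℂ) - G x := by
    filter_upwards [hm1] with x hx
    simp [g, hx]
  have hgs : g =ᵐ[s] fun _ => 1 := by
    filter_upwards [hs1] with x hx
    simp [g, hx]
  have hgμi : Integrable g μ := (hρ.sub hG).congr hgμ.symm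
  have hgsi : Integrable g s := (integrable_const (1 : ℂ)).congr hgs.symm
  have hg0 : g =ᵐ[μ + s] 0 := hχ.ae_eq_zero (hgμi.add_measure hgsi) (fun i => by
    rw [integral_add_measure (hχ.integrable_mul hgμi i) (hχ.integrable_mul hgsi i)]
    have e1 : ∫ x, χ i x * g x ∂μ
        = ∫ x, χ i x * ((σ.rnDeriv μ x).toReal : ℂ) ∂μ - ∫ x, χ i x ∂σ := by
      rw [h, ← integral_sub (hχ.integrable_mul hρ i) (hχ.integrable_mul hG i)]
      refine integral_congr_ae ?_
      filter_upwards [hgμ] with x hx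
      rw [hx, mul_sub]
    have e2 : ∫ x, χ i x * g x ∂s = ∫ x, χ i x ∂s := by
      refine integral_congr_ae ?_
      filter_upwards [hgs] with x hx
      rw [hx, mul_one]
    have e3 : ∫ x, χ i x ∂σ = ∫ x, χ i x ∂s + ∫ x, χ i x * ((σ.rnDeriv μ x).toReal : ℂ) ∂μ := by
      conv_lhs => rw [Measure.haveLebesgueDecomposition_add σ μ]
      rw [integral_add_measure (hχ.integrable _ i)
        ((hχ.integrable σ i).mono_measure (Measure.withDensity_rnDeriv_le σ μ)),
        integral_withDensity_eq_integral_toReal_smul (Measure.measurable_rnDeriv _ _)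
          (Measure.rnDeriv_lt_top σ μ)]
      congr 2 with x
      rw [Complex.real_smul, mul_comm]
    rw [e1, e2, e3]; ring)
  rw [Filter.EventuallyEq, ae_add_measure_iff] at hg0
  constructor
  · rw [← Measure.singularPart_eq_zero]
    have : ∀ᵐ x ∂s, False := by
      filter_upwards [hg0.2, hgs] with x h1 h2
      rw [h1] at h2
      simp at h2
    simpa [ae_iff] using this
  · filter_upwards [hg0.1, hgμ] with x h1 h2
    rw [h1] at h2
    exact (sub_eq_zero.1 h2.symm).symm

end IsCharacterSystem

theorem isCharacterSystem_real :
    IsCharacterSystem (fun (t : ℝ) (x : ℝ) => Complex.exp (t * x * Complex.I)) where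
  measurable i := by fun_prop
  norm_eq i x := by
    rw [← Complex.ofReal_mul]; exact Complex.norm_exp_ofReal_mul_I _
  map_zero x := by simp
  map_add i j x := by rw [← Complex.exp_add]; push_cast; ring_nf
  ext μ ν hμ hν h := by
    refine Measure.ext_of_charFun (funext fun t => ?_)
    rw [charFun_apply_real, charFun_apply_real, h]

/-- Trigonometric polynomials are uniformly dense in the continuous functions, both integrals are
continuous for the sup norm, and continuous functions determine a finite measure. -/
theorem isCharacterSystem_circle :
    IsCharacterSystem (fun (n : ℤ) (z : Circle) => (z : ℂ) ^ n) where
  measurable n := by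
    refine Continuous.measurable ?_
    simp_rw [← Circle.coe_zpow]
    exact continuous_subtype_val.comp (continuous_zpow n)
  norm_eq i x := by rw [norm_zpow, Circle.norm_coe, one_zpow]
  map_zero x := by simp
  map_add i j x := zpow_add₀ (by simp) _ _
  ext μ ν hμ hν h := by
    let e : AddCircle (1 : ℝ) ≃ₜ Circle := AddCircle.homeomorphCircle one_ne_zero
    have hint : ∀ (ρ : Measure Circle) [IsFiniteMeasure ρ] (f : C(AddCircle (1 : ℝ), ℂ)),
        Integrable (fun z => f (e.symm z)) ρ := fun ρ _ f =>
      Integrable.of_bound (f.continuous.comp e.symm.continuous).aestronglyMeasurable ‖f‖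
        (Eventually.of_forall fun z => f.norm_coe_le_norm _)
    have hlip : ∀ (ρ : Measure Circle) [IsFiniteMeasure ρ],
        Continuous fun f : C(AddCircle (1 : ℝ), ℂ) => ∫ z, f (e.symm z) ∂ρ := by
      intro ρ _
      refine (LipschitzWith.of_dist_le_mul (K := (ρ Set.univ).toNNReal) fun f g => ?_).continuous
      rw [dist_eq_norm, dist_eq_norm, ← integral_sub (hint ρ f) (hint ρ g)]
      refine (norm_integral_le_of_norm_le_const (C := ‖f - g‖)
        (Eventually.of_forall fun z => (f - g).norm_coe_le_norm _)).trans ?_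
      rw [mul_comm]; rfl
    have hall : ∀ f : C(AddCircle (1 : ℝ), ℂ),
        ∫ z, f (e.symm z) ∂μ = ∫ z, f (e.symm z) ∂ν := by
      intro f
      have hf : f ∈ (Submodule.span ℂ (Set.range (fourier (T := 1)))).topologicalClosure := by
        rw [span_fourier_closure_eq_top]; trivial
      have hcl : IsClosed {f : C(AddCircle (1 : ℝ), ℂ) |
          ∫ z, f (e.symm z) ∂μ = ∫ z, f (e.symm z) ∂ν} := isClosed_eq (hlip μ) (hlip ν)
      refine closure_minimal (s := ((Submodule.span ℂ (Set.range (fourier (T := 1))) : Submodule ℂ C(AddCircle (1 : ℝ), ℂ)) :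
        Set C(AddCircle (1 : ℝ), ℂ))) ?_ hcl hf
      intro g hg
      induction hg using Submodule.span_induction with
      | mem g hg =>
        obtain ⟨n, rfl⟩ := hg
        have : ∀ z, fourier n (e.symm z) = (z : ℂ) ^ n := by
          intro z
          rw [fourier_apply, AddCircle.toCircle_zsmul, Circle.coe_zpow]
          congr 2
          rw [← AddCircle.homeomorphCircle_apply one_ne_zero]
          exact e.apply_symm_apply z
        simp only [Set.mem_ofPred_eq, this]
        exact h n
      | zero => simp
      | add f g _ _ hf hg =>
        simp only [Set.mem_ofPred_eq, ContinuousMap.add_apply] at *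
        rw [integral_add (hint μ f) (hint μ g), integral_add (hint ν f) (hint ν g), hf, hg]
      | smul c f _ hf =>
        simp only [Set.mem_ofPred_eq, ContinuousMap.smul_apply] at *
        rw [integral_smul, integral_smul, hf]
    refine ext_of_forall_integral_eq_of_IsFiniteMeasure fun f => ?_
    have h1 := hall ⟨fun x => (f (e x) : ℂ), by fun_prop⟩
    simp only [ContinuousMap.coe_mk, Homeomorph.apply_symm_apply, integral_complex_ofReal] at h1
    exact_mod_cast h1

/-! ### Cyclic families -/

section CyclicFamily

/-- Two families with equal Gram matrices, the first of which is total, are related by a linear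
isometry. -/
theorem exists_linearIsometry_of_inner_eq {κ E F : Type*} [NormedAddCommGroup E]
    [InnerProductSpace ℂ E] [CompleteSpace E] [NormedAddCommGroup F] [InnerProductSpace ℂ F]
    [CompleteSpace F] (u : κ → E) (v : κ → F) (h : ∀ i j, inner ℂ (u i) (u j) = inner ℂ (v i) (v j))
    (hu : ∀ x, (∀ i, inner ℂ (u i) x = 0) → x = 0) :
    ∃ T : E →ₗᵢ[ℂ] F, ∀ i, T (u i) = v i := by
  let e := Finsupp.linearCombination ℂ u
  let f := Finsupp.linearCombination ℂ v
  have hn : ∀ c, ‖f c‖ = ‖e c‖ := by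
    intro c
    have : inner ℂ (f c) (f c) = inner ℂ (e c) (e c) := by
      simp only [e, f, Finsupp.linearCombination_apply, Finsupp.sum, sum_inner, inner_sum,
        inner_smul_left, inner_smul_right, h]
    rw [← sq_eq_sq₀ (norm_nonneg _) (norm_nonneg _), ← inner_self_eq_norm_sq (𝕜 := ℂ),
      ← inner_self_eq_norm_sq (𝕜 := ℂ), this]
  have hd : DenseRange e := by
    have h1 : (LinearMap.range e).topologicalClosure = ⊤ := by
      rw [Submodule.topologicalClosure_eq_top_iff, Submodule.eq_bot_iff]
      intro x hx
      refine hu x fun i => ?_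
      refine (Submodule.mem_orthogonal _ _).1 hx _ ⟨Finsupp.single i 1, ?_⟩
      simp [e]
    rw [DenseRange, dense_iff_closure_eq]
    have h2 := congrArg (fun K : Submodule ℂ E => (K : Set E)) h1
    simpa [Submodule.topologicalClosure_coe, LinearMap.coe_range] using h2
  have hex : ∃ C : ℝ, ∀ c, ‖f c‖ ≤ C * ‖e c‖ := ⟨1, fun c => by rw [one_mul, hn]⟩
  let T := f.extendOfNorm e
  have hT : ∀ c, T (e c) = f c := LinearMap.extendOfNorm_eq hd hex
  refine ⟨⟨T.toLinearMap, fun x => ?_⟩, fun i => ?_⟩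
  · exact hd.induction_on (p := fun x => ‖T x‖ = ‖x‖) x
      (isClosed_eq (by fun_prop) (by fun_prop)) fun c => by rw [hT, hn]
  · have := hT (Finsupp.single i 1)
    simpa [e, f] using this

variable {H : Type*} [NormedAddCommGroup H] [InnerProductSpace ℂ H]

/-- A unitary representation of an additive group. -/
structure IsUnitaryRep {ι : Type*} [AddCommGroup ι] (V : ι → H ≃ₗᵢ[ℂ] H) : Prop where
  map_zero : ∀ h, V 0 h = h
  map_add : ∀ i j h, V (i + j) h = V i (V j h)

theorem IsUnitaryRep.inner_map_map {ι : Type*} [AddCommGroup ι] {V : ι → H ≃ₗᵢ[ℂ] H}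
    (hV : IsUnitaryRep V) (i j : ι) (g h : H) :
    inner ℂ (V i g) (V j h) = inner ℂ g (V (j - i) h) := by
  rw [← (V i).inner_map_map g, ← hV.map_add, add_sub_cancel]

variable {ι X : Type*} [AddCommGroup ι] [MeasurableSpace X]

/-- Vectors `f a` with spectral measures `σ a`, whose cyclic subspaces are mutually orthogonal and
span the whole space. -/
structure IsCyclicFamily {κ : Type*} (χ : ι → X → ℂ) (V : ι → H ≃ₗᵢ[ℂ] H) (σ : κ → Measure X)
    (f : κ → H) : Prop where
  finite : ∀ a, IsFiniteMeasure (σ a)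
  inner_self : ∀ a i, inner ℂ (f a) (V i (f a)) = ∫ x, χ i x ∂σ a
  inner_ne : ∀ a b i, a ≠ b → inner ℂ (f a) (V i (f b)) = 0
  total : ∀ g, (∀ a i, inner ℂ (V i (f a)) g = 0) → g = 0

/-- A unitary equivalence with `⨁ L²(σ a)` which takes `V i` to multiplication by `χ i`. -/
def Intertwines {κ : Type*} (χ : ι → X → ℂ) (V : ι → H ≃ₗᵢ[ℂ] H) (σ : κ → Measure X)
    (W : H ≃ₗᵢ[ℂ] lp (fun a => Lp ℂ 2 (σ a)) 2) : Prop :=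
  ∀ i h a, (W (V i h) a : X → ℂ) =ᵐ[σ a] fun x => χ i x * W h a x

variable {χ : ι → X → ℂ} {V : ι → H ≃ₗᵢ[ℂ] H}

theorem IsCharacterSystem.memLp (hχ : IsCharacterSystem χ) (σ : Measure X) [IsFiniteMeasure σ]
    (i : ι) : MemLp (χ i) 2 σ :=
  MemLp.of_bound (hχ.measurable i).aestronglyMeasurable 1
    (Eventually.of_forall fun x => (hχ.norm_eq i x).le)

theorem IsCharacterSystem.inner_toLp (hχ : IsCharacterSystem χ) {σ : Measure X} [IsFiniteMeasure σ]
    (i : ι) (u : Lp ℂ 2 σ) : inner ℂ ((hχ.memLp σ i).toLp _) u = ∫ x, χ (-i) x * u x ∂σ := by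
  rw [L2.inner_def]
  refine integral_congr_ae ?_
  filter_upwards [(hχ.memLp σ i).coeFn_toLp] with x hx
  rw [hx, RCLike.inner_apply, hχ.map_neg, mul_comm]

theorem integrable_of_Lp_two {σ : Measure X} [IsFiniteMeasure σ] (u : Lp ℂ 2 σ) :
    Integrable (u : X → ℂ) σ := (Lp.memLp u).integrable (by norm_num)

theorem IsCharacterSystem.total (hχ : IsCharacterSystem χ) {σ : Measure X} [IsFiniteMeasure σ]
    (u : Lp ℂ 2 σ) (h : ∀ i, inner ℂ ((hχ.memLp σ i).toLp _) u = 0) : u = 0 := by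
  have := hχ.ae_eq_zero (integrable_of_Lp_two u) (fun i => by
    have h1 := h (-i)
    rwa [hχ.inner_toLp, neg_neg] at h1)
  exact (Lp.eq_zero_iff_ae_eq_zero).2 this

/-- The decomposition of a unitary representation along a cyclic family. -/
theorem IsCyclicFamily.exists_intertwines [CompleteSpace H] {κ : Type*} {σ : κ → Measure X}
    {f : κ → H} (hχ : IsCharacterSystem χ) (hV : IsUnitaryRep V) (hf : IsCyclicFamily χ V σ f) :
    ∃ W : H ≃ₗᵢ[ℂ] lp (fun a => Lp ℂ 2 (σ a)) 2, Intertwines χ V σ W ∧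
      ∀ i a h, inner ℂ (V i (f a)) h = ∫ x, χ (-i) x * W h a x ∂σ a := by
  classical
  have hfin := hf.finite
  have hJ : ∀ a, ∃ T : Lp ℂ 2 (σ a) →ₗᵢ[ℂ] H, ∀ i, T ((hχ.memLp (σ a) i).toLp _) = V i (f a) := by
    intro a
    refine exists_linearIsometry_of_inner_eq _ _ (fun i j => ?_) hχ.total
    rw [hχ.inner_toLp, hV.inner_map_map, hf.inner_self]
    refine integral_congr_ae ?_
    filter_upwards [(hχ.memLp (σ a) j).coeFn_toLp] with x hx
    rw [hx, ← hχ.map_add, neg_add_eq_sub]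
  choose J hJ using hJ
  -- Orthogonality to an orbit passes to the whole range of `J b`: the adjoint of `J b` sends `y` to
  -- a function orthogonal to every character.
  have hpart : ∀ (b : κ) (y : H), (∀ j, inner ℂ y (V j (f b)) = 0) → ∀ w, inner ℂ y (J b w) = 0 := by
    intro b y hy w
    have h0 : (J b).toContinuousLinearMap.adjoint y = 0 := by
      refine hχ.total _ fun i => ?_
      rw [ContinuousLinearMap.adjoint_inner_right]
      change inner ℂ (J b _) y = 0
      rw [hJ, ← inner_conj_symm, hy, _root_.map_zero]
    have := ContinuousLinearMap.adjoint_inner_left (J b).toContinuousLinearMap w y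
    rw [h0, inner_zero_left] at this
    exact this.symm
  have horth : OrthogonalFamily ℂ (fun a => Lp ℂ 2 (σ a)) J := by
    intro a b hab v w
    refine hpart b _ (fun j => ?_) w
    rw [← inner_conj_symm, hpart a _ (fun i => ?_) v, _root_.map_zero]
    rw [hV.inner_map_map, hf.inner_ne b a _ hab.symm]
  have hsum : IsHilbertSum ℂ (fun a => Lp ℂ 2 (σ a)) J := by
    refine IsHilbertSum.mk horth ?_
    rw [top_le_iff, Submodule.topologicalClosure_eq_top_iff, Submodule.eq_bot_iff]
    intro g hg
    refine hf.total g fun a i => ?_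
    refine (Submodule.mem_orthogonal _ _).1 hg _ ?_
    rw [← hJ]
    exact Submodule.mem_iSup_of_mem a ⟨_, rfl⟩
  let W := hsum.linearIsometryEquiv
  have hW : ∀ i a h, inner ℂ (V i (f a)) h = ∫ x, χ (-i) x * W h a x ∂σ a := by
    intro i a h
    have h1 : W (V i (f a)) = lp.single 2 a ((hχ.memLp (σ a) i).toLp _) := by
      rw [← W.apply_symm_apply (lp.single 2 a _), hsum.linearIsometryEquiv_symm_apply_single, hJ]
    rw [← W.inner_map_map, h1, lp.inner_single_left, hχ.inner_toLp]
  refine ⟨W, fun i h a => ?_, hW⟩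
  refine hχ.ae_eq (integrable_of_Lp_two _) (hχ.integrable_mul (integrable_of_Lp_two _) i)
    fun j => ?_
  have h1 := hW (-j) a (V i h)
  have h2 := hW (-j - i) a h
  rw [neg_neg] at h1
  rw [← h1, hV.inner_map_map, sub_neg_eq_add]
  have h3 : inner ℂ (f a) (V (i + j) h) = inner ℂ (V (-j - i) (f a)) h := by
    nth_rewrite 2 [← hV.map_zero h]
    rw [hV.inner_map_map]
    congr 2
    congr 1
    abel
  rw [h3, h2]
  congr 1 with x
  rw [← mul_assoc, ← hχ.map_add]
  congr 2
  abel

theorem IsCyclicFamily.isSpectralModel [CompleteSpace H] (hχ : IsCharacterSystem χ)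
    (hV : IsUnitaryRep V) {μ : Measure X} [IsFiniteMeasure μ] {m : X → ℕ∞} (hm : Measurable m)
    (hm1 : ∀ x, 1 ≤ m x) {f : ℕ → H}
    (hf : IsCyclicFamily χ V (fun k : ℕ => μ.restrict {x | (k : ℕ∞) < m x}) f) :
    IsSpectralModel χ V μ m := by
  obtain ⟨W, hW, -⟩ := hf.exists_intertwines hχ hV
  exact ⟨inferInstance, hm, hm1, W, hW⟩

end CyclicFamily

/-! ### Change of spectral measures and existence of cyclic sequences -/

section Existence

variable {H : Type*} [NormedAddCommGroup H] [InnerProductSpace ℂ H]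
variable {ι X : Type*} [AddCommGroup ι] [MeasurableSpace X]
variable {χ : ι → X → ℂ} {V : ι → H ≃ₗᵢ[ℂ] H}

theorem IsUnitaryRep.inner_map_left (hV : IsUnitaryRep V) (i : ι) (g h : H) :
    inner ℂ (V i g) h = inner ℂ g (V (-i) h) := by
  conv_lhs => rw [← hV.map_zero h]
  rw [hV.inner_map_map, zero_sub]

theorem IsUnitaryRep.inner_map_right (hV : IsUnitaryRep V) (i : ι) (g h : H) :
    inner ℂ g (V i h) = inner ℂ (V (-i) g) h := by
  rw [hV.inner_map_left, neg_neg]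

theorem hasSum_congr_fun {κ E : Type*} [AddCommMonoid E] [TopologicalSpace E] {f g : κ → E} {a : E}
    (h : ∀ b, f b = g b) : HasSum f a ↔ HasSum g a := by rw [funext h]

omit [AddCommGroup ι] in
theorem Intertwines.inner_eq_tsum {κ : Type*} {σ : κ → Measure X}
    {W : H ≃ₗᵢ[ℂ] lp (fun a => Lp ℂ 2 (σ a)) 2} (hW : Intertwines χ V σ W) (g h : H) (i : ι) :
    HasSum (fun a => ∫ x, χ i x * (starRingEnd ℂ (W g a x) * W h a x) ∂σ a)
      (inner ℂ g (V i h)) := by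
  rw [← W.inner_map_map]
  refine (hasSum_congr_fun fun a => ?_).2 (lp.hasSum_inner (𝕜 := ℂ) (W g) (W (V i h)))
  rw [L2.inner_def]
  refine integral_congr_ae ?_
  filter_upwards [hW i h a] with x hx
  rw [hx, RCLike.inner_apply]
  ring

theorem Intertwines.inner_single {κ : Type*} [DecidableEq κ] {σ : κ → Measure X}
    (hV : IsUnitaryRep V)
    {W : H ≃ₗᵢ[ℂ] lp (fun a => Lp ℂ 2 (σ a)) 2} (hW : Intertwines χ V σ W) (a : κ)
    (u : Lp ℂ 2 (σ a)) (i : ι) (h : H) :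
    inner ℂ (V i (W.symm (lp.single 2 a u))) h
      = ∫ x, χ (-i) x * (starRingEnd ℂ (u x) * W h a x) ∂σ a := by
  rw [hV.inner_map_left, ← W.inner_map_map, W.apply_symm_apply, lp.inner_single_left, L2.inner_def]
  refine integral_congr_ae ?_
  filter_upwards [hW (-i) h a] with x hx
  rw [hx, RCLike.inner_apply]
  ring

/-- The spectral measures of a cyclic family may be replaced by equivalent ones. -/
theorem IsCyclicFamily.exists_of_absolutelyContinuous [CompleteSpace H] {κ : Type*}
    {σ τ : κ → Measure X} {f : κ → H} (hχ : IsCharacterSystem χ) (hV : IsUnitaryRep V)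
    (hf : IsCyclicFamily χ V σ f) (hτ : ∀ a, IsFiniteMeasure (τ a)) (h1 : ∀ a, σ a ≪ τ a)
    (h2 : ∀ a, τ a ≪ σ a) : ∃ f' : κ → H, IsCyclicFamily χ V τ f' := by
  classical
  obtain ⟨W, hW, -⟩ := hf.exists_intertwines hχ hV
  have hfin := hf.finite
  -- Since `w² = dτ/dσ`, the vector with the single coordinate `w` has spectral measure `τ a`. It
  -- still generates its summand because `w > 0` holds `σ a`-almost everywhere.
  let w : κ → X → ℝ := fun a x => √((τ a).rnDeriv (σ a) x).toReal
  have hw2 : ∀ a x, w a x * w a x = ((τ a).rnDeriv (σ a) x).toReal := fun a x =>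
    Real.mul_self_sqrt ENNReal.toReal_nonneg
  have hwm : ∀ a, Measurable (w a) := fun a =>
    ((τ a).measurable_rnDeriv (σ a)).ennreal_toReal.sqrt
  have hL : ∀ a, MemLp (fun x => (w a x : ℂ)) 2 (σ a) := by
    intro a
    rw [memLp_two_iff_integrable_sq_norm (by fun_prop)]
    simp only [Complex.norm_real, sq, Real.norm_eq_abs, abs_mul_abs_self, hw2]
    exact Measure.integrable_toReal_rnDeriv
  let f' : κ → H := fun a => W.symm (lp.single 2 a ((hL a).toLp _))
  have hin : ∀ a i h, inner ℂ (V i (f' a)) h = ∫ x, χ (-i) x * (w a x * W h a x) ∂σ a := by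
    intro a i h
    rw [hW.inner_single hV]
    refine integral_congr_ae ?_
    filter_upwards [(hL a).coeFn_toLp] with x hx
    rw [hx, Complex.conj_ofReal]
  refine ⟨f', hτ, fun a i => ?_, fun a b i hab => ?_, fun g hg => ?_⟩
  · rw [hV.inner_map_right, hin, neg_neg, ← integral_rnDeriv_smul (h2 a)]
    refine integral_congr_ae ?_
    filter_upwards [(hL a).coeFn_toLp] with x hx
    simp only [f', W.apply_symm_apply, lp.single_apply_self]
    rw [hx, ← Complex.ofReal_mul, hw2, Complex.real_smul, mul_comm]
  · rw [hV.inner_map_right, hin, integral_eq_zero_of_ae]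
    simp only [f', W.apply_symm_apply]
    rw [lp.single_apply_ne 2 b _ hab]
    filter_upwards [Lp.coeFn_zero ℂ 2 (σ a)] with x hx
    rw [hx]; simp
  · suffices h : W g = 0 by simpa using h
    ext1
    funext a
    rw [lp.coeFn_zero, Pi.zero_apply, Lp.eq_zero_iff_ae_eq_zero]
    have hint : Integrable (fun x => (w a x : ℂ) * W g a x) (σ a) :=
      (hL a).integrable_mul (Lp.memLp (W g a))
    have h0 := hχ.ae_eq_zero hint (fun i => by rw [← neg_neg i, ← hin, hg])
    filter_upwards [h0, Measure.rnDeriv_pos' (h1 a), Measure.rnDeriv_lt_top (τ a) (σ a)]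
      with x hx hp ht
    simp only [Pi.zero_apply, mul_eq_zero, Complex.ofReal_eq_zero] at hx
    refine hx.resolve_left (Real.sqrt_pos.2 (ENNReal.toReal_pos hp.ne' ht.ne)).ne'

/-- In a separable space in which every vector has a spectral measure there is a cyclic
sequence. -/
theorem exists_isCyclicFamily [CompleteSpace H] [TopologicalSpace.SeparableSpace H]
    (hV : IsUnitaryRep V)
    (hσ : ∀ h : H, ∃ σ : Measure X, IsFiniteMeasure σ ∧ ∀ i, inner ℂ h (V i h) = ∫ x, χ i x ∂σ) :
    ∃ (σ : ℕ → Measure X) (f : ℕ → H), IsCyclicFamily χ V σ f := by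
  let d := TopologicalSpace.denseSeq H
  -- Gram–Schmidt for cyclic subspaces: `K n` is the closed invariant subspace generated by the
  -- first `n` terms of a dense sequence, and `f n` below is the component of `d n` orthogonal to
  -- it.
  let K : ℕ → Submodule ℂ H := fun n =>
    (Submodule.span ℂ {y | ∃ a < n, ∃ i, y = V i (d a)}).topologicalClosure
  have hKmin : ∀ (n : ℕ) (L : Submodule ℂ H), IsClosed (L : Set H) →
      (∀ a < n, ∀ i, V i (d a) ∈ L) → K n ≤ L := by
    intro n L hL h
    refine Submodule.topologicalClosure_minimal _ (Submodule.span_le.2 ?_) hL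
    rintro y ⟨a, ha, i, rfl⟩
    exact h a ha i
  have hmem : ∀ n, ∀ a < n, ∀ i, V i (d a) ∈ K n := fun n a ha i =>
    Submodule.le_topologicalClosure _ (Submodule.subset_span ⟨a, ha, i, rfl⟩)
  have hclosed : ∀ n, IsClosed (K n : Set H) := fun n => Submodule.isClosed_topologicalClosure _
  have hmono : ∀ {a b : ℕ}, a ≤ b → K a ≤ K b := fun {a b} hab =>
    hKmin a _ (hclosed b) fun c hc i => hmem b c (hc.trans_le hab) i
  have hinv : ∀ n i, ∀ y ∈ K n, V i y ∈ K n := by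
    intro n i
    refine hKmin n ((K n).comap (V i).toLinearEquiv.toLinearMap)
      ((hclosed n).preimage (V i).continuous) fun a ha j => ?_
    change V i (V j (d a)) ∈ K n
    rw [← hV.map_add]
    exact hmem n a ha _
  let f : ℕ → H := fun n => d n - (K n).starProjection (d n)
  have hforth : ∀ n, ∀ y ∈ K n, inner ℂ y (f n) = 0 := fun n =>
    (Submodule.mem_orthogonal _ _).1 ((K n).sub_starProjection_mem_orthogonal (d n))
  have hPmem : ∀ n, (K n).starProjection (d n) ∈ K n := fun n =>
    Submodule.starProjection_apply_mem _ _
  have hfmem : ∀ n, f n ∈ K (n + 1) := by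
    intro n
    refine sub_mem ?_ (hmono n.le_succ (hPmem n))
    have := hmem (n + 1) n n.lt_succ_self 0
    rwa [hV.map_zero] at this
  have hlt : ∀ a b i, a < b → inner ℂ (V i (f a)) (f b) = 0 := fun a b i hab =>
    hforth b _ (hinv b i _ (hmono hab (hfmem a)))
  choose σ hσ1 hσ2 using hσ
  refine ⟨fun n => σ (f n), f, fun a => hσ1 _, fun a i => hσ2 _ i, fun a b i hab => ?_,
    fun g hg => ?_⟩
  · rcases lt_or_gt_of_ne hab with h | h
    · rw [hV.inner_map_right, hlt a b _ h]
    · rw [← inner_conj_symm, hlt b a _ h, _root_.map_zero]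
  · have hK : ∀ n, K n ≤ (Submodule.span ℂ {g})ᗮ := by
      intro n
      induction n with
      | zero => exact hKmin 0 _ (Submodule.isClosed_orthogonal _) (by simp)
      | succ n ih =>
        refine hKmin _ _ (Submodule.isClosed_orthogonal _) fun a ha i => ?_
        rcases Nat.lt_succ_iff_lt_or_eq.1 ha with h | rfl
        · exact ih (hmem n a h i)
        · have h1 : V i (d a) = V i (f a) + V i ((K a).starProjection (d a)) := by
            rw [← (V i).map_add]; simp [f]
          rw [h1]
          refine add_mem ?_ (ih (hinv a i _ (hPmem a)))
          rw [Submodule.mem_orthogonal_singleton_iff_inner_left]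
          exact hg a i
    have hd : ∀ n, inner ℂ (d n) g = 0 := by
      intro n
      have := hK (n + 1) (hmem (n + 1) n n.lt_succ_self 0)
      rwa [hV.map_zero, Submodule.mem_orthogonal_singleton_iff_inner_left] at this
    have hcl : IsClosed {y : H | inner ℂ y g = 0} := isClosed_eq (by fun_prop) (by fun_prop)
    have h0 := (TopologicalSpace.denseRange_denseSeq H).induction_on
      (p := fun y => inner ℂ y g = (0 : ℂ)) g hcl hd
    exact inner_self_eq_zero.1 h0

end Existence

/-! ### Rearranging overlapping supports into a multiplicity function -/

section Sorting

open scoped Classical in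
-- A set has more than `k` elements exactly when its increasing enumeration reaches index `k`, and
-- the element found there has `k` predecessors in the set.
theorem natCast_lt_encard_iff (p : ℕ → Prop) (k : ℕ) :
    (k : ℕ∞) < {n | p n}.encard ↔ ∃ n, p n ∧ Nat.count p n = k := by
  constructor
  · intro h
    have hk : ∀ hf : {n | p n}.Finite, k < hf.toFinset.card := by
      intro hf
      rw [hf.encard_eq_coe_toFinset_card] at h
      exact_mod_cast h
    exact ⟨Nat.nth p k, Nat.nth_mem k hk, Nat.count_nth hk⟩
  · rintro ⟨n, hn, rfl⟩
    have h1 : (((Finset.range (n + 1)).filter p : Finset ℕ) : Set ℕ).encard ≤ {n | p n}.encard :=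
      Set.encard_le_encard fun j hj => by simpa using (Finset.mem_filter.1 (Finset.mem_coe.1 hj)).2
    rw [Set.encard_coe_eq_coe_finsetCard, ← Nat.count_eq_card_filter_range, Nat.count_succ,
      if_pos hn] at h1
    refine lt_of_lt_of_le ?_ h1
    exact_mod_cast Nat.lt_succ_self _

variable {X : Type*}

open scoped Classical in
theorem measurable_count {_ : MeasurableSpace X} {B : ℕ → Set X} (hB : ∀ n, MeasurableSet (B n)) (n : ℕ) :
    Measurable fun x => Nat.count (fun j => x ∈ B j) n := by
  induction n with
  | zero => simp
  | succ n ih =>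
    simp_rw [Nat.count_succ]
    exact ih.add (Measurable.ite (hB n) measurable_const measurable_const)

open scoped Classical in
/-- The points of `B n` which lie in exactly `k` of the preceding sets. -/
def sortedPiece (B : ℕ → Set X) (k n : ℕ) : Set X :=
  {x | x ∈ B n ∧ Nat.count (fun j => x ∈ B j) n = k}

theorem measurableSet_sortedPiece {_ : MeasurableSpace X} {B : ℕ → Set X} (hB : ∀ n, MeasurableSet (B n)) (k n : ℕ) :
    MeasurableSet (sortedPiece B k n) :=
  (hB n).inter (measurable_count hB n (measurableSet_singleton k))

theorem sortedPiece_subset (B : ℕ → Set X) (k n : ℕ) : sortedPiece B k n ⊆ B n := fun _ h => h.1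

theorem pairwise_disjoint_sortedPiece (B : ℕ → Set X) (k : ℕ) :
    Pairwise (Function.onFun Disjoint (sortedPiece B k)) := by
  classical
  intro a b hab
  refine Set.disjoint_left.2 fun x ha hb => hab ?_
  have h : Nat.count (fun j => x ∈ B j) a = Nat.count (fun j => x ∈ B j) b := ha.2.trans hb.2.symm
  exact Nat.count_injective ha.1 hb.1 h

theorem disjoint_sortedPiece (B : ℕ → Set X) {k l : ℕ} (hkl : k ≠ l) (n : ℕ) :
    Disjoint (sortedPiece B k n) (sortedPiece B l n) :=
  Set.disjoint_left.2 fun _ ha hb => hkl (ha.2.symm.trans hb.2)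

theorem lt_encard_iff_mem_iUnion (B : ℕ → Set X) (k : ℕ) (x : X) :
    (k : ℕ∞) < {n | x ∈ B n}.encard ↔ x ∈ ⋃ n, sortedPiece B k n := by
  classical
  rw [natCast_lt_encard_iff, Set.mem_iUnion]
  exact Iff.rfl

variable [MeasurableSpace X]

/-- The `max 1` secures the requirement `1 ≤ m` at every point; when the sets cover almost
everything it changes the count only on a null set. -/
theorem measurable_max_encard {B : ℕ → Set X} (hB : ∀ n, MeasurableSet (B n)) :
    Measurable fun x => max 1 {n | x ∈ B n}.encard := by
  have hlt : ∀ k : ℕ, MeasurableSet {x | (k : ℕ∞) < max 1 {n | x ∈ B n}.encard} := by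
    intro k
    have : {x | (k : ℕ∞) < max 1 {n | x ∈ B n}.encard}
        = {_x : X | (k : ℕ∞) < 1} ∪ ⋃ n, sortedPiece B k n := by
      ext x
      rw [Set.mem_ofPred_eq, lt_max_iff, lt_encard_iff_mem_iUnion]
      rfl
    rw [this]
    exact (MeasurableSet.const _).union
      (MeasurableSet.iUnion fun n => measurableSet_sortedPiece hB k n)
  refine ENat.measurable_iff.2 fun n => ?_
  have : (fun x => max 1 {n | x ∈ B n}.encard) ⁻¹' {(n : ℕ∞)}
      = (⋂ k ∈ Finset.range n, {x | (k : ℕ∞) < max 1 {n | x ∈ B n}.encard})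
        \ {x | (n : ℕ∞) < max 1 {n | x ∈ B n}.encard} := by
    ext x
    simp only [Set.mem_preimage, Set.mem_singleton_iff, Set.mem_sdiff, Set.mem_iInter,
      Finset.mem_range, Set.mem_ofPred_eq]
    generalize max 1 {n | x ∈ B n}.encard = a
    constructor
    · rintro rfl
      exact ⟨fun k hk => by exact_mod_cast hk, lt_irrefl _⟩
    · rintro ⟨h1, h2⟩
      refine le_antisymm (not_lt.1 h2) (not_lt.1 fun h => ?_)
      lift a to ℕ using ne_top_of_lt h
      exact lt_irrefl _ (h1 a (by exact_mod_cast h))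
  rw [this]
  exact (Finset.measurableSet_biInter _ fun k _ => hlt k).diff (hlt n)

theorem Lp_integrable_sq_norm {σ : Measure X} (u : Lp ℂ 2 σ) :
    Integrable (fun x => ‖u x‖ ^ 2) σ :=
  (memLp_two_iff_integrable_sq_norm (Lp.aestronglyMeasurable u)).1 (Lp.memLp u)

theorem integral_sq_norm_Lp {σ : Measure X} (u : Lp ℂ 2 σ) : ∫ x, ‖u x‖ ^ 2 ∂σ = ‖u‖ ^ 2 := by
  have h := L2.inner_def (𝕜 := ℂ) u u
  rw [inner_self_eq_norm_sq_to_K] at h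
  have h2 : ∫ x, inner ℂ (u x) (u x) ∂σ = ((∫ x, ‖u x‖ ^ 2 ∂σ : ℝ) : ℂ) := by
    rw [← integral_complex_ofReal]
    congr 1 with x
    rw [inner_self_eq_norm_sq_to_K]
    simp
  rw [h2] at h
  refine Complex.ofReal_injective ?_
  rw [← h]
  simp

theorem summable_sq_norm_lp {κ : Type*} {σ : κ → Measure X} (w : lp (fun a => Lp ℂ 2 (σ a)) 2) :
    Summable fun a => ‖w a‖ ^ 2 := by
  have := (lp.memℓp w).summable (by norm_num)
  simpa using this

variable {H : Type*} [NormedAddCommGroup H] [InnerProductSpace ℂ H]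
variable {ι : Type*} [AddCommGroup ι] {χ : ι → X → ℂ} {V : ι → H ≃ₗᵢ[ℂ] H}

/-- A cyclic sequence whose spectral measures are `μ` restricted to sets `B n` can be sorted into
a spectral model, whose multiplicity function counts the sets. -/
theorem IsCyclicFamily.isSpectralModel_sorted [CompleteSpace H]
    (hχ : IsCharacterSystem χ) (hV : IsUnitaryRep V) {μ : Measure X} [IsFiniteMeasure μ]
    {B : ℕ → Set X} (hB : ∀ n, MeasurableSet (B n)) (hcov : ∀ᵐ x ∂μ, ∃ n, x ∈ B n) {f : ℕ → H}
    (hf : IsCyclicFamily χ V (fun n => μ.restrict (B n)) f) :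
    IsSpectralModel χ V μ (fun x => max 1 {n | x ∈ B n}.encard) := by
  obtain ⟨W, hW, -⟩ := hf.exists_intertwines hχ hV
  let C := sortedPiece B
  have hC : ∀ k n, MeasurableSet (C k n) := measurableSet_sortedPiece hB
  have hCdisj : ∀ k, Pairwise (Function.onFun Disjoint (C k)) := pairwise_disjoint_sortedPiece B
  have hCB : ∀ k n, (μ.restrict (B n)).restrict (C k n) = μ.restrict (C k n) := fun k n => by
    rw [Measure.restrict_restrict (hC k n), Set.inter_eq_self_of_subset_left
      (sortedPiece_subset B k n)]
  -- The new `k`-th generator has the indicator of `C k n` as its `n`-th coordinate. For fixed `k`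
  -- these sets are disjoint, which gives square summability, and their union is the region covered
  -- more than `k` times.
  let u : ∀ k n, Lp ℂ 2 (μ.restrict (B n)) := fun k n =>
    indicatorConstLp 2 (hC k n) (measure_ne_top _ _) 1
  have hCsum : ∀ k, Summable fun n => (μ (C k n)).toReal := fun k =>
    summable_measure_toReal (hC k) (hCdisj k)
  have hu : ∀ k, Memℓp (u k) 2 := by
    intro k
    refine memℓp_gen ?_
    refine (hCsum k).congr fun n => ?_
    rw [norm_indicatorConstLp (by norm_num) (by norm_num)]
    have h1 : (μ.restrict (B n)).real (C k n) = (μ (C k n)).toReal := by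
      rw [Measure.real, Measure.restrict_apply (hC k n), Set.inter_eq_self_of_subset_left
        (sortedPiece_subset B k n)]
    rw [h1, norm_one, one_mul, ← Real.rpow_mul ENNReal.toReal_nonneg]
    norm_num
  let e : ℕ → H := fun k => W.symm ⟨u k, hu k⟩
  have hun : ∀ k n, (W (e k) n : X → ℂ) =ᵐ[μ.restrict (B n)] (C k n).indicator fun _ => 1 := by
    intro k n
    simp only [e, W.apply_symm_apply]
    exact indicatorConstLp_coeFn
  have hin : ∀ k i h, HasSum (fun n => ∫ x in C k n, χ (-i) x * W h n x ∂μ)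
      (inner ℂ (V i (e k)) h) := by
    intro k i h
    rw [hV.inner_map_left]
    refine (hasSum_congr_fun fun n => ?_).2 (hW.inner_eq_tsum (e k) h (-i))
    rw [← hCB, ← integral_indicator (hC k n)]
    refine integral_congr_ae ?_
    filter_upwards [hun k n] with x hx
    rw [hx]
    by_cases hm : x ∈ C k n <;> simp [hm]
  have hunion : ∀ k : ℕ, μ.restrict {x | (k : ℕ∞) < max 1 {n | x ∈ B n}.encard}
      = μ.restrict (⋃ n, C k n) := by
    intro k
    refine Measure.restrict_congr_set ?_
    filter_upwards [hcov] with x hx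
    have h1 : 1 ≤ {n | x ∈ B n}.encard := Set.one_le_encard_iff_nonempty.2 hx
    have h2 : x ∈ {x | (k : ℕ∞) < max 1 {n | x ∈ B n}.encard} ↔ x ∈ ⋃ n, C k n := by
      rw [Set.mem_ofPred_eq, max_eq_right h1]
      exact lt_encard_iff_mem_iUnion B k x
    exact propext h2
  refine IsCyclicFamily.isSpectralModel hχ hV (measurable_max_encard hB)
    (fun x => le_max_left _ _) (f := e) ?_
  simp_rw [hunion]
  refine ⟨fun k => inferInstance, fun k i => ?_, fun k l i hkl => ?_, fun g hg => ?_⟩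
  · rw [hV.inner_map_right]
    refine (hin k (-i) (e k)).unique ?_
    rw [neg_neg]
    refine (hasSum_congr_fun fun n => ?_).2 (hasSum_integral_iUnion (hC k) (hCdisj k)
      (hχ.integrable μ i).integrableOn)
    rw [← hCB]
    refine integral_congr_ae ?_
    filter_upwards [ae_restrict_of_ae (hun k n), ae_restrict_mem (hC k n)] with x hx hm
    rw [hx, Set.indicator_of_mem hm, mul_one]
  · rw [hV.inner_map_right]
    refine (hin k (-i) (e l)).unique ?_
    rw [neg_neg]
    convert! hasSum_zero with n
    refine integral_eq_zero_of_ae ?_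
    rw [← hCB]
    filter_upwards [ae_restrict_of_ae (hun l n), ae_restrict_mem (hC k n)] with x hx hm
    rw [hx, Set.indicator_of_notMem ((disjoint_sortedPiece B hkl n).notMem_of_mem_left hm)]
    simp
  · have hzero : ∀ k n, ∀ᵐ x ∂μ, x ∈ C k n → W g n x = 0 := by
      intro k
      -- By disjointness in `n`, the coordinates of `g` on the pieces `C k n` glue to one integrable
      -- function, and orthogonality to the `k`-th generator says that every character annihilates
      -- it.
      let G : X → ℂ := fun x => ∑' n, (C k n).indicator (W g n : X → ℂ) x
      have hG : ∀ n, ∀ x ∈ C k n, G x = W g n x := by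
        intro n x hx
        simp only [G]
        rw [tsum_eq_single n, Set.indicator_of_mem hx]
        intro j hj
        exact Set.indicator_of_notMem ((hCdisj k hj.symm).notMem_of_mem_left hx) _
      have hi : ∀ n, IntegrableOn (W g n : X → ℂ) (C k n) μ := by
        intro n
        rw [IntegrableOn, ← hCB]
        exact (integrable_of_Lp_two _).restrict
      have hGi : ∀ n, IntegrableOn G (C k n) μ := fun n =>
        (hi n).congr_fun (fun x hx => (hG n x hx).symm) (hC k n)
      have hGU : IntegrableOn G (⋃ n, C k n) μ := by
        refine integrableOn_iUnion_of_summable_integral_norm hGi ?_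
        refine Summable.of_nonneg_of_le (fun n => integral_nonneg fun x => norm_nonneg _)
          (fun n => ?_) ((hCsum k).add (summable_sq_norm_lp (W g)))
        rw [setIntegral_congr_fun (hC k n) (fun x hx => by rw [hG n x hx])]
        have hsq : IntegrableOn (fun x => ‖W g n x‖ ^ 2) (C k n) μ := by
          rw [IntegrableOn, ← hCB]
          exact (Lp_integrable_sq_norm _).restrict
        calc ∫ x in C k n, ‖W g n x‖ ∂μ ≤ ∫ x in C k n, (1 + ‖W g n x‖ ^ 2) ∂μ := by
              refine integral_mono (hi n).norm ((integrable_const _).add hsq) fun x => ?_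
              nlinarith [sq_nonneg (‖W g n x‖ - 1), norm_nonneg (W g n x)]
          _ = (μ (C k n)).toReal + ∫ x in C k n, ‖W g n x‖ ^ 2 ∂μ := by
              rw [integral_add (integrable_const _) hsq]
              simp [Measure.real]
          _ ≤ _ := by
              gcongr
              rw [← integral_sq_norm_Lp]
              rw [← hCB]
              exact setIntegral_le_integral (Lp_integrable_sq_norm _)
                (Eventually.of_forall fun x => by positivity)
      have h0 := hχ.ae_eq_zero hGU (fun i => by
        have h1 := hasSum_integral_iUnion (hC k) (hCdisj k) (hχ.integrable_mul hGU i)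
        refine h1.unique ?_
        have h2 := hin k (-i) g
        rw [hg, neg_neg] at h2
        convert! h2 using 2 with n
        exact setIntegral_congr_fun (hC k n) fun x hx => by simp only [hG n x hx])
      intro n
      have h3 := (ae_restrict_iff' (MeasurableSet.iUnion (hC k))).1 h0
      filter_upwards [h3] with x hx hm
      rw [← hG n x hm]
      exact hx (Set.mem_iUnion.2 ⟨n, hm⟩)
    suffices h : W g = 0 by simpa using h
    ext1
    funext n
    rw [lp.coeFn_zero, Pi.zero_apply, Lp.eq_zero_iff_ae_eq_zero, EventuallyEq,
      ae_restrict_iff' (hB n)]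
    have := ae_all_iff.2 fun k => hzero k n
    filter_upwards [this] with x hx hm
    exact hx _ ⟨hm, rfl⟩

end Sorting

/-! ### Uniqueness and existence of spectral models -/

section Uniqueness

variable {X : Type*} [MeasurableSpace X]

/-- This normal form replaces a spectral measure, up to equivalence, by a set, so that
multiplicities can be found by counting sets. -/
theorem absolutelyContinuous_restrict_rnDeriv_ne_zero {σ μ : Measure X} [SigmaFinite σ]
    [SigmaFinite μ] (h : σ ≪ μ) :
    σ ≪ μ.restrict {x | σ.rnDeriv μ x ≠ 0} ∧ μ.restrict {x | σ.rnDeriv μ x ≠ 0} ≪ σ := by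
  have hB : MeasurableSet {x | σ.rnDeriv μ x ≠ 0} :=
    (Measure.measurable_rnDeriv σ μ) (measurableSet_singleton 0).compl
  have key : ∀ s, σ s = 0 ↔ μ ({x | σ.rnDeriv μ x ≠ 0} ∩ s) = 0 := by
    intro s
    conv_lhs => rw [← Measure.withDensity_rnDeriv_eq σ μ h]
    exact withDensity_apply_eq_zero (Measure.measurable_rnDeriv σ μ)
  refine ⟨fun s hs => ?_, fun s hs => ?_⟩
  · rwa [Measure.restrict_apply' hB, Set.inter_comm, ← key] at hs
  · rwa [Measure.restrict_apply' hB, Set.inter_comm, ← key]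

theorem ae_summable_and_integrable_tsum {E : Type*} [NormedAddCommGroup E] [NormedSpace ℝ E]
    [CompleteSpace E] {μ : Measure X} {F : ℕ → X → E}
    (hF : ∀ i, Integrable (F i) μ) (hs : Summable fun i => ∫ a, ‖F i a‖ ∂μ) :
    (∀ᵐ a ∂μ, Summable fun i => F i a) ∧ Integrable (fun a => ∑' i, F i a) μ := by
  have h1 : ∫⁻ a, ∑' i, ‖F i a‖ₑ ∂μ ≠ ∞ := by
    rw [lintegral_tsum fun i => (hF i).1.enorm]
    have h2 : ∀ i, ∫⁻ a, ‖F i a‖ₑ ∂μ = ENNReal.ofReal (∫ a, ‖F i a‖ ∂μ) := fun i =>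
      (ofReal_integral_norm_eq_lintegral_enorm (hF i)).symm
    simp_rw [h2]
    exact hs.tsum_ofReal_ne_top
  have hm : AEMeasurable (fun a => ∑' i, ‖F i a‖ₑ) μ := AEMeasurable.tsum fun i => (hF i).1.enorm
  have hsum : ∀ᵐ a ∂μ, Summable fun i => F i a := by
    filter_upwards [ae_lt_top' hm h1] with a ha
    refine Summable.of_norm ?_
    have h3 := ENNReal.summable_toReal ha.ne
    simpa using h3
  refine ⟨hsum, ?_, ?_⟩
  · refine aestronglyMeasurable_of_tendsto_ae atTop (f := fun n a => ∑ i ∈ Finset.range n, F i a)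
      (fun n => ?_) ?_
    · exact Finset.aestronglyMeasurable_fun_sum _ fun i _ => (hF i).1
    · filter_upwards [hsum] with a ha
      exact ha.hasSum.tendsto_sum_nat
  · refine lt_of_le_of_lt (lintegral_mono fun a => ?_) (lt_top_iff_ne_top.2 h1)
    exact enorm_tsum_le_tsum_enorm

variable {H : Type*} [NormedAddCommGroup H] [InnerProductSpace ℂ H]
variable {ι : Type*} [AddCommGroup ι] {χ : ι → X → ℂ} {V : ι → H ≃ₗᵢ[ℂ] H}
variable {μ μ' : Measure X} {m m' : X → ℕ∞}

/-- In a spectral model the vectors are fields of coordinates `F g k`, `k < m x`; inner products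
are obtained by integrating the pointwise inner products of the fields. -/
theorem IsSpectralModel.exists_field (hχ : IsCharacterSystem χ) (hM : IsSpectralModel χ V μ m) :
    ∃ F : H → ℕ → X → ℂ, (∀ g (k : ℕ) x, m x ≤ k → F g k x = 0) ∧
      (∀ g h, (∀ᵐ x ∂μ, Summable fun k => starRingEnd ℂ (F g k x) * F h k x) ∧
        Integrable (fun x => ∑' k, starRingEnd ℂ (F g k x) * F h k x) μ ∧
        ∀ i, inner ℂ g (V i h) = ∫ x, χ i x * ∑' k, starRingEnd ℂ (F g k x) * F h k x ∂μ) ∧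
      ∀ A, MeasurableSet A → ∃ w : H,
        (∀ g, inner ℂ w g = ∫ x in A, F g 0 x ∂μ) ∧ (w = 0 → μ A = 0) := by
  have := hM.finite
  obtain ⟨W, hW⟩ := hM.exists_equiv
  have hWi : Intertwines χ V (fun k : ℕ => μ.restrict {x | (k : ℕ∞) < m x}) W := hW
  have hs : ∀ k : ℕ, MeasurableSet {x | (k : ℕ∞) < m x} := fun k =>
    hM.measurable (MeasurableSet.of_discrete (s := Set.Ioi (k : ℕ∞)))
  let F : H → ℕ → X → ℂ := fun g k => {x | (k : ℕ∞) < m x}.indicator (W g k)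
  have hFm : ∀ g (k : ℕ) x, m x ≤ k → F g k x = 0 := fun g k x hx =>
    Set.indicator_of_notMem (by simpa using hx) _
  have hFF : ∀ g h k, (fun x => starRingEnd ℂ (F g k x) * F h k x)
      = {x | (k : ℕ∞) < m x}.indicator fun x => starRingEnd ℂ (W g k x) * W h k x := by
    intro g h k
    funext x
    by_cases hx : x ∈ {x | (k : ℕ∞) < m x}
    · simp only [F, Set.indicator_of_mem hx]
    · simp only [F, Set.indicator_of_notMem hx, mul_zero]
  have hint : ∀ g h k, Integrable (fun x => starRingEnd ℂ (F g k x) * F h k x) μ := by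
    intro g h k
    rw [hFF, integrable_indicator_iff (hs k)]
    exact (Lp.memLp (W g k)).star.integrable_mul (Lp.memLp (W h k))
  have hsum : ∀ g h, Summable fun k => ∫ x, ‖starRingEnd ℂ (F g k x) * F h k x‖ ∂μ := by
    intro g h
    refine Summable.of_nonneg_of_le (fun n => integral_nonneg fun x => norm_nonneg _)
      (fun k => ?_) ((summable_sq_norm_lp (W g)).add (summable_sq_norm_lp (W h)))
    rw [← integral_sq_norm_Lp, ← integral_sq_norm_Lp, ← integral_add (Lp_integrable_sq_norm _)
      (Lp_integrable_sq_norm _), ← integral_indicator (hs k)]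
    refine integral_mono_ae (hint g h k).norm ?_ (Eventually.of_forall fun x => ?_)
    · rw [integrable_indicator_iff (hs k)]
      exact (Lp_integrable_sq_norm _).add (Lp_integrable_sq_norm _)
    · by_cases hx : x ∈ {x | (k : ℕ∞) < m x}
      · simp only [F, Set.indicator_of_mem hx, norm_mul, RCLike.norm_conj]
        nlinarith [sq_nonneg (‖W g k x‖ - ‖W h k x‖), sq_nonneg (‖W g k x‖ + ‖W h k x‖)]
      · simp only [F, Set.indicator_of_notMem hx]
        simp
  refine ⟨F, hFm, fun g h => ?_, fun A hA => ?_⟩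
  · obtain ⟨h1, h2⟩ := ae_summable_and_integrable_tsum (hint g h) (hsum g h)
    refine ⟨h1, h2, fun i => ?_⟩
    have h3 := hasSum_integral_of_summable_integral_norm
      (F := fun k x => χ i x * (starRingEnd ℂ (F g k x) * F h k x))
      (fun k => hχ.integrable_mul (hint g h k) i)
      ((hsum g h).congr fun k => by simp only [norm_mul, hχ.norm_eq, one_mul])
    simp_rw [tsum_mul_left] at h3
    refine HasSum.unique ?_ h3
    refine (hasSum_congr_fun fun k => ?_).1 (hWi.inner_eq_tsum g h i)
    rw [← integral_indicator (hs k)]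
    congr 1 with x
    have := congrFun (hFF g h k) x
    simp only at this
    rw [this]
    by_cases hx : x ∈ {x | (k : ℕ∞) < m x}
    · simp only [Set.indicator_of_mem hx]
    · simp only [Set.indicator_of_notMem hx, mul_zero]
  -- The vector `w` is the indicator of `A` in coordinate `0`. As `m ≥ 1`, this coordinate lives on
  -- the whole space, so `w` detects whether `A` is null.
  · have huniv : {x | ((0 : ℕ) : ℕ∞) < m x} = Set.univ :=
      Set.eq_univ_of_forall fun x => lt_of_lt_of_le (by simp) (hM.one_le x)
    let u : Lp ℂ 2 (μ.restrict {x | ((0 : ℕ) : ℕ∞) < m x}) :=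
      indicatorConstLp 2 hA (measure_ne_top _ _) 1
    refine ⟨W.symm (lp.single 2 0 u), fun g => ?_, fun h0 => ?_⟩
    · rw [← W.inner_map_map, W.apply_symm_apply, lp.inner_single_left, L2.inner_indicatorConstLp_one]
      have h1 : (μ.restrict {x | ((0 : ℕ) : ℕ∞) < m x}).restrict A = μ.restrict A := by
        rw [huniv, Measure.restrict_univ]
      rw [h1]
      congr 1 with x
      exact (Set.indicator_of_mem (by rw [huniv]; trivial) _).symm
    · have h1 : u = 0 := by
        have := congrArg (fun w => (W w : ∀ k : ℕ, Lp ℂ 2 (μ.restrict {x | (k : ℕ∞) < m x})) 0) h0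
        simpa using this
      have h2 : ‖u‖ = 0 := by rw [h1, norm_zero]
      rw [norm_indicatorConstLp (by norm_num) (by norm_num), norm_one, one_mul,
        Real.rpow_eq_zero measureReal_nonneg (by norm_num)] at h2
      rw [measureReal_eq_zero_iff, huniv, Measure.restrict_univ] at h2
      exact h2

/-- The multiplicity is at least the rank of the density matrix of the joint spectral measures of
finitely many vectors. -/
theorem IsSpectralModel.le_of_forall_quadratic (hχ : IsCharacterSystem χ)
    (hM : IsSpectralModel χ V μ m) {n : ℕ} (v : Fin n → H) (G : Fin n → Fin n → X → ℂ)
    (hG : ∀ a b, Integrable (G a b) μ)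
    (hv : ∀ a b i, inner ℂ (v a) (V i (v b)) = ∫ x, χ i x * G a b x ∂μ) :
    ∀ᵐ x ∂μ, (∀ ξ : Fin n → ℂ,
      ∑ a, ∑ b, starRingEnd ℂ (ξ a) * ξ b * G a b x = 0 → ξ = 0) → (n : ℕ∞) ≤ m x := by
  obtain ⟨F, hF0, hF, -⟩ := hM.exists_field hχ
  have hae : ∀ᵐ x ∂μ, ∀ a b, G a b x = ∑' k, starRingEnd ℂ (F (v a) k x) * F (v b) k x := by
    rw [ae_all_iff]
    intro a
    rw [ae_all_iff]
    intro b
    obtain ⟨-, h2, h3⟩ := hF (v a) (v b)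
    exact hχ.ae_eq (hG a b) h2 fun i => by rw [← hv, h3]
  filter_upwards [hae] with x hx hq
  by_contra! hlt
  obtain ⟨p, hp⟩ := ENat.ne_top_iff_exists.1 (ne_top_of_lt hlt)
  rw [← hp] at hlt
  have hpn : p < n := by exact_mod_cast hlt
  -- If `m x = p < n`, only the first `p` coordinates survive at `x`, and a kernel vector of this `p
  -- × n` matrix annihilates the quadratic form.
  let L : (Fin n → ℂ) →ₗ[ℂ] (Fin p → ℂ) :=
    Matrix.toLin' (Matrix.of fun (k : Fin p) (b : Fin n) => F (v b) k x)
  have hker : LinearMap.ker L ≠ ⊥ := LinearMap.ker_ne_bot_of_finrank_lt (by simpa using hpn)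
  obtain ⟨ξ, hξ, hξ0⟩ := Submodule.exists_mem_ne_zero_of_ne_bot hker
  refine hξ0 (hq ξ ?_)
  have hL : ∀ k ∈ Finset.range p, ∑ b, ξ b * F (v b) k x = 0 := by
    intro k hk
    have := congrFun (LinearMap.mem_ker.1 hξ) ⟨k, Finset.mem_range.1 hk⟩
    simp only [L, Matrix.toLin'_apply, Matrix.mulVec, dotProduct, Matrix.of_apply,
      Pi.zero_apply] at this
    rw [← this]
    exact Finset.sum_congr rfl fun b _ => mul_comm _ _
  have hfin : ∀ a b, G a b x
      = ∑ k ∈ Finset.range p, starRingEnd ℂ (F (v a) k x) * F (v b) k x := by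
    intro a b
    rw [hx, tsum_eq_sum]
    intro k hk
    rw [hF0 (v b) k x, mul_zero]
    rw [← hp]
    exact_mod_cast not_lt.1 (by simpa using hk)
  calc ∑ a, ∑ b, starRingEnd ℂ (ξ a) * ξ b * G a b x
      = ∑ k ∈ Finset.range p, ∑ a, starRingEnd ℂ (ξ a) * starRingEnd ℂ (F (v a) k x) *
          ∑ b, ξ b * F (v b) k x := by
        rw [Finset.sum_comm]
        simp_rw [hfin, Finset.mul_sum]
        rw [Finset.sum_comm]
        refine (Finset.sum_congr rfl fun a _ => Finset.sum_comm).trans ?_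
        rw [Finset.sum_comm]
        refine Finset.sum_congr rfl fun k _ => Finset.sum_congr rfl fun a _ =>
          Finset.sum_congr rfl fun b _ => by ring
    _ = 0 := Finset.sum_eq_zero fun k hk => by simp [hL k hk]

/-- The constant function 1 in the `k`-th summand serves as the `k`-th generator. This is a converse
to `IsCyclicFamily.isSpectralModel`. -/
theorem IsSpectralModel.exists_isCyclicFamily (hχ : IsCharacterSystem χ) (hV : IsUnitaryRep V)
    (hM : IsSpectralModel χ V μ m) :
    ∃ e : ℕ → H, IsCyclicFamily χ V (fun k : ℕ => μ.restrict {x | (k : ℕ∞) < m x}) e := by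
  have := hM.finite
  obtain ⟨W, hW⟩ := hM.exists_equiv
  have hWi : Intertwines χ V (fun k : ℕ => μ.restrict {x | (k : ℕ∞) < m x}) W := hW
  let u : ∀ k : ℕ, Lp ℂ 2 (μ.restrict {x | (k : ℕ∞) < m x}) := fun k =>
    (memLp_const 1).toLp fun _ => (1 : ℂ)
  have hu : ∀ k : ℕ, (u k : X → ℂ) =ᵐ[μ.restrict {x | (k : ℕ∞) < m x}] fun _ => 1 := fun k =>
    MemLp.coeFn_toLp _
  let e : ℕ → H := fun k => W.symm (lp.single 2 k (u k))
  have hin : ∀ (k : ℕ) i h, inner ℂ (V i (e k)) h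
      = ∫ x in {x | (k : ℕ∞) < m x}, χ (-i) x * W h k x ∂μ := by
    intro k i h
    rw [hWi.inner_single hV]
    refine integral_congr_ae ?_
    filter_upwards [hu k] with x hx
    simp [hx]
  refine ⟨e, fun k => inferInstance, fun k i => ?_, fun k l i hkl => ?_, fun g hg => ?_⟩
  · rw [hV.inner_map_right, hin, neg_neg]
    refine integral_congr_ae ?_
    filter_upwards [hu k] with x hx
    simp only [e, W.apply_symm_apply, lp.single_apply_self]
    rw [hx, mul_one]
  · rw [hV.inner_map_right, hin, integral_eq_zero_of_ae]
    simp only [e, W.apply_symm_apply]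
    rw [lp.single_apply_ne 2 l _ hkl]
    filter_upwards [Lp.coeFn_zero ℂ 2 (μ.restrict {x | (k : ℕ∞) < m x})] with x hx
    rw [hx]; simp
  · suffices h : W g = 0 by simpa using h
    ext1
    funext k
    rw [lp.coeFn_zero, Pi.zero_apply, Lp.eq_zero_iff_ae_eq_zero]
    exact hχ.ae_eq_zero (integrable_of_Lp_two _) fun i => by rw [← neg_neg i, ← hin, hg]

omit [AddCommGroup ι] in
theorem IsSpectralModel.restrict_zero_lt (hM : IsSpectralModel χ V μ m) :
    μ.restrict {x | ((0 : ℕ) : ℕ∞) < m x} = μ := by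
  have huniv : {x | ((0 : ℕ) : ℕ∞) < m x} = Set.univ :=
    Set.eq_univ_of_forall fun x => lt_of_lt_of_le (by simp) (hM.one_le x)
  rw [huniv, Measure.restrict_univ]

/-- Spectral measures are absolutely continuous with respect to the measure of a model. -/
theorem IsSpectralModel.absolutelyContinuous (hχ : IsCharacterSystem χ)
    (hM : IsSpectralModel χ V μ m) {g : H} {σ : Measure X} [IsFiniteMeasure σ]
    (hσ : ∀ i, inner ℂ g (V i g) = ∫ x, χ i x ∂σ) : σ ≪ μ := by
  have := hM.finite
  obtain ⟨F, -, hF, -⟩ := hM.exists_field hχ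
  obtain ⟨-, h2, h3⟩ := hF g g
  exact (hχ.absolutelyContinuous_and_ae_eq h2 fun i => by rw [← hσ, h3]).1

theorem IsSpectralModel.absolutelyContinuous_model (hχ : IsCharacterSystem χ)
    (hV : IsUnitaryRep V) (hM : IsSpectralModel χ V μ m) (hM' : IsSpectralModel χ V μ' m') :
    μ' ≪ μ := by
  have := hM'.finite
  obtain ⟨e, he⟩ := hM'.exists_isCyclicFamily hχ hV
  refine hM.absolutelyContinuous hχ (g := e 0) fun i => ?_
  rw [he.inner_self, hM'.restrict_zero_lt]

/-- Where `n ≤ m'`, the first `n` generators of the second model have density matrix `ρ` times the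
identity, with `ρ = dμ'/dμ > 0`. Its rank `n` bounds `m` from below. Used in both directions, this
gives uniqueness of the multiplicity function. -/
theorem IsSpectralModel.ae_le (hχ : IsCharacterSystem χ) (hV : IsUnitaryRep V)
    (hM : IsSpectralModel χ V μ m) (hM' : IsSpectralModel χ V μ' m') : ∀ᵐ x ∂μ, m' x ≤ m x := by
  have := hM.finite
  have := hM'.finite
  have hac' := hM.absolutelyContinuous_model hχ hV hM'
  have hac := hM'.absolutelyContinuous_model hχ hV hM
  obtain ⟨e, he⟩ := hM'.exists_isCyclicFamily hχ hV
  have hs : ∀ k : ℕ, MeasurableSet {x | (k : ℕ∞) < m' x} := fun k =>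
    hM'.measurable (MeasurableSet.of_discrete (s := Set.Ioi (k : ℕ∞)))
  let ρ : X → ℂ := fun x => ((μ'.rnDeriv μ x).toReal : ℂ)
  have hρ : Integrable ρ μ := (Measure.integrable_toReal_rnDeriv (μ := μ') (ν := μ)).ofReal
  have key : ∀ n : ℕ, ∀ᵐ x ∂μ, (n : ℕ∞) ≤ m' x → (n : ℕ∞) ≤ m x := by
    intro n
    let G : Fin n → Fin n → X → ℂ := fun a b =>
      if a = b then {x | ((a : ℕ) : ℕ∞) < m' x}.indicator ρ else 0
    have hG : ∀ a b, Integrable (G a b) μ := by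
      intro a b
      simp only [G]
      split_ifs
      · exact hρ.indicator (hs a)
      · exact integrable_zero _ _ _
    have h1 := hM.le_of_forall_quadratic hχ (fun a : Fin n => e a) G hG (fun a b i => by
      by_cases hab : a = b
      · subst hab
        simp only [G, if_true]
        rw [he.inner_self, ← integral_indicator (hs a), ← integral_rnDeriv_smul hac']
        congr 1 with x
        by_cases hx : x ∈ {x | ((a : ℕ) : ℕ∞) < m' x}
        · simp only [Set.indicator_of_mem hx, ρ, Complex.real_smul]
          ring
        · simp only [Set.indicator_of_notMem hx, smul_zero, mul_zero]
      · simp only [G, if_neg hab]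
        rw [he.inner_ne _ _ _ fun h => hab (Fin.ext h)]
        simp)
    filter_upwards [h1, Measure.rnDeriv_pos' hac, Measure.rnDeriv_lt_top μ' μ] with x hx hp ht hn
    have hρx : ρ x ≠ 0 := by
      simp only [ρ, ne_eq, Complex.ofReal_eq_zero]
      exact (ENNReal.toReal_pos hp.ne' ht.ne).ne'
    refine hx fun ξ hξ => ?_
    have h2 : ∀ a : Fin n, {x | ((a : ℕ) : ℕ∞) < m' x}.indicator ρ x = ρ x := fun a => by
      have hlt : ((a : ℕ) : ℕ∞) < (n : ℕ∞) := by exact_mod_cast a.2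
      exact Set.indicator_of_mem (s := {x | ((a : ℕ) : ℕ∞) < m' x}) (hlt.trans_le hn) _
    have h3 : ∑ a, ∑ b, starRingEnd ℂ (ξ a) * ξ b * G a b x
        = ((∑ a, ‖ξ a‖ ^ 2 : ℝ) : ℂ) * ρ x := by
      push_cast
      rw [Finset.sum_mul]
      refine Finset.sum_congr rfl fun a _ => ?_
      rw [Finset.sum_eq_single a]
      · simp only [G, if_true, h2]
        rw [Complex.conj_mul']
      · intro b _ hb
        simp [G, Ne.symm hb]
      · simp
    rw [h3, mul_eq_zero, or_iff_left hρx, Complex.ofReal_eq_zero,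
      Finset.sum_eq_zero_iff_of_nonneg fun a _ => by positivity] at hξ
    funext a
    simpa using hξ a (Finset.mem_univ a)
  filter_upwards [ae_all_iff.2 key] with x hx
  exact ENat.forall_natCast_le_iff_le.1 hx

/-- The spectral multiplicities may be read off any model. -/
theorem IsSpectralModel.essentialMultiplicities_eq (hχ : IsCharacterSystem χ)
    (hV : IsUnitaryRep V) (hM : IsSpectralModel χ V μ m) :
    essentialMultiplicities χ V = {n | μ {x | m x = n} ≠ 0} := by
  ext n
  refine ⟨?_, fun h => ⟨μ, m, hM, h⟩⟩
  rintro ⟨μ', m', hM', h⟩ h0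
  refine h (hM.absolutelyContinuous_model hχ hV hM' ?_)
  refine le_antisymm (le_trans (measure_mono_ae ?_) h0.le) bot_le
  have hac := hM'.absolutelyContinuous_model hχ hV hM
  filter_upwards [hM.ae_le hχ hV hM', hac.ae_le (hM'.ae_le hχ hV hM)] with x h1 h2 h3
  exact (le_antisymm h1 h2).symm.trans h3

/-- Spectral theorem: existence of a spectral model. -/
theorem exists_isSpectralModel [CompleteSpace H] [TopologicalSpace.SeparableSpace H]
    (hχ : IsCharacterSystem χ) (hV : IsUnitaryRep V)
    (hσ : ∀ h : H, ∃ σ : Measure X, IsFiniteMeasure σ ∧ ∀ i, inner ℂ h (V i h) = ∫ x, χ i x ∂σ) :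
    ∃ (μ : Measure X) (m : X → ℕ∞), IsSpectralModel χ V μ m := by
  obtain ⟨σ, f, hf⟩ := _root_.exists_isCyclicFamily hV hσ
  have hfin := hf.finite
  -- A finite measure equivalent to the sum of all the spectral measures; each `σ n` is then
  -- exchanged for `μ` restricted to the set where its density is nonzero.
  let μ := (Measure.sum σ).toFinite
  have hac : ∀ n, σ n ≪ μ := fun n =>
    (Measure.absolutelyContinuous_sum_right n Measure.AbsolutelyContinuous.rfl).trans
      (absolutelyContinuous_toFinite _)
  let B : ℕ → Set X := fun n => {x | (σ n).rnDeriv μ x ≠ 0}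
  have hB : ∀ n, MeasurableSet (B n) := fun n =>
    (Measure.measurable_rnDeriv (σ n) μ) (measurableSet_singleton 0).compl
  obtain ⟨f', hf'⟩ := hf.exists_of_absolutelyContinuous hχ hV (τ := fun n => μ.restrict (B n))
    (fun n => inferInstance) (fun n => (absolutelyContinuous_restrict_rnDeriv_ne_zero (hac n)).1)
    (fun n => (absolutelyContinuous_restrict_rnDeriv_ne_zero (hac n)).2)
  refine ⟨μ, _, hf'.isSpectralModel_sorted hχ hV hB ?_⟩
  have h1 : ∀ᵐ x ∂Measure.sum σ, ∃ n, x ∈ B n := by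
    rw [Measure.ae_sum_iff]
    intro n
    have h2 : ∀ᵐ x ∂σ n, x ∈ B n := (absolutelyContinuous_restrict_rnDeriv_ne_zero (hac n)).1.ae_le
      (ae_restrict_mem (hB n))
    exact h2.mono fun x hx => ⟨n, hx⟩
  exact (toFinite_absolutelyContinuous _).ae_le h1

end Uniqueness

/-! ### Bochner's theorem for unitary flows -/

section Bochner

open scoped FourierTransform SchwartzMap

variable {H : Type*} [NormedAddCommGroup H] [InnerProductSpace ℂ H] [CompleteSpace H]

/-- Translation on `L²(ℝ, H)`. -/
noncomputable def translateLp (t : ℝ) : Lp H 2 (volume : Measure ℝ) →ₗᵢ[ℂ] Lp H 2 (volume : Measure ℝ) :=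
  Lp.compMeasurePreservingₗᵢ ℂ (· + t) (measurePreserving_add_right volume t)

omit [CompleteSpace H] in
theorem translateLp_ae (t : ℝ) (f : Lp H 2 (volume : Measure ℝ)) :
    translateLp t f =ᵐ[volume] fun s => f (s + t) :=
  Lp.coeFn_compMeasurePreserving f (measurePreserving_add_right volume t)

theorem norm_exp_two_pi_mul (t x : ℝ) : ‖Complex.exp (2 * Real.pi * t * x * Complex.I)‖ = 1 := by
  have : (2 * Real.pi * t * x * Complex.I : ℂ) = ((2 * Real.pi * t * x : ℝ) : ℂ) * Complex.I := by
    push_cast; ring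
  rw [this]
  exact Complex.norm_exp_ofReal_mul_I _

omit [CompleteSpace H] in
theorem memLp_exp_smul (t : ℝ) (g : Lp H 2 (volume : Measure ℝ)) :
    MemLp (fun x : ℝ => starRingEnd ℂ (Complex.exp (2 * Real.pi * t * x * Complex.I)) • g x) 2
      volume := by
  refine (Lp.memLp g).of_le (AEStronglyMeasurable.smul (by fun_prop) (Lp.aestronglyMeasurable g))
    (Eventually.of_forall fun x => ?_)
  rw [norm_smul, RCLike.norm_conj, norm_exp_two_pi_mul, one_mul]

omit [CompleteSpace H] in
theorem fourier_comp_add_right (f : ℝ → H) (t x : ℝ) :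
    𝓕 (fun s => f (s + t)) x = Complex.exp (2 * Real.pi * t * x * Complex.I) • 𝓕 f x := by
  rw [Real.fourier_real_eq_integral_exp_smul, Real.fourier_real_eq_integral_exp_smul,
    ← integral_smul, ← integral_add_right_eq_self (fun s : ℝ =>
      Complex.exp (2 * Real.pi * t * x * Complex.I) •
        Complex.exp (((-2 * Real.pi * s * x : ℝ) : ℂ) * Complex.I) • f s) t]
  congr 1 with s
  rw [smul_smul, ← Complex.exp_add]
  congr 2
  push_cast
  ring

/-- The Fourier transform turns a translation into multiplication by a character. With the character
moved to `g`, both sides are continuous in `f`, so Schwartz functions suffice. -/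
theorem inner_fourier_translateLp (t : ℝ) (f g : Lp H 2 (volume : Measure ℝ)) :
    inner ℂ g (𝓕 (translateLp t f)) = inner ℂ ((memLp_exp_smul t g).toLp _) (𝓕 f) := by
  have hc : Continuous fun f : Lp H 2 (volume : Measure ℝ) => 𝓕 f :=
    (Lp.fourierTransformₗᵢ ℝ H).continuous
  refine (SchwartzMap.denseRange_toLpCLM (E := ℝ) (F := H) (p := 2) (μ := volume)
    ENNReal.ofNat_ne_top).induction_on
    (p := fun f => inner ℂ g (𝓕 (translateLp t f)) = inner ℂ ((memLp_exp_smul t g).toLp _) (𝓕 f)) f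
    (isClosed_eq (continuous_const.inner (hc.comp (translateLp t).continuous))
      (continuous_const.inner hc)) fun u => ?_
  change inner ℂ g (𝓕 (translateLp t (u.toLp 2))) = inner ℂ ((memLp_exp_smul t g).toLp _) (𝓕 (u.toLp 2))
  have h1 : translateLp t (u.toLp 2) = (u.compSubConstCLM ℝ (-t)).toLp 2 := by
    apply Lp.ext
    have h2 := (measurePreserving_add_right volume t).quasiMeasurePreserving.ae_eq_comp
      (u.coeFn_toLp 2 volume)
    filter_upwards [translateLp_ae t (u.toLp 2), h2, (u.compSubConstCLM ℝ (-t)).coeFn_toLp 2 volume]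
      with s a b c
    rw [a, c, SchwartzMap.compSubConstCLM_apply, sub_neg_eq_add]
    exact b
  rw [h1, SchwartzMap.toLp_fourier_eq, SchwartzMap.toLp_fourier_eq, L2.inner_def, L2.inner_def]
  refine integral_congr_ae ?_
  filter_upwards [(𝓕 u).coeFn_toLp 2 volume, (𝓕 (u.compSubConstCLM ℝ (-t))).coeFn_toLp 2 volume,
    (memLp_exp_smul t g).coeFn_toLp] with x a b c
  rw [a, b, c, SchwartzMap.fourier_coe, SchwartzMap.fourier_coe, inner_smul_left,
    ← inner_smul_right, Complex.conj_conj, ← fourier_comp_add_right]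
  have h3 : ⇑(u.compSubConstCLM ℝ (-t)) = fun s => u (s + t) := by
    funext s
    rw [SchwartzMap.compSubConstCLM_apply, sub_neg_eq_add]
  rw [h3]

/-- The autocorrelation function of `f ∈ L²(ℝ, H)` is the characteristic function of a measure. -/
theorem exists_charFun_eq_inner_translateLp (f : Lp H 2 (volume : Measure ℝ)) :
    ∃ ρ : Measure ℝ, IsFiniteMeasure ρ ∧ ∀ t, charFun ρ t = inner ℂ f (translateLp t f) := by
  let F : Lp H 2 (volume : Measure ℝ) := 𝓕 f
  have hFi : Integrable (fun x => ‖F x‖ ^ 2) volume :=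
    (memLp_two_iff_integrable_sq_norm (Lp.aestronglyMeasurable F)).1 (Lp.memLp F)
  let ρ₀ : Measure ℝ := volume.withDensity fun x => ENNReal.ofReal (‖F x‖ ^ 2)
  have hρ₀ : IsFiniteMeasure ρ₀ := isFiniteMeasure_withDensity hFi.lintegral_lt_top.ne
  -- By Plancherel the autocorrelation is the Fourier integral of `‖F‖²`; dilation by `2π`
  -- reconciles the kernel `exp (2πitx)` with the kernel `exp (itx)` of `charFun`.
  refine ⟨ρ₀.map (fun x => 2 * Real.pi * x), inferInstance, fun t => ?_⟩
  rw [charFun_apply_real, integral_map (by fun_prop) (by fun_prop),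
    integral_withDensity_eq_integral_toReal_smul₀ hFi.aemeasurable.ennreal_ofReal
      (Eventually.of_forall fun x => ENNReal.ofReal_lt_top),
    ← Lp.inner_fourier_eq, inner_fourier_translateLp, L2.inner_def]
  refine integral_congr_ae ?_
  filter_upwards [(memLp_exp_smul t F).coeFn_toLp] with x hx
  rw [hx, ENNReal.toReal_ofReal (by positivity), inner_smul_left, Complex.conj_conj,
    inner_self_eq_norm_sq_to_K, Complex.real_smul, mul_comm]
  push_cast
  congr 2
  ring

omit [CompleteSpace H] in
theorem UnitaryFlow.isUnitaryRep (U : UnitaryFlow H) : IsUnitaryRep U.toFun :=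
  ⟨U.map_zero, U.map_add⟩

/-- The Fejér regularizations of a positive definite function `⟨h, U_t h⟩`. -/
theorem UnitaryFlow.exists_charFun_eq_fejer (U : UnitaryFlow H) (h : H) {N : ℝ} (hN : 0 < N) :
    ∃ ρ : Measure ℝ, IsFiniteMeasure ρ ∧
      ∀ t, charFun ρ t = ((max (1 - |t| / (2 * N)) 0 : ℝ) : ℂ) * inner ℂ h (U.toFun t h) := by
  -- The orbit `s ↦ U_s h` is cut off to `[-N, N]` and normalized by `c² = 1/(2N)`. Its integrand
  -- against the translate is constant on an overlap of length `max (2N - |t|) 0`, whence the Fejér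
  -- factor.
  let c : ℝ := √(2 * N)⁻¹
  have hc : c * c = (2 * N)⁻¹ := Real.mul_self_sqrt (by positivity)
  let g : ℝ → H := (Set.Icc (-N) N).indicator fun s => (c : ℂ) • U.toFun s h
  have hg : MemLp g 2 volume := by
    refine (memLp_indicator_iff_restrict measurableSet_Icc).2 ?_
    refine MemLp.of_bound ((U.continuous h).const_smul (c : ℂ)).aestronglyMeasurable
      (‖(c : ℂ)‖ * ‖h‖) (Eventually.of_forall fun s => ?_)
    rw [norm_smul, LinearIsometryEquiv.norm_map]
  obtain ⟨ρ, hρ, hρt⟩ := exists_charFun_eq_inner_translateLp (hg.toLp g)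
  refine ⟨ρ, hρ, fun t => ?_⟩
  rw [hρt, L2.inner_def]
  have h1 := (measurePreserving_add_right volume t).quasiMeasurePreserving.ae_eq_comp hg.coeFn_toLp
  have h2 : ∫ s, inner ℂ (hg.toLp g s) (translateLp t (hg.toLp g) s)
      = ∫ s, (Set.Icc (max (-N) (-N - t)) (min N (N - t))).indicator
          (fun _ => ((2 * N)⁻¹ : ℂ) * inner ℂ h (U.toFun t h)) s := by
    refine integral_congr_ae ?_
    filter_upwards [hg.coeFn_toLp, translateLp_ae t (hg.toLp g), h1] with s a b d
    simp only [Function.comp_apply] at d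
    rw [a, b, d]
    by_cases hs : s ∈ Set.Icc (-N) N
    · by_cases hst : s + t ∈ Set.Icc (-N) N
      · rw [Set.indicator_of_mem (by
          simp only [Set.mem_Icc, max_le_iff, le_min_iff] at *
          exact ⟨⟨hs.1, by linarith⟩, hs.2, by linarith⟩)]
        simp only [g, Set.indicator_of_mem hs, Set.indicator_of_mem hst]
        rw [inner_smul_left, inner_smul_right, Complex.conj_ofReal, ← mul_assoc,
          ← Complex.ofReal_mul, hc, U.isUnitaryRep.inner_map_map, add_sub_cancel_left]
        push_cast
        ring
      · rw [Set.indicator_of_notMem (fun hm => hst (by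
          simp only [Set.mem_Icc, max_le_iff, le_min_iff] at *
          exact ⟨by linarith [hm.1.2], by linarith [hm.2.2]⟩))]
        simp only [g, Set.indicator_of_notMem hst, inner_zero_right]
    · rw [Set.indicator_of_notMem (fun hm => hs (by
          simp only [Set.mem_Icc, max_le_iff, le_min_iff] at *
          exact ⟨hm.1.1, hm.2.1⟩))]
      simp only [g, Set.indicator_of_notMem hs, inner_zero_left]
  rw [h2, integral_indicator_const _ measurableSet_Icc, Real.volume_real_Icc, Complex.real_smul,
    ← mul_assoc]
  congr 1
  have h3 : min N (N - t) - max (-N) (-N - t) = 2 * N - |t| := by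
    rcases le_total 0 t with h | h
    · rw [abs_of_nonneg h, min_eq_right (by linarith), max_eq_left (by linarith)]; ring
    · rw [abs_of_nonpos h, min_eq_left (by linarith), max_eq_right (by linarith)]; ring
  have h4 : max (1 - |t| / (2 * N)) 0 = max (2 * N - |t|) 0 * (2 * N)⁻¹ := by
    rw [max_mul_of_nonneg _ _ (by positivity), zero_mul]
    congr 1
    field_simp
  rw [h3, h4]
  push_cast
  ring

/-- Bochner's theorem for a unit vector. -/
theorem UnitaryFlow.exists_isSpectralMeasure_of_norm_eq_one (U : UnitaryFlow H) {h : H}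
    (hh : ‖h‖ = 1) : ∃ σ : Measure ℝ, U.IsSpectralMeasure h σ := by
  choose ρ hρf hρ using fun n : ℕ =>
    U.exists_charFun_eq_fejer h (N := (n : ℝ) + 1) (by positivity)
  have hprob : ∀ n, IsProbabilityMeasure (ρ n) := by
    intro n
    have h0 := hρ n 0
    rw [charFun_zero, U.map_zero, inner_self_eq_norm_sq_to_K, hh] at h0
    refine isProbabilityMeasure_iff_real.2 ?_
    refine Complex.ofReal_injective ?_
    rw [h0]
    simp
  have hlim : ∀ t, Tendsto (fun n => charFun (ρ n) t) atTop (𝓝 (inner ℂ h (U.toFun t h))) := by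
    intro t
    simp_rw [hρ]
    have h1 : Tendsto (fun n : ℕ => max (1 - |t| / (2 * ((n : ℝ) + 1))) 0) atTop (𝓝 (max (1 - 0) 0)) := by
      refine (Tendsto.sub tendsto_const_nhds ?_).max tendsto_const_nhds
      refine Tendsto.div_atTop tendsto_const_nhds ?_
      exact Tendsto.const_mul_atTop (by norm_num)
        (tendsto_atTop_add_const_right _ _ tendsto_natCast_atTop_atTop)
    have h2 := (Complex.continuous_ofReal.tendsto _).comp h1
    have h3 := h2.mul_const (inner ℂ h (U.toFun t h))
    simpa using h3
  have hcont : Continuous fun t => (inner ℂ h (U.toFun t h) : ℂ) :=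
    continuous_const.inner (U.continuous h)
  -- Continuity at `0` of the limit of the characteristic functions gives tightness, hence
  -- compactness. A limit along an ultrafilter suffices, since the characteristic functions are
  -- already known to converge.
  have htight := isTightMeasureSet_of_tendsto_charFun hcont.continuousAt hlim
  let μ : ℕ → ProbabilityMeasure ℝ := fun n => ⟨ρ n, hprob n⟩
  have hcomp : IsCompact (closure (Set.range μ)) := by
    refine isCompact_closure_of_isTightMeasureSet ?_
    refine htight.subset ?_
    rintro _ ⟨_, ⟨n, rfl⟩, rfl⟩
    exact ⟨n, rfl⟩
  obtain ⟨ν, -, hν⟩ := hcomp.ultrafilter_le_nhds ((Ultrafilter.of atTop).map μ)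
    (le_principal_iff.2 (Filter.mem_map.2 (Eventually.of_forall fun n =>
      subset_closure (Set.mem_range_self n))))
  have hν' : Tendsto μ (Ultrafilter.of (atTop : Filter ℕ)) (𝓝 ν) := hν
  rw [ProbabilityMeasure.tendsto_iff_forall_integral_rclike_tendsto ℂ] at hν'
  refine ⟨ν, inferInstance, fun t => ?_⟩
  have h1 := hν' (BoundedContinuousFunction.innerProbChar t)
  have h2 := (hlim t).mono_left (Ultrafilter.of_le atTop)
  simp_rw [charFun_eq_integral_innerProbChar] at h2
  rw [tendsto_nhds_unique h2 h1, ← charFun_eq_integral_innerProbChar, charFun_apply_real]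

/-- **Bochner's theorem** for unitary flows: every vector has a spectral measure. -/
theorem UnitaryFlow.exists_isSpectralMeasure (U : UnitaryFlow H) (h : H) :
    ∃ σ : Measure ℝ, U.IsSpectralMeasure h σ := by
  rcases eq_or_ne h 0 with rfl | h0
  · exact ⟨0, inferInstance, fun t => by simp⟩
  · have hn : ‖h‖ ≠ 0 := norm_ne_zero_iff.2 h0
    obtain ⟨σ, hσ, hσt⟩ := U.exists_isSpectralMeasure_of_norm_eq_one
      (h := ((‖h‖⁻¹ : ℝ) : ℂ) • h) (by
        rw [norm_smul, Complex.norm_real, norm_inv, norm_norm, inv_mul_cancel₀ hn])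
    refine ⟨ENNReal.ofReal (‖h‖ ^ 2) • σ, ⟨?_⟩, fun t => ?_⟩
    · rw [Measure.smul_apply, smul_eq_mul]
      exact ENNReal.mul_lt_top ENNReal.ofReal_lt_top (measure_lt_top σ _)
    · rw [integral_smul_measure, ← hσt, map_smul, inner_smul_left, inner_smul_right,
        Complex.conj_ofReal, ENNReal.toReal_ofReal (by positivity), Complex.real_smul]
      have : (‖h‖ : ℂ) ≠ 0 := by exact_mod_cast hn
      push_cast
      field_simp

end Bochner

/-! ### Folding the line onto the circle -/

section Folding

variable {X Y : Type*} [MeasurableSpace X] [MeasurableSpace Y]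

/-- A measurable map which is injective on `A` has a measurable left inverse on `A`. -/
theorem exists_measurable_leftInvOn [StandardBorelSpace X] [MeasurableSpace.CountablySeparated Y]
    {φ : X → Y} (hφ : Measurable φ) {A : Set X} (hA : MeasurableSet A) (hinj : Set.InjOn φ A)
    (hne : A.Nonempty) : ∃ ψ : Y → X, Measurable ψ ∧ ∀ x ∈ A, ψ (φ x) = x := by
  have := hA.standardBorel
  have hemb : MeasurableEmbedding (fun x : A => φ x) :=
    (hφ.comp measurable_subtype_coe).measurableEmbedding fun x y h =>
      Subtype.ext (hinj x.2 y.2 h)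
  obtain ⟨ψ, hψ, hψ'⟩ := hemb.exists_measurable_extend (measurable_subtype_coe (p := (· ∈ A)))
    fun _ => ⟨hne.some⟩
  exact ⟨ψ, hψ, fun x hx => congr_fun hψ' ⟨x, hx⟩⟩

variable {ι ι' : Type*} [AddCommGroup ι] [AddCommGroup ι'] {χ : ι → X → ℂ} {χ' : ι' → Y → ℂ}

/-- On `A` the map `φ` has a measurable left inverse, so `g` is a function of `φ` there and the
question moves to the image measure on `Y`. -/
theorem IsCharacterSystem.ae_eq_zero_of_injOn [StandardBorelSpace X]
    [MeasurableSpace.CountablySeparated Y] (hχ' : IsCharacterSystem χ')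
    {φ : X → Y} (hφ : Measurable φ) {A : Set X} (hA : MeasurableSet A) (hinj : Set.InjOn φ A)
    {μ : Measure X} {g : X → ℂ} (hg : Integrable g (μ.restrict A))
    (h : ∀ i, ∫ x in A, χ' i (φ x) * g x ∂μ = 0) : g =ᵐ[μ.restrict A] 0 := by
  rcases A.eq_empty_or_nonempty with rfl | hne
  · rw [Measure.restrict_empty, ae_zero]
    exact eventually_bot
  obtain ⟨ψ, hψ, hψφ⟩ := exists_measurable_leftInvOn hφ hA hinj hne
  have hψφ' : ∀ᵐ x ∂μ.restrict A, ψ (φ x) = x := (ae_restrict_mem hA).mono hψφ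
  have hmp : Measure.map ψ (Measure.map φ (μ.restrict A)) = μ.restrict A := by
    rw [Measure.map_map hψ hφ, Measure.map_congr (f := ψ ∘ φ) (g := id) hψφ', Measure.map_id]
  have hg' : Integrable g (Measure.map ψ (Measure.map φ (μ.restrict A))) := by rwa [hmp]
  have hgψ : Integrable (g ∘ ψ) (Measure.map φ (μ.restrict A)) := hg'.comp_measurable hψ
  have h0 : g ∘ ψ =ᵐ[Measure.map φ (μ.restrict A)] 0 := by
    refine hχ'.ae_eq_zero hgψ fun i => ?_
    rw [integral_map (f := fun y => χ' i y * (g ∘ ψ) y) hφ.aemeasurable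
      ((hχ'.measurable i).aestronglyMeasurable.mul hgψ.aestronglyMeasurable), ← h i]
    refine integral_congr_ae ?_
    filter_upwards [hψφ'] with x hx
    simp only [Function.comp_apply, hx]
  filter_upwards [ae_of_ae_map hφ.aemeasurable h0, hψφ'] with x h1 h2
  simpa [h2] using h1

variable {H : Type*} [NormedAddCommGroup H] [InnerProductSpace ℂ H]
  {V : ι → H ≃ₗᵢ[ℂ] H} {V' : ι' → H ≃ₗᵢ[ℂ] H}

/-- Transport of a cyclic family to a coarser group of characters: the base space is cut into
pieces on which the folding map `φ` is injective. -/
theorem IsCyclicFamily.exists_of_injOn [CompleteSpace H] [StandardBorelSpace X]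
    [MeasurableSpace.CountablySeparated Y] (hχ : IsCharacterSystem χ) (hχ' : IsCharacterSystem χ')
    (hV : IsUnitaryRep V) {j : ι' → ι} (hj : ∀ n, j (-n) = -j n) (hVV' : ∀ n h, V' n h = V (j n) h)
    {φ : X → Y} (hφ : Measurable φ) (hφχ : ∀ n x, χ' n (φ x) = χ (j n) x)
    {κ π : Type*} [Countable π] {σ : κ → Measure X} {f : κ → H} (hf : IsCyclicFamily χ V σ f)
    {A : π → Set X} (hA : ∀ p, MeasurableSet (A p)) (hdisj : Pairwise (Function.onFun Disjoint A))
    (hinj : ∀ p, Set.InjOn φ (A p)) (hcov : ∀ a, ∀ᵐ x ∂σ a, ∃ p, x ∈ A p) :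
    ∃ f' : κ × π → H, IsCyclicFamily χ' V' (fun q => ((σ q.1).restrict (A q.2)).map φ) f' := by
  classical
  obtain ⟨W, hW, -⟩ := hf.exists_intertwines hχ hV
  have hfin := hf.finite
  have hmem : ∀ q : κ × π, MemLp ((A q.2).indicator fun _ => (1 : ℂ)) 2 (σ q.1) := fun q =>
    (memLp_const 1).indicator (hA q.2)
  let u : ∀ q : κ × π, Lp ℂ 2 (σ q.1) := fun q => (hmem q).toLp _
  have hu : ∀ q, (u q : X → ℂ) =ᵐ[σ q.1] (A q.2).indicator fun _ => (1 : ℂ) := fun q =>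
    (hmem q).coeFn_toLp
  -- The generator with index `(a, p)` is the indicator of `A p` in coordinate `a`. It generates
  -- everything over `A p` even under the coarser group, because `φ` is injective there.
  let f' : κ × π → H := fun q => W.symm (lp.single 2 q.1 (u q))
  have hWf : ∀ q, W (f' q) = lp.single 2 q.1 (u q) := fun q => W.apply_symm_apply _
  have hinner : ∀ q n h, inner ℂ (V' n (f' q)) h
      = ∫ x in A q.2, χ' (-n) (φ x) * W h q.1 x ∂σ q.1 := by
    intro q n h
    rw [hVV', hW.inner_single hV, ← integral_indicator (hA q.2)]
    refine integral_congr_ae ?_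
    filter_upwards [hu q] with x hx
    rw [hx]
    by_cases hxA : x ∈ A q.2
    · simp [hxA, hφχ, hj]
    · simp [hxA]
  have hself : ∀ q n r, inner ℂ (f' q) (V' n (f' r))
      = ∫ x in A q.2, χ' n (φ x) * W (f' r) q.1 x ∂σ q.1 := by
    intro q n r
    have := hinner q (-n) (f' r)
    rwa [hVV', hj, hV.inner_map_left, neg_neg, neg_neg, ← hVV'] at this
  refine ⟨f', fun q => inferInstance, fun q n => ?_, fun q r n hqr => ?_, fun g hg => ?_⟩
  · rw [hself, integral_map hφ.aemeasurable (hχ'.measurable n).aestronglyMeasurable]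
    refine integral_congr_ae ?_
    filter_upwards [ae_restrict_of_ae (hu q), ae_restrict_mem (hA q.2)] with x hx hxA
    rw [hWf, lp.single_apply_self, hx, Set.indicator_of_mem hxA, mul_one]
  · rw [hself]
    refine integral_eq_zero_of_ae ?_
    rw [hWf]
    by_cases hqr1 : q.1 = r.1
    · obtain ⟨a, p⟩ := q
      obtain ⟨b, p'⟩ := r
      obtain rfl : a = b := hqr1
      have hp : p ≠ p' := fun h => hqr (by rw [h])
      filter_upwards [ae_restrict_of_ae (hu (a, p')), ae_restrict_mem (hA p)] with x hx hxA
      rw [lp.single_apply_self, hx, Set.indicator_of_notMem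
        (Set.disjoint_left.1 (hdisj hp) hxA), mul_zero, Pi.zero_apply]
    · rw [lp.single_apply_ne _ _ _ hqr1]
      filter_upwards [ae_restrict_of_ae (Lp.coeFn_zero ℂ 2 (σ q.1))] with x hx
      rw [hx, Pi.zero_apply, mul_zero]
  · apply W.injective
    rw [_root_.map_zero]
    ext1
    funext a
    rw [lp.coeFn_zero, Pi.zero_apply, Lp.eq_zero_iff_ae_eq_zero]
    have h1 : ∀ p, ∀ᵐ x ∂σ a, x ∈ A p → W g a x = 0 := fun p => by
      rw [← ae_restrict_iff' (hA p)]
      refine hχ'.ae_eq_zero_of_injOn hφ (hA p) (hinj p) (integrable_of_Lp_two _).integrableOn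
        fun i => ?_
      have := hinner (a, p) (-i) g
      rw [hg, neg_neg] at this
      exact this.symm
    filter_upwards [ae_all_iff.2 h1, hcov a] with x h2 ⟨p, hp⟩
    exact h2 p hp


theorem IsUnitaryRep.zpow_apply {ι : Type*} [AddCommGroup ι] {V : ι → H ≃ₗᵢ[ℂ] H}
    (hV : IsUnitaryRep V) (i : ι) (n : ℤ) (h : H) : (V i ^ n) h = V (n • i) h := by
  induction n with
  | zero => rw [zpow_zero, zero_smul, hV.map_zero]; rfl
  | succ n ih =>
    rw [add_comm, zpow_one_add, add_smul, one_smul, hV.map_add, ← ih]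
    rfl
  | pred n ih =>
    apply (V i).injective
    rw [← hV.map_add, ← one_add_zsmul, add_sub_cancel, ← ih]
    change (V i * V i ^ (-(n : ℤ) - 1)) h = _
    rw [← zpow_one_add, add_sub_cancel]

theorem isUnitaryRep_zpow (U : H ≃ₗᵢ[ℂ] H) : IsUnitaryRep fun n : ℤ => U ^ n :=
  ⟨fun h => by rw [zpow_zero]; rfl, fun i j h => by rw [zpow_add]; rfl⟩

/-- A single unitary and the cyclic group of its powers have the same models; negative powers are
reached by cancelling `z ≠ 0`. The results for groups of characters thus apply to one operator. -/
theorem isSpectralModel_unit_iff {U : H ≃ₗᵢ[ℂ] H} {μ : Measure Circle} {m : Circle → ℕ∞} :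
    IsSpectralModel (fun (_ : Unit) (z : Circle) => (z : ℂ)) (fun _ => U) μ m ↔
      IsSpectralModel (fun (n : ℤ) (z : Circle) => (z : ℂ) ^ n) (fun n => U ^ n) μ m := by
  refine ⟨fun h => ⟨h.1, h.2, h.3, ?_⟩, fun h => ⟨h.1, h.2, h.3, ?_⟩⟩
  · obtain ⟨W, hW⟩ := h.4
    refine ⟨W, fun n => ?_⟩
    induction n with
    | zero => intro h k; simp
    | succ n ih =>
      intro h k
      filter_upwards [hW () ((U ^ (n : ℤ)) h) k, ih h k] with z h1 h2
      have h3 : (U ^ ((n : ℤ) + 1)) h = U ((U ^ (n : ℤ)) h) := by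
        rw [add_comm, zpow_one_add]; rfl
      rw [h3, h1, h2, add_comm, zpow_one_add₀ z.coe_ne_zero, mul_assoc]
    | pred n ih =>
      intro h k
      filter_upwards [hW () ((U ^ (-(n : ℤ) - 1)) h) k, ih h k] with z h1 h2
      have h3 : (U ^ (-(n : ℤ))) h = U ((U ^ (-(n : ℤ) - 1)) h) := by
        change _ = (U * U ^ (-(n : ℤ) - 1)) h
        rw [← zpow_one_add, add_sub_cancel]
      rw [h3, h1] at h2
      apply mul_left_cancel₀ z.coe_ne_zero
      rw [h2, ← mul_assoc, ← zpow_one_add₀ z.coe_ne_zero, add_sub_cancel]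
  · obtain ⟨W, hW⟩ := h.4
    exact ⟨W, fun _ h k => by simpa using hW 1 h k⟩

theorem multiplicitySet_eq (U : H ≃ₗᵢ[ℂ] H) : multiplicitySet U =
    essentialMultiplicities (fun (n : ℤ) (z : Circle) => (z : ℂ) ^ n) (fun n => U ^ n) := by
  unfold multiplicitySet essentialMultiplicities
  simp only [isSpectralModel_unit_iff]

/-- For fixed `x` and `k ≠ 0`, every bad parameter `t ≠ 0` lies in the image of `N \ {x}` under `y ↦
2πk / (x - y)`. This map is differentiable, so the image is null, and Fubini exchanges `t` and `x`.
-/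
theorem ae_forall_sub_notMem {N : Set ℝ} (hN : MeasurableSet N) (hN0 : volume N = 0)
    (μ : Measure ℝ) [SFinite μ] :
    ∀ᵐ t : ℝ, ∀ k : ℤ, k ≠ 0 → ∀ᵐ x ∂μ, x - 2 * Real.pi * k / t ∉ N := by
  rw [ae_all_iff]
  intro k
  by_cases hk : k = 0
  · exact Eventually.of_forall fun _ h => (h hk).elim
  have hc : 2 * Real.pi * k ≠ 0 := by
    have := Real.pi_ne_zero
    have : (k : ℝ) ≠ 0 := by exact_mod_cast hk
    positivity
  generalize 2 * Real.pi * k = c at hc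
  suffices ∀ᵐ t : ℝ, ∀ᵐ x ∂μ, x - c / t ∉ N from this.mono fun t ht _ => ht
  rw [Measure.ae_ae_comm (p := fun t x => x - c / t ∉ N)
    ((measurable_snd.sub (measurable_const.div measurable_fst)) hN).compl]
  refine Eventually.of_forall fun x => ?_
  have h1 : volume ((fun y => c / (x - y)) '' (N \ {x})) = 0 := by
    refine addHaar_image_eq_zero_of_differentiableOn_of_addHaar_eq_zero volume (fun y hy => ?_)
      (measure_mono_null Set.sdiff_subset hN0)
    have : x - y ≠ 0 := sub_ne_zero.2 fun h => hy.2 h.symm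
    exact ((differentiableAt_const c).div (by fun_prop) this).differentiableWithinAt
  filter_upwards [compl_mem_ae_iff.2 h1, Measure.ae_ne volume 0] with t ht ht0 hN'
  refine ht ⟨x - c / t, ⟨hN', fun h => ?_⟩, ?_⟩
  · have : c / t = 0 := by simpa using h
    exact div_ne_zero hc ht0 this
  · field_simp
    simpa using hc

/-- The points of `N` which have no other translate by the lattice `(2π/t)ℤ` in `N`. -/
def isolatedPart (N : Set ℝ) (t : ℝ) : Set ℝ :=
  {x | x ∈ N ∧ ∀ k : ℤ, k ≠ 0 → x - 2 * Real.pi * k / t ∉ N}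

theorem measurableSet_isolatedPart {N : Set ℝ} (hN : MeasurableSet N) (t : ℝ) :
    MeasurableSet (isolatedPart N t) := by
  have : isolatedPart N t
      = N ∩ ⋂ k : ℤ, ⋂ _ : k ≠ 0, {x | x - 2 * Real.pi * k / t ∈ N}ᶜ := by
    ext x; simp [isolatedPart]
  rw [this]
  exact hN.inter (MeasurableSet.iInter fun k => MeasurableSet.iInter fun _ =>
    ((measurable_id.sub_const _) hN).compl)

/-- Points with equal images differ by a multiple of `2π/t`. Since `x` need not lie in `N`, this
also keeps generic points outside `N` from being folded onto points of `N`. -/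
theorem eq_of_exp_eq {N : Set ℝ} {t : ℝ} (ht : t ≠ 0) {x y : ℝ}
    (hx : ∀ k : ℤ, k ≠ 0 → x - 2 * Real.pi * k / t ∉ N) (hy : y ∈ N)
    (h : Circle.exp (t * x) = Circle.exp (t * y)) : x = y := by
  obtain ⟨k, hk⟩ := Circle.exp_eq_exp.1 h
  have h1 : y = x - 2 * Real.pi * k / t := by
    field_simp
    linarith
  by_cases hk0 : k = 0
  · rw [h1, hk0]; simp
  · exact (hx k hk0 (h1 ▸ hy)).elim

theorem injOn_isolatedPart {N : Set ℝ} {t : ℝ} (ht : t ≠ 0) :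
    Set.InjOn (fun x => Circle.exp (t * x)) (isolatedPart N t) := fun _ hx _ hy h =>
  eq_of_exp_eq ht hx.2 hy.1 h

/-- Each level set of the floor is a fundamental domain for translation by `2π/t`. -/
theorem injOn_floor {t : ℝ} (ht : t ≠ 0) (j : ℤ) :
    Set.InjOn (fun x => Circle.exp (t * x)) {x : ℝ | ⌊t * x / (2 * Real.pi)⌋ = j} := by
  intro x hx y hy h
  obtain ⟨k, hk⟩ := Circle.exp_eq_exp.1 h
  have hpi := Real.pi_pos
  have h1 : t * x / (2 * Real.pi) = t * y / (2 * Real.pi) + k := by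
    rw [hk]; field_simp
  have h2 := congrArg Int.floor h1
  rw [Int.floor_add_intCast, show ⌊t * x / (2 * Real.pi)⌋ = j from hx,
    show ⌊t * y / (2 * Real.pi)⌋ = j from hy] at h2
  have h3 : k = 0 := by omega
  have h4 : t * x = t * y := by rw [hk, h3]; simp
  exact mul_left_cancel₀ ht h4

theorem encard_setOf_natCast_lt (n : ℕ∞) : {k : ℕ | (k : ℕ∞) < n}.encard = n := by
  induction n using ENat.recTopCoe with
  | top => simp
  | coe n =>
    have : {k : ℕ | (k : ℕ∞) < n} = Set.Iio n := by ext; simp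
    rw [this, Set.encard_eq_coe_toFinset_card, Set.toFinset_Iio, Nat.card_Iio]


/-- The pieces on which the folding map is injective. -/
def foldingPiece (N : Set ℝ) (t : ℝ) : Option ℤ → Set ℝ
  | none => isolatedPart N t
  | some j => {x | ⌊t * x / (2 * Real.pi)⌋ = j} \ N

theorem measurableSet_foldingPiece {N : Set ℝ} (hN : MeasurableSet N) (t : ℝ) (p : Option ℤ) :
    MeasurableSet (foldingPiece N t p) := by
  cases p with
  | none => exact measurableSet_isolatedPart hN t
  | some j =>
    refine MeasurableSet.diff ?_ hN
    exact (Int.measurable_floor.comp ((measurable_const_mul t).div_const _))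
      (measurableSet_singleton j)

theorem pairwise_disjoint_foldingPiece (N : Set ℝ) (t : ℝ) :
    Pairwise (Function.onFun Disjoint (foldingPiece N t)) := by
  rintro (_ | i) (_ | j) hij <;> refine Set.disjoint_left.2 fun x hx hy => ?_
  · exact hij rfl
  · exact hy.2 hx.1
  · exact hx.2 hy.1
  · exact hij (by rw [← show ⌊t * x / (2 * Real.pi)⌋ = i from hx.1,
      show ⌊t * x / (2 * Real.pi)⌋ = j from hy.1])

theorem injOn_foldingPiece (N : Set ℝ) {t : ℝ} (ht : t ≠ 0) (p : Option ℤ) :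
    Set.InjOn (fun x => Circle.exp (t * x)) (foldingPiece N t p) := by
  cases p with
  | none => exact injOn_isolatedPart ht
  | some j => exact (injOn_floor ht j).mono Set.sdiff_subset

theorem exists_mem_foldingPiece {N : Set ℝ} {t x : ℝ}
    (hx : ∀ k : ℤ, k ≠ 0 → x - 2 * Real.pi * k / t ∉ N) : ∃ p, x ∈ foldingPiece N t p := by
  by_cases hN : x ∈ N
  · exact ⟨none, hN, hx⟩
  · exact ⟨some _, rfl, hN⟩

theorem map_restrict_eq_restrict_image {φ : X → Y} (hφ : Measurable φ) {μ : Measure X}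
    {D : Set X} (hD : MeasurableSet (φ '' D)) (h : ∀ᵐ x ∂μ, φ x ∈ φ '' D → x ∈ D) :
    (μ.restrict D).map φ = (μ.map φ).restrict (φ '' D) := by
  rw [Measure.restrict_map hφ hD]
  congr 1
  refine Measure.restrict_congr_set ?_
  filter_upwards [h] with x hx
  exact propext ⟨fun h' => ⟨x, h', rfl⟩, hx⟩

theorem circle_exp_zpow (t x : ℝ) (n : ℤ) : ((Circle.exp (t * x) : Circle) : ℂ) ^ n
    = Complex.exp (((n • t : ℝ) : ℂ) * x * Complex.I) := by
  rw [Circle.coe_exp, ← Complex.exp_int_mul]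
  congr 1
  push_cast [zsmul_eq_mul]
  ring

/-- The maximal spectral type and the multiplicity function of almost every operator of a flow
whose spectrum has infinite multiplicity off a Lebesgue null set. -/
theorem ae_multiplicitySet_eq [CompleteSpace H] {V : ℝ → H ≃ₗᵢ[ℂ] H} (hV : IsUnitaryRep V)
    {μ : Measure ℝ} {m : ℝ → ℕ∞}
    (hM : IsSpectralModel (fun (t x : ℝ) => Complex.exp (t * x * Complex.I)) V μ m)
    {N : Set ℝ} (hN : MeasurableSet N) (hN0 : volume N = 0) (hm : ∀ᵐ x ∂μ, x ∉ N → m x = ⊤) :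
    ∀ᵐ t : ℝ, multiplicitySet (V t) = {n | μ {x | m x = n} ≠ 0} := by
  have := hM.finite
  filter_upwards [ae_forall_sub_notMem hN hN0 μ, Measure.ae_ne volume 0] with t hgood ht
  have hgood' : ∀ᵐ x ∂μ, ∀ k : ℤ, k ≠ 0 → x - 2 * Real.pi * k / t ∉ N := by
    rw [ae_all_iff]
    intro k
    by_cases hk : k = 0
    · exact Eventually.of_forall fun _ h => (h hk).elim
    · exact (hgood k hk).mono fun x hx _ => hx
  set φ : ℝ → Circle := fun x => Circle.exp (t * x) with hφdef
  have hφ : Measurable φ := by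
    have : Continuous φ := by fun_prop
    exact this.measurable
  set A := foldingPiece N t with hAdef
  have hA : ∀ p, MeasurableSet (A p) := measurableSet_foldingPiece hN t
  obtain ⟨f, hf⟩ := hM.exists_isCyclicFamily isCharacterSystem_real hV
  -- The generators of the flow, cut along the pieces, form a cyclic family of `V t` indexed by `ℕ ×
  -- Option ℤ`. It remains to count how the folded supports overlap.
  obtain ⟨f', hf'⟩ := hf.exists_of_injOn isCharacterSystem_real isCharacterSystem_circle hV
    (V' := fun n : ℤ => V t ^ n) (j := fun n : ℤ => n • t) (fun n => neg_zsmul _ _)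
    (fun n h => hV.zpow_apply t n h) hφ (fun n x => circle_exp_zpow t x n) hA
    (pairwise_disjoint_foldingPiece N t) (injOn_foldingPiece N ht)
    (fun a => ae_restrict_of_ae (hgood'.mono fun x hx => exists_mem_foldingPiece hx))
  set ν := μ.map φ with hν
  let D : ℕ → Set ℝ := fun k => isolatedPart N t ∩ {x | (k : ℕ∞) < m x}
  have hmk : ∀ k : ℕ, MeasurableSet {x | (k : ℕ∞) < m x} := fun k =>
    hM.measurable (.of_discrete (s := Set.Ioi (k : ℕ∞)))
  have hD : ∀ k, MeasurableSet (D k) := fun k => (hA none).inter (hmk k)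
  have himg : ∀ D' ⊆ isolatedPart N t, MeasurableSet D' → MeasurableSet (φ '' D') :=
    fun D' hD' hm' => hm'.image_of_measurable_injOn hφ ((injOn_isolatedPart ht).mono hD')
  have hback : ∀ᵐ x ∂μ, ∀ D' ⊆ isolatedPart N t, φ x ∈ φ '' D' → x ∈ D' := by
    filter_upwards [hgood'] with x hx D' hD' ⟨y, hy, hyx⟩
    rwa [eq_of_exp_eq ht hx (hD' hy).1 hyx.symm]
  -- Since `m = ⊤` outside `N`, the folded measure of a piece `some j` is this same `τ j` for every
  -- index `k`.
  let τ : ℤ → Measure Circle := fun j => (μ.restrict (A (some j))).map φ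
  have hτ : ∀ j, τ j ≪ ν := fun j => Measure.restrict_le_self.absolutelyContinuous.map hφ
  let E : ℤ → Set Circle := fun j => {y | (τ j).rnDeriv ν y ≠ 0}
  have hE : ∀ j, MeasurableSet (E j) := fun j =>
    (Measure.measurable_rnDeriv _ _) (measurableSet_singleton 0).compl
  -- The image of the isolated part may be removed from `E j`, because `τ j` does not charge it;
  -- this keeps finite and infinite multiplicities apart.
  let B : ℕ × Option ℤ → Set Circle := fun q =>
    match q.2 with
    | none => φ '' D q.1
    | some j => E j \ φ '' isolatedPart N t
  have hIm := himg _ subset_rfl (hA none)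
  have hB : ∀ q, MeasurableSet (B q) := by
    rintro ⟨k, _ | j⟩
    · exact himg _ Set.inter_subset_left (hD k)
    · exact (hE j).diff hIm
  have hτE : ∀ j, ν.restrict (E j \ φ '' isolatedPart N t) = ν.restrict (E j) := by
    intro j
    refine Measure.restrict_congr_set ?_
    have h1 : ∀ᵐ y ∂τ j, y ∉ φ '' isolatedPart N t := by
      rw [ae_map_iff hφ.aemeasurable hIm.compl]
      filter_upwards [ae_restrict_of_ae hback, ae_restrict_mem (hA (some j))] with x h1 h2 h3
      exact h2.2 (h1 _ subset_rfl h3).1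
    have h2 := (absolutelyContinuous_restrict_rnDeriv_ne_zero (hτ j)).2.ae_le h1
    filter_upwards [(ae_restrict_iff' (hE j)).1 h2] with y hy
    exact propext ⟨fun h => h.1, fun h => ⟨h, hy h⟩⟩
  have hequiv : ∀ q : ℕ × Option ℤ,
      ((μ.restrict {x | (q.1 : ℕ∞) < m x}).restrict (A q.2)).map φ ≪ ν.restrict (B q) ∧
      ν.restrict (B q) ≪ ((μ.restrict {x | (q.1 : ℕ∞) < m x}).restrict (A q.2)).map φ := by
    rintro ⟨k, _ | j⟩
    · have : ((μ.restrict {x | (k : ℕ∞) < m x}).restrict (A none)).map φ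
          = ν.restrict (φ '' D k) := by
        rw [Measure.restrict_restrict (hA none)]
        exact map_restrict_eq_restrict_image hφ (himg _ Set.inter_subset_left (hD k))
          (hback.mono fun x hx => hx _ Set.inter_subset_left)
      exact ⟨this.le.absolutelyContinuous, this.ge.absolutelyContinuous⟩
    · have : ((μ.restrict {x | (k : ℕ∞) < m x}).restrict (A (some j))).map φ = τ j := by
        rw [Measure.restrict_restrict (hA _)]
        congr 1
        refine Measure.restrict_congr_set ?_
        filter_upwards [hm] with x hx
        refine propext ⟨fun h => h.1, fun h => ⟨h, ?_⟩⟩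
        rw [Set.mem_ofPred_eq, hx h.2]
        exact ENat.natCast_lt_top k
      have h2 : ν.restrict (B (k, some j)) = ν.restrict (E j) := hτE j
      rw [h2]
      change Measure.map φ ((μ.restrict {x | (k : ℕ∞) < m x}).restrict (A (some j))) ≪ _ ∧
        _ ≪ Measure.map φ ((μ.restrict {x | (k : ℕ∞) < m x}).restrict (A (some j)))
      rw [this]
      exact absolutelyContinuous_restrict_rnDeriv_ne_zero (hτ j)
  -- Over a point of `N` exactly the sets `φ '' D k` with `k < m x` are met. Over a point outside
  -- `N` some `E j` is met once for each `k`, so the count is infinite, as is `m x`.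
  have hcount : ∀ᵐ x ∂μ, {q | φ x ∈ B q}.encard = m x := by
    have h1 : ∀ j, ∀ᵐ x ∂μ, x ∈ A (some j) → φ x ∈ E j := fun j => by
      rw [← ae_restrict_iff' (hA _)]
      refine ae_of_ae_map hφ.aemeasurable ?_
      exact (absolutelyContinuous_restrict_rnDeriv_ne_zero (hτ j)).1.ae_le (ae_restrict_mem (hE j))
    filter_upwards [hback, hm, ae_all_iff.2 h1, hgood'] with x hx1 hx2 hx3 hx4
    by_cases hxN : x ∈ N
    · have hxi : x ∈ isolatedPart N t := ⟨hxN, hx4⟩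
      have : {q | φ x ∈ B q} = (fun k : ℕ => (k, none)) '' {k : ℕ | (k : ℕ∞) < m x} := by
        ext ⟨k, _ | j⟩
        · have : φ x ∈ φ '' D k ↔ (k : ℕ∞) < m x :=
            ⟨fun h => (hx1 _ Set.inter_subset_left h).2, fun h => ⟨x, ⟨hxi, h⟩, rfl⟩⟩
          simpa [B] using this
        · have : φ x ∈ φ '' isolatedPart N t := ⟨x, hxi, rfl⟩
          simpa [B] using fun _ => this
      rw [this, Function.Injective.encard_image (fun a b h => congrArg Prod.fst h),
        encard_setOf_natCast_lt]
    · rw [hx2 hxN, Set.encard_eq_top_iff]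
      refine Set.infinite_of_injective_forall_mem
        (f := fun k : ℕ => (k, some ⌊t * x / (2 * Real.pi)⌋))
        (fun a b h => congrArg Prod.fst h) fun k => ?_
      exact ⟨hx3 _ ⟨rfl, hxN⟩, fun h => hxN (hx1 _ subset_rfl h).1⟩
  obtain ⟨f'', hf''⟩ := hf'.exists_of_absolutelyContinuous isCharacterSystem_circle
    (isUnitaryRep_zpow (V t)) (τ := fun q => ν.restrict (B q)) (fun q => inferInstance)
    (fun q => (hequiv q).1) (fun q => (hequiv q).2)
  let e : ℕ ≃ ℕ × Option ℤ := (Denumerable.eqv _).symm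
  have hfe : IsCyclicFamily (fun (n : ℤ) (z : Circle) => (z : ℂ) ^ n) (fun n => V t ^ n)
      (fun n => ν.restrict (B (e n))) (f'' ∘ e) :=
    ⟨fun a => hf''.finite (e a), fun a => hf''.inner_self (e a),
      fun a b i hab => hf''.inner_ne _ _ i fun h => hab (e.injective h),
      fun g hg => hf''.total g fun a i => by simpa using hg (e.symm a) i⟩
  let m' : Circle → ℕ∞ := fun y => max 1 {n | y ∈ B (e n)}.encard
  have hm'm : ∀ᵐ x ∂μ, m' (φ x) = m x := by
    filter_upwards [hcount] with x hx
    have : {n | φ x ∈ B (e n)}.encard = m x := by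
      rw [← hx]
      exact Set.encard_preimage_of_bijective e.bijective {q | φ x ∈ B q}
    change max 1 {n | φ x ∈ B (e n)}.encard = m x
    rw [this, max_eq_right (hM.one_le x)]
  have hcov : ∀ᵐ y ∂ν, ∃ n, y ∈ B (e n) := by
    rw [ae_map_iff hφ.aemeasurable]
    · filter_upwards [hcount] with x hx
      have h1 : {q | φ x ∈ B q}.encard ≠ 0 := by
        rw [hx]
        exact (lt_of_lt_of_le one_pos (hM.one_le x)).ne'
      obtain ⟨q, hq⟩ := Set.encard_ne_zero.1 h1
      exact ⟨e.symm q, by simpa using hq⟩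
    · have : {y | ∃ n, y ∈ B (e n)} = ⋃ n, B (e n) := by ext; simp
      rw [this]
      exact MeasurableSet.iUnion fun n => hB (e n)
  have hmodel : IsSpectralModel (fun (n : ℤ) (z : Circle) => (z : ℂ) ^ n) (fun n => V t ^ n) ν m' :=
    hfe.isSpectralModel_sorted isCharacterSystem_circle (isUnitaryRep_zpow (V t))
      (fun n => hB (e n)) hcov
  rw [multiplicitySet_eq, hmodel.essentialMultiplicities_eq isCharacterSystem_circle
    (isUnitaryRep_zpow (V t))]
  ext n
  have hms : MeasurableSet {y | m' y = n} := hmodel.measurable (measurableSet_singleton n)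
  rw [Set.mem_ofPred_eq, Set.mem_ofPred_eq, hν, Measure.map_apply hφ hms]
  have : μ (φ ⁻¹' {y | m' y = n}) = μ {x | m x = n} := by
    refine measure_congr ?_
    filter_upwards [hm'm] with x hx
    exact propext ⟨fun h => hx.symm.trans h, fun h => hx.trans h⟩
  rw [this]

end Folding

/-! ### Flows with singular spectrum -/

namespace UnitaryFlow

variable {H : Type*} [NormedAddCommGroup H] [InnerProductSpace ℂ H] [CompleteSpace H]

theorem span_range_topologicalClosure_eq_top_iff {ι : Type*} (v : ι → H) :
    (Submodule.span ℂ (Set.range v)).topologicalClosure = ⊤ ↔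
      ∀ g, (∀ i, inner ℂ (v i) g = 0) → g = 0 := by
  rw [Submodule.topologicalClosure_eq_top_iff, Submodule.eq_bot_iff]
  refine forall_congr' fun g => imp_congr_left ?_
  rw [Submodule.mem_orthogonal]
  refine ⟨fun h i => h _ (Submodule.subset_span ⟨i, rfl⟩), fun h u hu => ?_⟩
  induction hu using Submodule.span_induction with
  | mem x hx => obtain ⟨i, rfl⟩ := hx; exact h i
  | zero => exact inner_zero_left _
  | add x y _ _ hx hy => rw [inner_add_left, hx, hy, add_zero]
  | smul a x _ hx => rw [inner_smul_left, hx, mul_zero]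

/-- For almost every `t` the isolated part of a null carrier of `σ` has full measure. A single piece
suffices for the folding, so one generator remains one generator. -/
theorem ae_hasSimpleSpectrum (U : UnitaryFlow H) (h1 : U.HasSimpleSpectrum)
    (h2 : U.HasSingularSpectrum) : ∀ᵐ t : ℝ, _root_.HasSimpleSpectrum (U.toFun t) := by
  obtain ⟨h, hh⟩ := h1
  rw [span_range_topologicalClosure_eq_top_iff] at hh
  obtain ⟨σ, ⟨hσ, hσh⟩, s, hs, hs0, hs1⟩ := h2 h
  have hf : IsCyclicFamily (fun (t x : ℝ) => Complex.exp (t * x * Complex.I)) U.toFun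
      (fun _ : Unit => σ) (fun _ => h) :=
    ⟨fun _ => hσ, fun _ => hσh, fun a b _ hab => (hab rfl).elim, fun g hg => hh g (hg ())⟩
  filter_upwards [ae_forall_sub_notMem hs.compl hs1 σ, Measure.ae_ne volume 0] with t hgood ht
  have hgood' : ∀ᵐ x ∂σ, x ∈ isolatedPart sᶜ t := by
    have : ∀ᵐ x ∂σ, ∀ k : ℤ, k ≠ 0 → x - 2 * Real.pi * k / t ∉ sᶜ := by
      rw [ae_all_iff]
      intro k
      by_cases hk : k = 0
      · exact Eventually.of_forall fun _ h => (h hk).elim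
      · exact (hgood k hk).mono fun x hx _ => hx
    filter_upwards [this, measure_eq_zero_iff_ae_notMem.1 hs0] with x hx hxs
    exact ⟨hxs, hx⟩
  have hφ : Continuous fun x : ℝ => Circle.exp (t * x) := by fun_prop
  obtain ⟨f', hf'⟩ := hf.exists_of_injOn isCharacterSystem_real isCharacterSystem_circle
    U.isUnitaryRep (V' := fun n : ℤ => U.toFun t ^ n) (j := fun n : ℤ => n • t)
    (fun n => neg_zsmul _ _) (fun n h => U.isUnitaryRep.zpow_apply t n h) hφ.measurable
    (fun n x => circle_exp_zpow t x n) (A := fun _ : Unit => isolatedPart sᶜ t)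
    (fun _ => measurableSet_isolatedPart hs.compl t) (fun a b hab => (hab rfl).elim)
    (fun _ => injOn_isolatedPart ht) (fun _ => hgood'.mono fun x hx => ⟨(), hx⟩)
  refine ⟨f' ((), ()), ?_⟩
  rw [span_range_topologicalClosure_eq_top_iff]
  exact fun g hg => hf'.total g fun _ i => hg i

/-- The generator `e 0` of a model has spectral measure `μ` itself, so `μ` is singular; with `N` a
null carrier of `μ`, the condition on points outside `N` is void. -/
theorem ae_multiplicitySet_eq_of_hasSingularSpectrum [TopologicalSpace.SeparableSpace H]
    (U : UnitaryFlow H) (hU : U.HasSingularSpectrum) :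
    ∀ᵐ t : ℝ, _root_.multiplicitySet (U.toFun t) = U.multiplicitySet := by
  obtain ⟨μ, m, hM⟩ := exists_isSpectralModel isCharacterSystem_real U.isUnitaryRep fun h =>
    (hU h).imp fun σ hσ => hσ.1
  have hfin := hM.finite
  obtain ⟨e, he⟩ := hM.exists_isCyclicFamily isCharacterSystem_real U.isUnitaryRep
  obtain ⟨σ, ⟨hσ, hσh⟩, s, hs, hs0, hs1⟩ := hU (e 0)
  have hσμ : σ = μ := isCharacterSystem_real.ext σ μ hσ hfin fun i => by
    rw [← hσh, he.inner_self, hM.restrict_zero_lt]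
  rw [hσμ] at hs0
  rw [UnitaryFlow.multiplicitySet,
    hM.essentialMultiplicities_eq isCharacterSystem_real U.isUnitaryRep]
  refine ae_multiplicitySet_eq U.isUnitaryRep hM hs.compl hs1 ?_
  filter_upwards [measure_eq_zero_iff_ae_notMem.1 hs0] with x hx hx'
  exact (hx' hx).elim

end UnitaryFlow

/-! ### Strong continuity of the Koopman flow -/

section KoopmanFlow

variable {Ω : Type*} [MeasurableSpace Ω] {P : Measure Ω}

theorem MeasurePreservingFlow.tendsto_koopman [IsFiniteMeasure P] (G : MeasurePreservingFlow P)
    (f : Lp ℂ 2 P) : Tendsto (fun t => G.koopman t f) (𝓝 0) (𝓝 f) := by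
  refine Lp.induction (by simp) (motive := fun f => Tendsto (fun t => G.koopman t f) (𝓝 0) (𝓝 f))
    (fun c s hs hμs => ?_) (fun f g hf hg _ h1 h2 => ?_) ?_ f
  · rw [Lp.simpleFunc.coe_indicatorConst]
    have : ∀ t, G.koopman t (indicatorConstLp 2 hs hμs.ne c)
        = indicatorConstLp 2 ((G.measurePreserving t).measurable hs)
          (measure_ne_top P _) c := fun t =>
      Lp.indicatorConstLp_compMeasurePreserving hs hμs.ne c (G.measurePreserving t)
    simp_rw [this]
    exact tendsto_indicatorConstLp_set (by simp) (G.continuous s hs)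
  · simp_rw [_root_.map_add]
    exact h1.add h2
  · rw [isClosed_iff_clusterPt]
    intro f hf
    rw [← mem_closure_iff_clusterPt] at hf
    rw [Set.mem_ofPred_eq, Metric.tendsto_nhds]
    intro ε hε
    obtain ⟨g, hg, hfg⟩ := Metric.mem_closure_iff.1 hf (ε / 3) (by positivity)
    filter_upwards [Metric.tendsto_nhds.1 hg (ε / 3) (by positivity)] with t ht
    calc dist (G.koopman t f) f
        ≤ dist (G.koopman t f) (G.koopman t g) + dist (G.koopman t g) g + dist g f :=
          dist_triangle4 _ _ _ _
      _ < ε / 3 + ε / 3 + ε / 3 := by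
          rw [LinearIsometry.dist_map, dist_comm g f]
          gcongr
      _ = ε := by ring

/-- The unitary flow on `L²₀` induced by a flow of automorphisms. -/
noncomputable def MeasurePreservingFlow.koopmanFlow [IsFiniteMeasure P] (G : MeasurePreservingFlow P) :
    UnitaryFlow (L2Zero P) where
  toFun := G.koopmanZero
  map_zero h := Subtype.ext (G.koopman_zero h)
  map_add s t h := Subtype.ext (by
    change G.koopman (s + t) h = G.koopman s (G.koopman t h)
    rw [koopman_add, add_comm])
  continuous h := by
    rw [continuous_iff_continuousAt]
    intro t
    rw [ContinuousAt, tendsto_subtype_rng]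
    have h1 : ∀ s, (G.koopmanZero s h : Lp ℂ 2 P) = G.koopman (s - t) (G.koopman t h) := fun s => by
      rw [koopman_add, add_sub_cancel]; rfl
    simp_rw [h1, sub_self]
    have h2 := (G.tendsto_koopman (G.koopman t h)).comp
      (tendsto_sub_nhds_zero_iff.2 (tendsto_id (x := 𝓝 t)))
    rwa [koopman_zero]

end KoopmanFlow

/-! ### Wick exponentials of Gaussian variables -/

section WickExponential

variable {Ω : Type*} [MeasurableSpace Ω] {P : Measure Ω} [IsProbabilityMeasure P]

omit [IsProbabilityMeasure P] in
theorem integral_sq_Lp_real (f : Lp ℝ 2 P) : ∫ ω, f ω ^ 2 ∂P = ‖f‖ ^ 2 := by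
  rw [← real_inner_self_eq_norm_sq, L2.inner_def]
  congr 1 with ω
  simp [sq]

omit [IsProbabilityMeasure P] in
theorem integral_eq_zero_of_gaussian {f : Lp ℝ 2 P} {v : NNReal}
    (hf : P.map f = gaussianReal 0 v) : ∫ ω, f ω ∂P = 0 := by
  have hm := (Lp.stronglyMeasurable f).measurable.aemeasurable (μ := P)
  have := integral_map hm (f := fun x : ℝ => x) (by fun_prop)
  rw [← this, hf, integral_id_gaussianReal]

omit [IsProbabilityMeasure P] in
theorem integral_exp_mul_I_of_gaussian {f : Lp ℝ 2 P} {v : NNReal}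
    (hf : P.map f = gaussianReal 0 v) :
    ∫ ω, Complex.exp (f ω * Complex.I) ∂P = Complex.exp (-(‖f‖ ^ 2 / 2 : ℝ)) := by
  have hm := (Lp.stronglyMeasurable f).measurable.aemeasurable (μ := P)
  have hv : (v : ℝ) = ‖f‖ ^ 2 := by
    rw [← integral_sq_Lp_real, ← integral_map hm (f := fun x : ℝ => x ^ 2) (by fun_prop), hf,
      ← variance_id_gaussianReal (μ := 0) (v := v),
      variance_of_integral_eq_zero (X := id) (by fun_prop) integral_id_gaussianReal]
    rfl
  rw [← integral_map hm (f := fun x : ℝ => Complex.exp (x * Complex.I)) (by fun_prop), hf]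
  have := charFun_gaussianReal (μ := 0) (v := v) 1
  rw [charFun_apply_real] at this
  simp only [Complex.ofReal_one, one_mul] at this
  rw [this, ← hv]
  congr 1
  push_cast
  ring

omit [IsProbabilityMeasure P] in
theorem norm_exp_Lp_mul_I (f : Lp ℝ 2 P) (ω : Ω) : ‖Complex.exp (f ω * Complex.I)‖ = 1 :=
  Complex.norm_exp_ofReal_mul_I _

theorem memLp_exp_mul_I (f : Lp ℝ 2 P) (p : ℝ≥0∞) :
    MemLp (fun ω => Complex.exp (f ω * Complex.I)) p P := by
  have hm := (Lp.stronglyMeasurable f).measurable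
  exact MemLp.of_bound (by fun_prop) 1 (Eventually.of_forall fun ω => (norm_exp_Lp_mul_I f ω).le)

theorem memLp_wickExp (f : Lp ℝ 2 P) :
    MemLp (fun ω => Complex.exp (‖f‖ ^ 2 / 2 : ℝ) * Complex.exp (f ω * Complex.I) - 1) 2 P :=
  ((memLp_exp_mul_I f 2).const_mul _).sub (memLp_const 1)

/-- The Wick exponential of a Gaussian variable, without its constant term. -/
noncomputable def wickExp (f : Lp ℝ 2 P) : Lp ℂ 2 P := (memLp_wickExp f).toLp _

theorem wickExp_ae (f : Lp ℝ 2 P) : wickExp f =ᵐ[P] fun ω =>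
    Complex.exp (‖f‖ ^ 2 / 2 : ℝ) * Complex.exp (f ω * Complex.I) - 1 :=
  (memLp_wickExp f).coeFn_toLp

theorem inner_wickExp_left (f : Lp ℝ 2 P) (g : Lp ℂ 2 P) : inner ℂ (wickExp f) g =
    Complex.exp (‖f‖ ^ 2 / 2 : ℝ) * ∫ ω, Complex.exp ((-f : Lp ℝ 2 P) ω * Complex.I) * g ω ∂P
      - ∫ ω, g ω ∂P := by
  have hg : Integrable g P := integrable_of_Lp_two g
  have h1 : Integrable (fun ω => Complex.exp ((-f : Lp ℝ 2 P) ω * Complex.I) * g ω) P :=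
    hg.bdd_mul (c := 1) (memLp_exp_mul_I (-f) 2).1
      (Eventually.of_forall fun ω => (norm_exp_Lp_mul_I (-f) ω).le)
  rw [L2.inner_def, ← integral_const_mul, ← integral_sub (h1.const_mul _) hg]
  refine integral_congr_ae ?_
  filter_upwards [wickExp_ae f, Lp.coeFn_neg f] with ω h2 h3
  rw [h2, h3, RCLike.inner_apply, Pi.neg_apply, map_sub, map_mul, ← Complex.exp_conj,
    ← Complex.exp_conj, map_mul, Complex.conj_ofReal, Complex.conj_ofReal, Complex.conj_I, map_one]
  push_cast
  rw [neg_mul, mul_neg]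
  ring

theorem mem_L2Zero_iff (g : Lp ℂ 2 P) : g ∈ L2Zero P ↔ ∫ ω, g ω ∂P = 0 := by
  rw [Submodule.mem_orthogonal_singleton_iff_inner_right, L2.inner_def]
  have : ∫ ω, inner ℂ ((Lp.const 2 P (1 : ℂ) : Lp ℂ 2 P) ω) (g ω) ∂P = ∫ ω, g ω ∂P := by
    refine integral_congr_ae ?_
    filter_upwards [Lp.coeFn_const 2 P (1 : ℂ)] with ω h
    rw [h]
    simp
  rw [this]

theorem integral_exp_mul_wickExp {f g : Lp ℝ 2 P} {v w : NNReal}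
    (hf : P.map f = gaussianReal 0 v) (hfg : P.map (f + g : Lp ℝ 2 P) = gaussianReal 0 w) :
    ∫ ω, Complex.exp (f ω * Complex.I) * wickExp g ω ∂P =
      Complex.exp (‖g‖ ^ 2 / 2 - ‖f + g‖ ^ 2 / 2 : ℝ) - Complex.exp (-(‖f‖ ^ 2 / 2 : ℝ)) := by
  rw [← integral_exp_mul_I_of_gaussian hf, Complex.ofReal_sub, sub_eq_add_neg (((_ : ℝ) : ℂ)),
    Complex.exp_add, ← integral_exp_mul_I_of_gaussian hfg, ← integral_const_mul, ← integral_sub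
      (((memLp_exp_mul_I (f + g) 1).integrable le_rfl).const_mul _)
      ((memLp_exp_mul_I f 1).integrable le_rfl)]
  refine integral_congr_ae ?_
  filter_upwards [wickExp_ae g, Lp.coeFn_add f g] with ω h1 h2
  rw [h1, h2, Pi.add_apply, Complex.ofReal_add, add_mul, Complex.exp_add]
  ring

theorem integral_wickExp {f : Lp ℝ 2 P} {v : NNReal} (hf : P.map f = gaussianReal 0 v) :
    ∫ ω, wickExp f ω ∂P = 0 := by
  rw [integral_congr_ae (wickExp_ae f), integral_sub
    (((memLp_exp_mul_I f 1).integrable le_rfl).const_mul _) (integrable_const _),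
    integral_const_mul, integral_exp_mul_I_of_gaussian hf, ← Complex.exp_add]
  simp

variable {V : Submodule ℝ (Lp ℝ 2 P)}

/-- The Gaussian characteristic function is evaluated at `g - f`, and the polarization of `‖g - f‖²`
leaves only the cross term. These are the exponential vectors of Fock space without their vacuum
component. Expanding the exponential produces convolution powers, so no chaos decomposition is
needed. -/
theorem inner_wickExp_wickExp (hV : ∀ f ∈ V, ∃ v : NNReal, P.map (f : Ω → ℝ) = gaussianReal 0 v)
    {f g : Lp ℝ 2 P} (hf : f ∈ V) (hg : g ∈ V) :
    inner ℂ (wickExp f) (wickExp g) = Complex.exp (inner ℝ f g : ℝ) - 1 := by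
  obtain ⟨v, hv⟩ := hV g hg
  obtain ⟨v1, hv1⟩ := hV _ (V.neg_mem hf)
  obtain ⟨v2, hv2⟩ := hV _ (V.add_mem (V.neg_mem hf) hg)
  rw [inner_wickExp_left, integral_wickExp hv, sub_zero, integral_exp_mul_wickExp hv1 hv2, mul_sub,
    ← Complex.exp_add, ← Complex.exp_add, norm_neg, add_neg_cancel, Complex.exp_zero]
  congr 2
  have : ‖-f + g‖ ^ 2 = ‖f‖ ^ 2 - 2 * inner ℝ f g + ‖g‖ ^ 2 := by
    rw [norm_add_sq_real, norm_neg, inner_neg_left]; ring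
  rw [this]
  push_cast
  ring

end WickExponential

/-! ### Totality of the Wick exponentials -/

section Totality

/-- A finite measure on the product, whose index set may be uncountable, is determined by its
finite-dimensional marginals, and these by their characteristic functions. -/
theorem isCharacterSystem_pi (κ : Type*) :
    IsCharacterSystem (fun (ξ : κ →₀ ℝ) (x : κ → ℝ) =>
      Complex.exp ((Finsupp.linearCombination ℝ x ξ : ℝ) * Complex.I)) where
  measurable ξ := by
    have : Measurable fun x : κ → ℝ => Finsupp.linearCombination ℝ x ξ := by
      simp_rw [Finsupp.linearCombination_apply, Finsupp.sum]
      fun_prop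
    fun_prop
  norm_eq ξ x := Complex.norm_exp_ofReal_mul_I _
  map_zero x := by simp
  map_add ξ ζ x := by rw [_root_.map_add, Complex.ofReal_add, add_mul, Complex.exp_add]
  ext μ ν hμ hν h := by
    refine IsProjectiveLimit.unique (P := fun J : Finset κ => ν.map J.restrict) (fun J => ?_)
      (fun J => rfl)
    have hJ : Measurable (J.restrict (π := fun _ : κ => ℝ)) := by fun_prop
    refine Measure.ext_of_charFunDual (funext fun L => ?_)
    rw [charFunDual_apply, charFunDual_apply, integral_map hJ.aemeasurable (by fun_prop),
      integral_map hJ.aemeasurable (by fun_prop)]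
    classical
    have hL : ∀ x : κ → ℝ, L (J.restrict x)
        = Finsupp.linearCombination ℝ x (∑ j : J, Finsupp.single (j : κ) (L (Pi.single j 1))) := by
      intro x
      rw [_root_.map_sum]
      conv_lhs => rw [← Finset.univ_sum_single (J.restrict x), _root_.map_sum]
      refine Finset.sum_congr rfl fun j _ => ?_
      rw [Finsupp.linearCombination_single, smul_eq_mul, mul_comm, ← smul_eq_mul, ← L.map_smul,
        ← Pi.single_smul', smul_eq_mul, mul_one]
      rfl
    simp_rw [hL]
    exact h _

variable {Ω : Type*} [mΩ : MeasurableSpace Ω] {P : Measure Ω} [IsProbabilityMeasure P]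

/-- If every event agrees modulo null sets with an event generated by `Φ`, then every integrable
function agrees almost everywhere with a function of `Φ`. -/
theorem exists_measurable_ae_eq_comp {X : Type*} [mX : MeasurableSpace X] {Φ : Ω → X}
    (hΦ : Measurable Φ)
    (hgen : ∀ A, MeasurableSet A → ∃ B, MeasurableSet[mX.comap Φ] B ∧ A =ᵐ[P] B)
    {g : Ω → ℂ} (hg : Integrable g P) : ∃ u : X → ℂ, Measurable u ∧ g =ᵐ[P] u ∘ Φ := by
  have h1 : g =ᵐ[P] P[g | mX.comap Φ] := by
    refine hg.ae_eq_of_forall_setIntegral_eq _ _ integrable_condExp fun A hA _ => ?_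
    obtain ⟨B, hB, hAB⟩ := hgen A hA
    rw [setIntegral_congr_set hAB, setIntegral_congr_set hAB,
      setIntegral_condExp hΦ.comap_le hg hB]
  have h2 : Measurable[mX.comap Φ] (P[g | mX.comap Φ]) := stronglyMeasurable_condExp.measurable
  obtain ⟨u, hu, hu'⟩ := h2.exists_eq_measurable_comp
  exact ⟨u, hu, hu' ▸ h1⟩

/-- All variables of `V` together form a map `Φ` to `V → ℝ`, of which `g` is a function. A finite
linear combination of coordinates is almost everywhere again an element of `V`, so `h` covers all
characters of the product. -/
theorem ae_eq_zero_of_forall_integral_exp {V : Submodule ℝ (Lp ℝ 2 P)}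
    (hgen : ∀ A, MeasurableSet A → ∃ B,
      MeasurableSet[⨆ f ∈ V, MeasurableSpace.comap (f : Ω → ℝ) inferInstance] B ∧ A =ᵐ[P] B)
    {g : Ω → ℂ} (hg : Integrable g P)
    (h : ∀ f ∈ V, ∫ ω, Complex.exp ((f : Lp ℝ 2 P) ω * Complex.I) * g ω ∂P = 0) : g =ᵐ[P] 0 := by
  let Φ : Ω → V → ℝ := fun ω f => (f : Lp ℝ 2 P) ω
  have hΦ : Measurable Φ := measurable_pi_lambda _ fun f => (Lp.stronglyMeasurable _).measurable
  have hcomap : (⨆ f ∈ V, MeasurableSpace.comap (f : Ω → ℝ) inferInstance)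
      = MeasurableSpace.comap Φ inferInstance := by
    change _ = MeasurableSpace.comap Φ (⨆ a, _)
    rw [MeasurableSpace.comap_iSup, iSup_subtype']
    simp_rw [MeasurableSpace.comap_comp]
    rfl
  rw [hcomap] at hgen
  obtain ⟨u, hu, h1⟩ := exists_measurable_ae_eq_comp hΦ hgen hg
  have huint : Integrable u (P.map Φ) := by
    rw [integrable_map_measure hu.aestronglyMeasurable hΦ.aemeasurable]
    exact hg.congr h1
  have h3 : u =ᵐ[P.map Φ] 0 := by
    refine (isCharacterSystem_pi V).ae_eq_zero huint fun ξ => ?_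
    rw [integral_map (f := fun x => Complex.exp ((Finsupp.linearCombination ℝ x ξ : ℝ) * Complex.I)
      * u x) hΦ.aemeasurable (((isCharacterSystem_pi V).measurable ξ).aestronglyMeasurable.mul
        huint.aestronglyMeasurable),
      ← h _ (ξ.sum fun f c => c • f : V).2]
    refine integral_congr_ae ?_
    have h4 : ∀ᵐ ω ∂P, Finsupp.linearCombination ℝ (Φ ω) ξ
        = ((ξ.sum fun f c => c • f : V) : Lp ℝ 2 P) ω := by
      induction ξ using Finsupp.induction_linear with
      | zero =>
        filter_upwards [Lp.coeFn_zero ℝ 2 P] with ω h5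
        rw [_root_.map_zero, Finsupp.sum_zero_index, Submodule.coe_zero, h5, Pi.zero_apply]
      | add ξ ζ h5 h6 =>
        have : ((ξ + ζ).sum fun f c => c • f : V)
            = (ξ.sum fun f c => c • f) + ζ.sum fun f c => c • f :=
          Finsupp.sum_add_index' (by simp) (fun _ _ _ => add_smul _ _ _)
        rw [this]
        filter_upwards [h5, h6, Lp.coeFn_add ((ξ.sum fun f c => c • f : V) : Lp ℝ 2 P)
          ((ζ.sum fun f c => c • f : V) : Lp ℝ 2 P)] with ω h7 h8 h9
        rw [_root_.map_add, h7, h8, Submodule.coe_add, h9, Pi.add_apply]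
      | single f c =>
        rw [Finsupp.sum_single_index (by simp)]
        filter_upwards [Lp.coeFn_smul c (f : Lp ℝ 2 P)] with ω h5
        rw [Finsupp.linearCombination_single, Submodule.coe_smul, h5]
        rfl
    filter_upwards [h1, h4] with ω h5 h6
    rw [h5, h6, Function.comp_apply]
  filter_upwards [h1, ae_of_ae_map hΦ.aemeasurable h3] with ω h5 h6
  rw [h5]
  exact h6

theorem eq_zero_of_forall_inner_wickExp {V : Submodule ℝ (Lp ℝ 2 P)}
    (hgen : ∀ A, MeasurableSet A → ∃ B,
      MeasurableSet[⨆ f ∈ V, MeasurableSpace.comap (f : Ω → ℝ) inferInstance] B ∧ A =ᵐ[P] B)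
    {g : Lp ℂ 2 P} (hg : g ∈ L2Zero P) (h : ∀ f ∈ V, inner ℂ (wickExp f) g = 0) : g = 0 := by
  rw [Lp.eq_zero_iff_ae_eq_zero]
  rw [mem_L2Zero_iff] at hg
  refine ae_eq_zero_of_forall_integral_exp hgen (integrable_of_Lp_two g) fun f hf => ?_
  have := h (-f) (V.neg_mem hf)
  rw [inner_wickExp_left, hg, sub_zero, neg_neg] at this
  exact (mul_eq_zero.1 this).resolve_left (Complex.exp_ne_zero _)

end Totality

/-! ### Convolution powers that are not singular -/

section ConvolutionPowers

open scoped Pointwise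

/-- If `α`, `β` dominate Lebesgue measure on `A`, `B`, then `α ∗ β` dominates Lebesgue measure on
the set of points at which the convolution of the indicators of `A` and `B` does not vanish. -/
theorem restrict_volume_absolutelyContinuous_conv {α β : Measure ℝ} [SFinite α] [SFinite β]
    {A B D : Set ℝ} (hA : MeasurableSet A) (hB : MeasurableSet B)
    (hα : volume.restrict A ≪ α) (hβ : volume.restrict B ≪ β)
    (hAB : ∀ z ∈ D, volume {x | x ∈ A ∧ z - x ∈ B} ≠ 0) :
    volume.restrict D ≪ α.conv β := by
  refine Measure.AbsolutelyContinuous.mk fun S hS h0 => ?_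
  have hS' : MeasurableSet ((fun x : ℝ × ℝ => x.1 + x.2) ⁻¹' S) :=
    (measurable_fst.add measurable_snd) hS
  rw [Measure.conv, Measure.map_apply (by fun_prop) hS, Measure.measure_prod_null hS'] at h0
  have h1 : ∀ᵐ x, x ∈ A → ∀ᵐ y, y ∈ B → x + y ∉ S := by
    rw [← ae_restrict_iff' hA]
    filter_upwards [hα.ae_le h0] with x hx
    rw [← ae_restrict_iff' hB]
    exact measure_eq_zero_iff_ae_notMem.1 (hβ hx)
  -- The substitution `y = z - x` permits exchanging the quantifiers by Fubini: almost every `z ∈ S`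
  -- has only a null set of decompositions, contrary to `hAB` when `z ∈ D`.
  have h2 : ∀ᵐ x, ∀ᵐ z, x ∈ A → z - x ∈ B → z ∉ S := by
    filter_upwards [h1] with x hx
    by_cases hxA : x ∈ A
    · have h3 := (measurePreserving_sub_right volume x).quasiMeasurePreserving.ae (hx hxA)
      filter_upwards [h3] with z hz _ hzB
      simpa using hz hzB
    · exact Eventually.of_forall fun _ h => (hxA h).elim
  rw [Measure.ae_ae_comm (p := fun x z => x ∈ A → z - x ∈ B → z ∉ S)] at h2
  · rw [Measure.restrict_apply hS, measure_eq_zero_iff_ae_notMem]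
    filter_upwards [h2] with z hz hzS
    refine hAB z hzS.2 ?_
    rw [measure_eq_zero_iff_ae_notMem]
    filter_upwards [hz] with x hx hx'
    exact hx hx'.1 hx'.2 hzS.1
  · have : {q : ℝ × ℝ | q.1 ∈ A → q.2 - q.1 ∈ B → q.2 ∉ S}
        = ({q | q.1 ∈ A} ∩ {q | q.2 - q.1 ∈ B} ∩ {q | q.2 ∈ S})ᶜ := by
      ext q; simp only [Set.mem_ofPred_eq, Set.mem_compl_iff, Set.mem_inter_iff]; tauto
    rw [this]
    exact (((measurable_fst hA).inter ((measurable_snd.sub measurable_fst) hB)).inter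
      (measurable_snd hS)).compl

/-- Convolution powers of a measure. -/
noncomputable def convPow (σ : Measure ℝ) : ℕ → Measure ℝ
  | 0 => Measure.dirac 0
  | n + 1 => (convPow σ n).conv σ

variable (σ : Measure ℝ) [IsFiniteMeasure σ]

instance isFiniteMeasure_convPow (n : ℕ) : IsFiniteMeasure (convPow σ n) := by
  induction n with
  | zero => rw [convPow]; infer_instance
  | succ n ih => rw [convPow]; infer_instance

theorem charFun_convPow (n : ℕ) (t : ℝ) : charFun (convPow σ n) t = charFun σ t ^ n := by
  induction n with
  | zero => rw [convPow, charFun_dirac]; simp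
  | succ n ih => rw [convPow, charFun_conv, ih, pow_succ]

theorem convPow_add (m n : ℕ) : convPow σ (m + n) = (convPow σ m).conv (convPow σ n) :=
  Measure.ext_of_charFun (funext fun t => by
    rw [charFun_conv, charFun_convPow, charFun_convPow, charFun_convPow, pow_add])

variable {σ}

theorem map_neg_eq_of_conj_charFun (h : ∀ t, starRingEnd ℂ (charFun σ t) = charFun σ t) :
    σ.map (fun x => -x) = σ := by
  refine Measure.ext_of_charFun (funext fun t => ?_)
  have := charFun_map_mul (μ := σ) (-1) t
  simp only [neg_mul, one_mul] at this
  rw [this, charFun_neg, h]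

/-- The self-convolution of a symmetric measure which is not singular dominates Lebesgue measure
near the origin. -/
theorem exists_restrict_Ioo_absolutelyContinuous_conv_self
    (hsymm : σ.map (fun x => -x) = σ) (hσ : ¬ σ ⟂ₘ volume) :
    ∃ δ > 0, volume.restrict (Set.Ioo (-δ) δ) ≪ σ.conv σ := by
  have hrn := Measure.measurable_rnDeriv σ volume
  set E := {x | σ.rnDeriv volume x ≠ 0} with hE
  have hEm : MeasurableSet E := hrn (measurableSet_singleton 0).compl
  have hEσ : volume.restrict E ≪ σ := by
    refine Measure.AbsolutelyContinuous.trans ?_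
      (Measure.withDensity_rnDeriv_le σ volume).absolutelyContinuous
    refine Measure.AbsolutelyContinuous.mk fun S hS h0 => ?_
    rw [withDensity_apply_eq_zero hrn] at h0
    rwa [Measure.restrict_apply hS, Set.inter_comm]
  have hE0 : volume E ≠ 0 := by
    intro h0
    apply hσ
    rw [← Measure.rnDeriv_eq_zero]
    filter_upwards [measure_eq_zero_iff_ae_notMem.1 h0] with x hx
    simpa [hE] using hx
  obtain ⟨K, hKE, hK, hK0⟩ := hEm.exists_lt_isCompact (pos_iff_ne_zero.2 hE0)
  have hneg : volume.restrict (Neg.neg ⁻¹' K) ≪ σ := by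
    have h1 : volume.restrict K ≪ σ :=
      (Measure.restrict_mono_set volume hKE).absolutelyContinuous.trans hEσ
    have h2 := h1.map (f := fun x : ℝ => -x) (by fun_prop)
    rw [hsymm] at h2
    have h3 := Measure.restrict_map (μ := (volume : Measure ℝ)) (f := fun x : ℝ => -x) (by fun_prop)
      (hK.measurableSet.preimage (measurable_neg (G := ℝ)))
    rw [(Measure.measurePreserving_neg (volume : Measure ℝ)).map_eq] at h3
    have h4 : (fun x : ℝ => -x) ⁻¹' (Neg.neg ⁻¹' K) = K := by ext; simp
    rw [h4] at h3
    rwa [h3]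
  -- Steinhaus: for small `z` the set `(z + K) \ K` has measure less than that of `K`, so `K` meets
  -- `z + K` in positive measure. By symmetry `-K` is dominated as well, and these intersections
  -- provide the decompositions of `z`.
  have hsub := eventually_nhds_zero_measure_vadd_sdiff_lt (μ := (volume : Measure ℝ)) hK hK.isClosed
    (hK0.ne')
  obtain ⟨δ, hδ, hδK⟩ := Metric.eventually_nhds_iff.1 hsub
  refine ⟨δ, hδ, restrict_volume_absolutelyContinuous_conv hK.measurableSet
    (hK.measurableSet.preimage measurable_neg)
    ((Measure.restrict_mono_set volume hKE).absolutelyContinuous.trans hEσ) hneg fun z hz h0 => ?_⟩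
  have h1 := hδK (y := z) (by rw [dist_zero_right, Real.norm_eq_abs, abs_lt]; exact hz)
  have h2 : volume (z +ᵥ K) = volume K := measure_vadd _ _ _
  have h3 : (z +ᵥ K) ⊆ ((z +ᵥ K) \ K) ∪ {x | x ∈ K ∧ z - x ∈ Neg.neg ⁻¹' K} := by
    rintro _ ⟨x, hx, rfl⟩
    by_cases hK' : z + x ∈ K
    · right; refine ⟨hK', ?_⟩; simpa using hx
    · left; exact ⟨⟨x, hx, rfl⟩, hK'⟩
  have h4 := (measure_mono h3).trans (measure_union_le (μ := volume) _ _)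
  rw [h0, h2, add_zero] at h4
  exact absurd h4 (not_le.2 h1)

/-- At each step the half-length grows by `δ`: a point of the longer interval splits into a point of
the old one and a point of `(-δ, δ)` along a nondegenerate interval of choices. -/
theorem restrict_Ioo_absolutelyContinuous_convPow {L : ℕ} {δ : ℝ} (hδ : 0 < δ)
    (h : volume.restrict (Set.Ioo (-δ) δ) ≪ convPow σ L) (j : ℕ) :
    volume.restrict (Set.Ioo (-((j + 1) * δ)) ((j + 1) * δ)) ≪ convPow σ (L * (j + 1)) := by
  induction j with
  | zero => simpa using h
  | succ j ih =>
    rw [mul_add, convPow_add, mul_one]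
    push_cast
    refine restrict_volume_absolutelyContinuous_conv measurableSet_Ioo measurableSet_Ioo
      ih h fun z hz => ?_
    have h1 : {x | x ∈ Set.Ioo (-((j + 1) * δ)) ((j + 1) * δ) ∧ z - x ∈ Set.Ioo (-δ) δ}
        = Set.Ioo (max (-((j + 1) * δ)) (z - δ)) (min ((j + 1) * δ) (z + δ)) := by
      ext x
      simp only [Set.mem_ofPred_eq, Set.mem_Ioo, max_lt_iff, lt_min_iff]
      constructor
      · rintro ⟨⟨h1, h2⟩, h3, h4⟩; refine ⟨⟨h1, ?_⟩, h2, ?_⟩ <;> linarith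
      · rintro ⟨⟨h1, h2⟩, h3, h4⟩; refine ⟨⟨h1, h3⟩, ?_, ?_⟩ <;> linarith
    rw [h1, Real.volume_Ioo, ne_eq, ENNReal.ofReal_eq_zero, not_le, sub_pos, max_lt_iff, lt_min_iff,
      lt_min_iff]
    have : (0 : ℝ) ≤ j * δ := by positivity
    have hz1 := hz.1
    have hz2 := hz.2
    refine ⟨⟨?_, ?_⟩, ?_, ?_⟩ <;> linarith

theorem exists_restrict_Ioo_absolutelyContinuous_convPow
    (hreal : ∀ t, starRingEnd ℂ (charFun σ t) = charFun σ t) {k : ℕ} (hk : k ≠ 0)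
    (hσ : ¬ convPow σ k ⟂ₘ volume) : ∃ L ≠ 0, ∃ δ > (0 : ℝ), ∀ j : ℕ,
      volume.restrict (Set.Ioo (-((j + 1) * δ)) ((j + 1) * δ)) ≪ convPow σ (L * (j + 1)) := by
  obtain ⟨δ, hδ, h⟩ := exists_restrict_Ioo_absolutelyContinuous_conv_self
    (map_neg_eq_of_conj_charFun fun t => by rw [charFun_convPow, map_pow, hreal]) hσ
  rw [← convPow_add] at h
  exact ⟨k + k, by omega, δ, hδ, restrict_Ioo_absolutelyContinuous_convPow hδ h⟩

end ConvolutionPowers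

/-! ### Spectral measures and multiplicity of Wick exponentials -/

section FockSpectrum

/-- The density of `τ` with respect to `μ` is `∑ |F k|²`. Singularity on `A` makes it vanish there,
and with it each coordinate. -/
theorem IsSpectralModel.ae_eq_zero_of_mutuallySingular {ι X H : Type*} [AddCommGroup ι]
    [MeasurableSpace X] [NormedAddCommGroup H] [InnerProductSpace ℂ H] {χ : ι → X → ℂ}
    (hχ : IsCharacterSystem χ) {V : ι → H ≃ₗᵢ[ℂ] H} {μ : Measure X} [IsFiniteMeasure μ]
    {F : ℕ → X → ℂ} {g : H}
    (hs : ∀ᵐ x ∂μ, Summable fun k => starRingEnd ℂ (F k x) * F k x)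
    (hi : Integrable (fun x => ∑' k, starRingEnd ℂ (F k x) * F k x) μ)
    (hF : ∀ i, inner ℂ g (V i g) = ∫ x, χ i x * ∑' k, starRingEnd ℂ (F k x) * F k x ∂μ)
    {τ : Measure X} [IsFiniteMeasure τ] (hτ : ∀ i, inner ℂ g (V i g) = ∫ x, χ i x ∂τ)
    {A : Set X} (hτA : τ ⟂ₘ μ.restrict A) :
    ∀ᵐ x ∂μ.restrict A, F 0 x = 0 := by
  have h1 := (hχ.absolutelyContinuous_and_ae_eq hi fun i => by rw [← hτ, hF]).2
  obtain ⟨S, hS, hS0, hS1⟩ := hτA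
  have h2 : ∀ᵐ x ∂μ, x ∈ S → τ.rnDeriv μ x = 0 := by
    rw [← ae_restrict_iff' hS]
    have h3 : ∫⁻ x in S, τ.rnDeriv μ x ∂μ = 0 :=
      le_antisymm ((Measure.setLIntegral_rnDeriv_le S).trans hS0.le) bot_le
    exact (lintegral_eq_zero_iff (Measure.measurable_rnDeriv τ μ)).1 h3
  filter_upwards [ae_restrict_of_ae h1, ae_restrict_of_ae h2, ae_restrict_of_ae hs,
    measure_eq_zero_iff_ae_notMem.1 hS1] with x h3 h4 h5 h6
  rw [h4 (not_not.1 h6)] at h3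
  have h7 : ∀ k, starRingEnd ℂ (F k x) * F k x = ((‖F k x‖ ^ 2 : ℝ) : ℂ) := fun k => by
    rw [Complex.conj_mul']; push_cast; rfl
  simp only [h7] at h3 h5
  have h8 := h5.hasSum
  rw [h3] at h8
  have h9 : HasSum (fun k => ‖F k x‖ ^ 2) 0 := by
    rw [← Complex.hasSum_ofReal]
    simpa using h8
  rw [hasSum_zero_iff_of_nonneg fun k => by positivity] at h9
  simpa using congr_fun h9 0

variable (σ : Measure ℝ) [IsFiniteMeasure σ]

theorem convPow_real_univ (n : ℕ) : (convPow σ n).real Set.univ = σ.real Set.univ ^ n := by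
  have := charFun_convPow σ n 0
  rw [charFun_zero, charFun_zero] at this
  exact_mod_cast this

/-- The measure `∑_{l ≥ 1} σ^{*l} / l!`. -/
noncomputable def convExp : Measure ℝ :=
  Measure.sum fun l : ℕ => ENNReal.ofReal (1 / (l + 1).factorial) • convPow σ (l + 1)

instance isFiniteMeasure_convExp : IsFiniteMeasure (convExp σ) := by
  refine ⟨lt_top_iff_ne_top.2 ?_⟩
  rw [convExp, Measure.sum_apply _ MeasurableSet.univ]
  have h : ∀ l : ℕ, (ENNReal.ofReal (1 / (l + 1).factorial) • convPow σ (l + 1)) Set.univ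
      = ENNReal.ofReal (σ.real Set.univ ^ (l + 1) / (l + 1).factorial) := fun l => by
    rw [Measure.smul_apply, smul_eq_mul, ← ofReal_measureReal, convPow_real_univ,
      ← ENNReal.ofReal_mul (by positivity)]
    congr 1
    ring
  simp_rw [h]
  exact ((summable_nat_add_iff 1).2 (Real.summable_pow_div_factorial _)).tsum_ofReal_ne_top

theorem hasSum_exp_sub_one (z : ℂ) :
    HasSum (fun l : ℕ => z ^ (l + 1) / (l + 1).factorial) (Complex.exp z - 1) := by
  have h := NormedSpace.expSeries_div_hasSum_exp z
  rw [← Complex.exp_eq_exp_ℂ] at h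
  simpa using (hasSum_nat_add_iff' 1).2 h

theorem charFun_convExp (t : ℝ) : charFun (convExp σ) t = Complex.exp (charFun σ t) - 1 := by
  refine HasSum.unique ?_ (hasSum_exp_sub_one _)
  have h := hasSum_integral_measure (isCharacterSystem_real.integrable (convExp σ) t)
  change HasSum _ (∫ x : ℝ, Complex.exp (t * x * Complex.I) ∂convExp σ) at h
  rw [← charFun_apply_real] at h
  refine (hasSum_congr_fun fun l => ?_).1 h
  rw [integral_smul_measure, ← charFun_apply_real, charFun_convPow,
    ENNReal.toReal_ofReal (by positivity), Complex.real_smul]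
  push_cast
  ring

omit [IsFiniteMeasure σ] in
theorem convPow_absolutelyContinuous_convExp (l : ℕ) : convPow σ (l + 1) ≪ convExp σ := by
  refine Measure.absolutelyContinuous_sum_right l ?_
  refine Measure.AbsolutelyContinuous.mk fun S _ h => ?_
  rw [Measure.smul_apply, smul_eq_mul, mul_eq_zero] at h
  refine h.resolve_left ?_
  rw [ENNReal.ofReal_eq_zero, not_le]
  positivity

omit [IsFiniteMeasure σ] in
theorem convExp_mutuallySingular (h : ∀ k ≠ 0, convPow σ k ⟂ₘ volume) :
    convExp σ ⟂ₘ volume := by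
  rw [convExp, Measure.MutuallySingular.sum_left]
  exact fun l => (h (l + 1) l.succ_ne_zero).smul _

variable {σ} {H : Type*} [NormedAddCommGroup H] [InnerProductSpace ℂ H] {V : ℝ → H ≃ₗᵢ[ℂ] H}
  {μ : Measure ℝ} {m : ℝ → ℕ∞}

/-- The coefficients of the joint spectral densities of Wick exponentials. -/
theorem integrable_and_hasSum_of_wick [IsFiniteMeasure μ] (hac : ∀ l, convPow σ (l + 1) ≪ μ)
    (c : ℝ) : (∀ᵐ x ∂μ, Summable fun l : ℕ => ((c ^ (l + 1) / (l + 1).factorial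
        * ((convPow σ (l + 1)).rnDeriv μ x).toReal : ℝ) : ℂ)) ∧
      Integrable (fun x => ∑' l : ℕ, ((c ^ (l + 1) / (l + 1).factorial
        * ((convPow σ (l + 1)).rnDeriv μ x).toReal : ℝ) : ℂ)) μ ∧
      ∀ t : ℝ, ∫ x : ℝ, Complex.exp (t * x * Complex.I) * ∑' l : ℕ, ((c ^ (l + 1) / (l + 1).factorial
        * ((convPow σ (l + 1)).rnDeriv μ x).toReal : ℝ) : ℂ) ∂μ
          = Complex.exp (c * charFun σ t) - 1 := by
  set F : ℕ → ℝ → ℂ := fun l x => ((c ^ (l + 1) / (l + 1).factorial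
        * ((convPow σ (l + 1)).rnDeriv μ x).toReal : ℝ) : ℂ) with hFdef
  have hF : ∀ l, Integrable (F l) μ := fun l =>
    (Measure.integrable_toReal_rnDeriv.const_mul _).ofReal
  have hnorm : ∀ l, ∫ x, ‖F l x‖ ∂μ
      = (|c| * σ.real Set.univ) ^ (l + 1) / (l + 1).factorial := fun l => by
    have h1 : ∀ x, ‖F l x‖ = |c| ^ (l + 1) / (l + 1).factorial
        * ((convPow σ (l + 1)).rnDeriv μ x).toReal := fun x => by
      rw [hFdef, Complex.norm_real, Real.norm_eq_abs, abs_mul, abs_div, abs_pow, Nat.abs_cast,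
        abs_of_nonneg ENNReal.toReal_nonneg]
    simp_rw [h1]
    rw [integral_const_mul, Measure.integral_toReal_rnDeriv (hac l), convPow_real_univ]
    ring
  have hs : Summable fun l => ∫ x, ‖F l x‖ ∂μ := by
    simp_rw [hnorm]
    exact (summable_nat_add_iff 1).2 (Real.summable_pow_div_factorial _)
  obtain ⟨h1, h2⟩ := ae_summable_and_integrable_tsum hF hs
  refine ⟨h1, h2, fun t => ?_⟩
  have hχ := isCharacterSystem_real
  have h3 := hasSum_integral_of_summable_integral_norm (fun l => hχ.integrable_mul (hF l) t)
    (by simpa only [norm_mul, hχ.norm_eq, one_mul] using hs)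
  simp_rw [tsum_mul_left] at h3
  refine h3.unique ((hasSum_congr_fun fun l => ?_).1 (hasSum_exp_sub_one (c * charFun σ t)))
  have h4 := integral_rnDeriv_smul (hac l) (f := fun x : ℝ => Complex.exp (t * x * Complex.I))
  rw [← charFun_apply_real, charFun_convPow] at h4
  rw [mul_pow, ← h4, mul_div_right_comm, ← integral_const_mul]
  refine integral_congr_ae (Eventually.of_forall fun x => ?_)
  simp only [hFdef, Complex.real_smul]
  push_cast
  ring

/-- Vandermonde with the distinct nodes `(a + 1) ^ L`; the initial exponent is absorbed into the
unknowns, which the nonzero nodes allow. -/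
theorem eq_zero_of_forall_sum_mul_pow_eq_zero {n L j₀ : ℕ} (hL : L ≠ 0) {ξ : Fin n → ℂ}
    (h : ∀ j ≥ j₀, ∑ a, ξ a * ((a : ℕ) + 1 : ℂ) ^ (L * (j + 1)) = 0) : ξ = 0 := by
  have hinj : Function.Injective fun a : Fin n => ((a : ℕ) + 1 : ℂ) ^ L := by
    intro a b hab
    dsimp only at hab
    have h1 : ((a : ℕ) + 1) ^ L = ((b : ℕ) + 1) ^ L := by exact_mod_cast hab
    have h2 := Nat.pow_left_injective hL h1
    exact Fin.ext (by simpa using h2)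
  have h1 := Matrix.eq_zero_of_forall_pow_sum_mul_pow_eq_zero hinj
    (v := fun a => ξ a * ((a : ℕ) + 1 : ℂ) ^ (L * (j₀ + 1))) fun i => by
      rw [← h (j₀ + i) (by omega)]
      refine Finset.sum_congr rfl fun a _ => ?_
      rw [mul_assoc, ← pow_mul, ← pow_add]
      congr 2
      ring
  funext a
  refine (mul_eq_zero.1 (congr_fun h1 a)).resolve_right (pow_ne_zero _ ?_)
  exact_mod_cast Nat.succ_ne_zero a

/-- The quadratic form equals `∑ ρ l / (l + 1)! * |∑ ξ a * c a ^ (l + 1)|²`, a series of nonnegative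
terms, so each term vanishes separately. -/
theorem eq_zero_of_quadratic_eq_zero {n : ℕ} {c : Fin n → ℝ} {ρ : ℕ → ℝ} (hρ : ∀ l, 0 ≤ ρ l)
    (hs : ∀ a b, Summable fun l : ℕ =>
      (((c a * c b) ^ (l + 1) / (l + 1).factorial * ρ l : ℝ) : ℂ)) {ξ : Fin n → ℂ}
    (h : ∑ a, ∑ b, starRingEnd ℂ (ξ a) * ξ b * ∑' l : ℕ,
      (((c a * c b) ^ (l + 1) / (l + 1).factorial * ρ l : ℝ) : ℂ) = 0) (l : ℕ) (hl : ρ l ≠ 0) :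
    ∑ a, ξ a * (c a : ℂ) ^ (l + 1) = 0 := by
  have h1 : HasSum (fun l : ℕ => ∑ a, ∑ b, starRingEnd ℂ (ξ a) * ξ b *
      (((c a * c b) ^ (l + 1) / (l + 1).factorial * ρ l : ℝ) : ℂ)) 0 := by
    rw [← h]
    exact hasSum_sum fun a _ => hasSum_sum fun b _ => (hs a b).hasSum.mul_left _
  have h2 : HasSum (fun l : ℕ => ρ l / (l + 1).factorial * ‖∑ a, ξ a * (c a : ℂ) ^ (l + 1)‖ ^ 2)
      0 := by
    rw [← Complex.hasSum_ofReal, Complex.ofReal_zero]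
    refine (hasSum_congr_fun fun l => ?_).1 h1
    push_cast
    rw [← Complex.conj_mul', _root_.map_sum, Finset.sum_mul_sum, Finset.mul_sum]
    refine Finset.sum_congr rfl fun a _ => ?_
    rw [Finset.mul_sum]
    refine Finset.sum_congr rfl fun b _ => ?_
    rw [map_mul, map_pow, Complex.conj_ofReal]
    ring
  rw [hasSum_zero_iff_of_nonneg fun k => by have := hρ k; positivity] at h2
  have h3 := congr_fun h2 l
  have h4 : ρ l / (l + 1).factorial ≠ 0 := div_ne_zero hl (by positivity)
  simpa [h4] using h3

/-- If the spectral measure of a Gaussian vector has a convolution power which is not singular,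
then the multiplicity is infinite on the absolutely continuous part of the spectrum. -/
theorem IsSpectralModel.ae_eq_top_of_wick
    (hM : IsSpectralModel (fun (t x : ℝ) => Complex.exp (t * x * Complex.I)) V μ m)
    {v : ℝ → H}
    (hv : ∀ c d t, inner ℂ (v c) (V t (v d)) = Complex.exp ((c * d : ℝ) * charFun σ t) - 1)
    (hreal : ∀ t, starRingEnd ℂ (charFun σ t) = charFun σ t) {k : ℕ} (hk : k ≠ 0)
    (hσ : ¬ convPow σ k ⟂ₘ volume) {A : Set ℝ} (hA : MeasurableSet A)
    (hμA : μ.restrict A ≪ volume) : ∀ᵐ x ∂μ, x ∈ A → m x = ⊤ := by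
  have := hM.finite
  obtain ⟨L, hL, δ, hδ, hLδ⟩ := exists_restrict_Ioo_absolutelyContinuous_convPow hreal hk hσ
  -- The vector `v 1` has spectral measure `convExp σ`, which dominates every positive convolution
  -- power.
  have hac : ∀ l, convPow σ (l + 1) ≪ μ := fun l =>
    (convPow_absolutelyContinuous_convExp σ l).trans
      (hM.absolutelyContinuous isCharacterSystem_real (g := v 1) fun t => by
        rw [hv, ← charFun_apply_real, charFun_convExp]
        simp)
  -- The zero set of the density is null for the convolution power, hence Lebesgue null within the
  -- interval, hence `μ`-null within `A`.
  have hpos : ∀ j : ℕ, ∀ᵐ x ∂μ, x ∈ A → x ∈ Set.Ioo (-((j + 1) * δ)) ((j + 1) * δ) →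
      (convPow σ (L * (j + 1))).rnDeriv μ x ≠ 0 := by
    intro j
    set ρ := (convPow σ (L * (j + 1))).rnDeriv μ
    have hρ : MeasurableSet {x | ρ x = 0} :=
      (Measure.measurable_rnDeriv _ _) (measurableSet_singleton 0)
    have hacj : convPow σ (L * (j + 1)) ≪ μ := by
      have h1 : L * (j + 1) ≠ 0 := mul_ne_zero hL j.succ_ne_zero
      obtain ⟨l, hl⟩ := Nat.exists_eq_succ_of_ne_zero h1
      rw [hl]
      exact hac l
    have h0 : convPow σ (L * (j + 1)) {x | ρ x = 0} = 0 := by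
      rw [← Measure.setLIntegral_rnDeriv hacj]
      exact setLIntegral_eq_zero hρ fun x hx => hx
    have h1 := hLδ j h0
    rw [Measure.restrict_apply hρ, measure_eq_zero_iff_ae_notMem] at h1
    rw [← ae_restrict_iff' hA]
    filter_upwards [hμA.ae_le h1] with x hx hx' h
    exact hx ⟨h, hx'⟩
  have hn : ∀ n : ℕ, ∀ᵐ x ∂μ, x ∈ A → (n : ℕ∞) ≤ m x := by
    intro n
    -- The `n` vectors are `v 1, …, v n`; starting at 1 makes all Vandermonde nodes nonzero.
    let c : Fin n → ℝ := fun a => (a : ℕ) + 1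
    have hG := fun a b => integrable_and_hasSum_of_wick hac (c a * c b)
    filter_upwards [hM.le_of_forall_quadratic isCharacterSystem_real (fun a => v (c a)) _
      (fun a b => (hG a b).2.1) (fun a b t => by rw [hv, (hG a b).2.2]), ae_all_iff.2 hpos,
      ae_all_iff.2 fun a => ae_all_iff.2 fun b => (hG a b).1,
      ae_all_iff.2 fun l => Measure.rnDeriv_lt_top (convPow σ l) μ] with x h1 h2 h3 h4 hxA
    refine h1 fun ξ hξ => ?_
    -- From `j₀` on the intervals contain `x`, so every power with exponent `L * (j + 1)` has
    -- nonzero density there.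
    obtain ⟨j₀, hj₀⟩ := exists_nat_gt (|x| / δ)
    refine eq_zero_of_forall_sum_mul_pow_eq_zero (L := L) (j₀ := j₀) hL fun j hj => ?_
    have h5 : L * (j + 1) ≠ 0 := mul_ne_zero hL j.succ_ne_zero
    obtain ⟨l, hl⟩ := Nat.exists_eq_succ_of_ne_zero h5
    have h6 : x ∈ Set.Ioo (-((j + 1) * δ)) ((j + 1) * δ) := by
      rw [Set.mem_Ioo, ← abs_lt, ← div_lt_iff₀ hδ]
      have : (j₀ : ℝ) ≤ j := by exact_mod_cast hj
      linarith
    have h7 := h2 j hxA h6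
    rw [hl] at h7 ⊢
    have h8 := eq_zero_of_quadratic_eq_zero (c := c) (fun l => ENNReal.toReal_nonneg) h3 hξ l
      (ENNReal.toReal_ne_zero.2 ⟨h7, (h4 _).ne⟩)
    simpa [c] using h8
  filter_upwards [ae_all_iff.2 hn] with x hx hxA
  exact ENat.eq_top_iff_forall_ge.2 fun n => hx n hxA

end FockSpectrum

/-! ### Multiplicities of Gaussian flows -/

section GaussianFlow

/-- Lebesgue decomposition on the line, as a splitting of the space. -/
theorem exists_null_restrict_compl_absolutelyContinuous (μ : Measure ℝ) [IsFiniteMeasure μ] :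
    ∃ N, MeasurableSet N ∧ volume N = 0 ∧ μ.restrict Nᶜ ≪ volume := by
  obtain ⟨s, hs, hs0, hs1⟩ := Measure.mutuallySingular_singularPart μ volume
  refine ⟨sᶜ, hs.compl, hs1, ?_⟩
  rw [compl_compl, μ.haveLebesgueDecomposition_add volume, Measure.restrict_add,
    Measure.restrict_eq_zero.2 hs0, zero_add]
  exact Measure.restrict_le_self.absolutelyContinuous.trans (withDensity_absolutelyContinuous _ _)

variable {Ω : Type*} [MeasurableSpace Ω] {P : Measure Ω} [IsProbabilityMeasure P]

namespace MeasurePreservingFlow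

variable (G : MeasurePreservingFlow P)

/-- The action of the flow on the real space `L²(Ω, P)`. -/
noncomputable def koopmanReal (t : ℝ) : Lp ℝ 2 P →ₗᵢ[ℝ] Lp ℝ 2 P :=
  Lp.compMeasurePreservingₗᵢ ℝ (G.toFun t) (G.measurePreserving t)

omit [IsProbabilityMeasure P] in
theorem koopmanReal_ae (t : ℝ) (f : Lp ℝ 2 P) : G.koopmanReal t f =ᵐ[P] f ∘ G.toFun t :=
  Lp.coeFn_compMeasurePreserving f (G.measurePreserving t)

theorem koopman_wickExp (t : ℝ) (f : Lp ℝ 2 P) :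
    G.koopman t (wickExp f) = wickExp (G.koopmanReal t f) := by
  apply Lp.ext
  have h1 := (G.measurePreserving t).quasiMeasurePreserving.ae_eq_comp (wickExp_ae f)
  filter_upwards [G.koopman_ae t (wickExp f), h1, wickExp_ae (G.koopmanReal t f),
    G.koopmanReal_ae t f] with ω h2 h3 h4 h5
  rw [h2, h3, h4, h5, (G.koopmanReal t).norm_map]
  rfl

/-- Bochner's theorem is applied to the complexification of `f`. The correlations are real, which
later makes the measure symmetric. -/
theorem exists_isSpectralMeasure_real {f : Lp ℝ 2 P} (hf : ∫ ω, f ω ∂P = 0) :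
    ∃ σ : Measure ℝ, IsFiniteMeasure σ ∧
      ∀ t, charFun σ t = (inner ℝ f (G.koopmanReal t f) : ℝ) := by
  let g : Lp ℂ 2 P := Complex.ofRealCLM.compLp f
  have hg : g =ᵐ[P] fun ω => (f ω : ℂ) := Complex.ofRealCLM.coeFn_compLp f
  have hg0 : g ∈ L2Zero P := by
    rw [mem_L2Zero_iff, integral_congr_ae hg, integral_complex_ofReal, hf, Complex.ofReal_zero]
  obtain ⟨σ, hσ, hσg⟩ := G.koopmanFlow.exists_isSpectralMeasure ⟨g, hg0⟩
  refine ⟨σ, hσ, fun t => ?_⟩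
  rw [charFun_apply_real, ← hσg t]
  change inner ℂ g (G.koopman t g) = _
  rw [L2.inner_def, L2.inner_def, ← integral_complex_ofReal]
  refine integral_congr_ae ?_
  have h1 := (G.measurePreserving t).quasiMeasurePreserving.ae_eq_comp hg
  filter_upwards [hg, G.koopman_ae t g, h1, G.koopmanReal_ae t f] with ω h2 h3 h4 h5
  rw [h2, h3, h4, h5]
  simp

theorem exists_ae_multiplicitySet_eq [StandardBorelSpace Ω] (hG : G.IsGaussian) :
    ∃ S : Set ℕ∞, ∀ᵐ t : ℝ, G.multiplicitySet t = S := by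
  obtain ⟨V, -, hV, hinv, hgen⟩ := hG
  replace hinv : ∀ t, ∀ f ∈ V, G.koopmanReal t f ∈ V := hinv
  have hmem : ∀ f ∈ V, wickExp f ∈ L2Zero P := fun f hf => by
    obtain ⟨v, hv⟩ := hV f hf
    rw [mem_L2Zero_iff, integral_wickExp hv]
  have hrep : IsUnitaryRep G.koopmanZero := G.koopmanFlow.isUnitaryRep
  have hsep : TopologicalSpace.SeparableSpace (L2Zero P) := by
    have : Fact ((2 : ℝ≥0∞) ≠ ∞) := ⟨by simp⟩
    infer_instance
  obtain ⟨μ, m, hM⟩ := exists_isSpectralModel isCharacterSystem_real hrep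
    G.koopmanFlow.exists_isSpectralMeasure
  have := hM.finite
  obtain ⟨N, hN, hN0, hμN⟩ := exists_null_restrict_compl_absolutelyContinuous μ
  refine ⟨_, ae_multiplicitySet_eq hrep hM hN hN0 ?_⟩
  have hσ : ∀ f ∈ V, ∃ σ : Measure ℝ, IsFiniteMeasure σ ∧
      (∀ t, charFun σ t = (inner ℝ f (G.koopmanReal t f) : ℝ)) := fun f hf => by
    obtain ⟨v, hv⟩ := hV f hf
    exact G.exists_isSpectralMeasure_real (integral_eq_zero_of_gaussian hv)
  choose! σ hσfin hσ using hσ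
  have hv : ∀ f (hf : f ∈ V) (c d t : ℝ),
      inner ℂ (⟨wickExp (c • f), hmem _ (V.smul_mem c hf)⟩ : L2Zero P)
        (G.koopmanZero t ⟨wickExp (d • f), hmem _ (V.smul_mem d hf)⟩)
      = Complex.exp ((c * d : ℝ) * charFun (σ f) t) - 1 := fun f hf c d t => by
    change inner ℂ (wickExp (c • f)) (G.koopman t (wickExp (d • f))) = _
    rw [koopman_wickExp, inner_wickExp_wickExp hV (V.smul_mem c hf) (hinv t _ (V.smul_mem d hf)),
      _root_.map_smul, inner_smul_left, inner_smul_right, hσ f hf]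
    congr 2
    push_cast
    simp only [conj_trivial]
    ring
  -- Either no convolution power meets Lebesgue measure, and there is no spectrum outside `N`, or
  -- some power does, and the multiplicity outside `N` is infinite.
  by_cases hsing : ∀ f ∈ V, ∀ k ≠ 0, convPow (σ f) k ⟂ₘ volume
  · obtain ⟨F, -, hF, hw⟩ := hM.exists_field isCharacterSystem_real
    -- The vector `w` is the indicator of `Nᶜ` in coordinate `0`. Each Wick exponential has a
    -- singular spectral measure, so its field vanishes on `Nᶜ` and it is orthogonal to `w`.
    -- Totality gives `w = 0`, that is, `μ Nᶜ = 0`.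
    obtain ⟨w, hw1, hw2⟩ := hw Nᶜ hN.compl
    have hw0 : w = 0 := by
      have h0 : (w : Lp ℂ 2 P) = 0 := by
        refine eq_zero_of_forall_inner_wickExp hgen w.2 fun f hf => ?_
        rw [← inner_conj_symm]
        have h1 := hw1 ⟨wickExp f, hmem f hf⟩
        have := hσfin f hf
        obtain ⟨h2, h3, h4⟩ := hF ⟨wickExp f, hmem f hf⟩ ⟨wickExp f, hmem f hf⟩
        have h5 := IsSpectralModel.ae_eq_zero_of_mutuallySingular isCharacterSystem_real h2 h3 h4
          (τ := convExp (σ f)) (fun t => by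
            have := hv f hf 1 1 t
            simp only [one_smul] at this
            rw [this, ← charFun_apply_real, charFun_convExp]
            simp) (A := Nᶜ) ((convExp_mutuallySingular _ (hsing f hf)).mono_ac
              Measure.AbsolutelyContinuous.rfl hμN)
        rw [integral_eq_zero_of_ae h5] at h1
        change inner ℂ (w : Lp ℂ 2 P) (wickExp f) = 0 at h1
        rw [h1, _root_.map_zero]
      exact Subtype.ext h0
    filter_upwards [measure_eq_zero_iff_ae_notMem.1 (hw2 hw0)] with x hx hxN
    exact (hx hxN).elim
  · push Not at hsing
    obtain ⟨f, hf, k, hk, hfk⟩ := hsing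
    have := hσfin f hf
    exact hM.ae_eq_top_of_wick (hv f hf) (fun t => by rw [hσ f hf, Complex.conj_ofReal]) hk hfk
      hN.compl hμN

end MeasurePreservingFlow

end GaussianFlow

theorem mainTheorem7
    {H : Type*} [NormedAddCommGroup H] [InnerProductSpace ℂ H] [CompleteSpace H]
    [TopologicalSpace.SeparableSpace H] (U : UnitaryFlow H)
    {Ω : Type*} [MeasurableSpace Ω] [StandardBorelSpace Ω] (P : Measure Ω) [IsProbabilityMeasure P]
    (G : MeasurePreservingFlow P) :
    (U.HasSimpleSpectrum → U.HasSingularSpectrum →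
      ∀ᵐ t : ℝ, HasSimpleSpectrum (U.toFun t)) ∧
    (U.HasSingularSpectrum →
      ∀ᵐ t : ℝ, multiplicitySet (U.toFun t) = U.multiplicitySet) ∧
    (G.IsGaussian →
      ∃ S : Set ℕ∞, ∀ᵐ t : ℝ, G.multiplicitySet t = S) :=
  ⟨U.ae_hasSimpleSpectrum, U.ae_multiplicitySet_eq_of_hasSingularSpectrum,
    G.exists_ae_multiplicitySet_eq⟩
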